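/- Let $\ell,\rho_1,\rho_2,\rho_3,k,k_0,b,\varpi,l,\gamma>0$ with $l\ell\neq n\pi$ for all $n=1,2,3,\dots$. Let $\mu,\nu:(0,\infty)\to(0,\infty)$ be nonincreasing, absolutely continuous, summable and bounded near zero (i.e. with finite limits at $0^+$), such that $\int_0^\infty\!\int_s^\infty\mu(r)\,dr\,ds=\int_0^\infty\!\int_s^\infty\nu(r)\,dr\,ds=1$ and, for some $\delta_\mu,\delta_\nu>0$, $\mu'(s)+\delta_\mu\mu(s)\le 0$ and $\nu'(s)+\delta_\nu\nu(s)\le0$ for a.e. $s>0$. Let $L^2,H^1,H^1_0,H^2$ be the complex Lebesgue and Sobolev spaces on $(0,\ell)$, with $\|\cdot\|$ the norm of $L^2$; let $H^1_0$ carry the norm $\|f_x\|$, and set $L^2_*=\{f\in L^2:\int_0^\ell f\,dx=0\}$ and $H^1_*=H^1\cap L^2_*$. Let $\mathcal M=L^2_\mu(\mathbb R^+;H_0^1)$ and $\mathcal N=L^2_\nu(\mathbb R^+;H_0^1)$ be the square summable $H^1_0$-valued functions on $\mathbb R^+=(0,\infty)$ with respect to $\mu(s)\,ds$ and $\nu(s)\,ds$.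 On $\mathcal M$ let $T\eta=-\eta'$ (weak derivative in $s$), with domain $\mathcal D(T)=\{\eta\in\mathcal M:\eta'\in\mathcal M,\ \lim_{s\to0}\|\eta_x(s)\|=0\}$, and define $T$ on $\mathcal N$ in the same way. Let $$\mathcal H=H_0^1\times L^2\times H_*^1\times L_*^2\times H_*^1\times L_*^2\times L^2\times\mathcal M\times L^2\times\mathcal N,$$ whose elements are denoted by $u=(\varphi,\Phi,\psi,\Psi,w,W,\vartheta,\eta,\xi,\zeta)$, be equipped with the Hilbert norm $$\|u\|_{\mathcal H}^2=k\|\varphi_x+\psi+lw\|^2+\rho_1\|\Phi\|^2+b\|\psi_x\|^2+\rho_2\|\Psi\|^2+k_0\|w_x-l\varphi\|^2+\rho_1\|W\|^2+\rho_3\|\vartheta\|^2+\varpi\|\eta\|_{\mathcal M}^2+\rho_3\|\xi\|^2+\varpi\|\zeta\|_{\mathcal N}^2 .$$ Let $\mathsf A$ be the Bresse–Gurtin–Pipkin operator on $\mathcal H$, whose domain $\mathcal D(\mathsf A)$ is the set of those $u\in\mathcal H$ with $\varphi\in H^2$; $\Phi,\psi_x,w_x\in H^1_0$; $\Psi,W\in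 H^1$; $\vartheta,\xi\in H^1_0$; $\int_0^\infty\mu(s)\eta(s)\,ds,\ \int_0^\infty\nu(s)\zeta(s)\,ds\in H^2$; $\eta,\zeta\in\mathcal D(T)$, and such that the components of $\mathsf A u$ are, in this order, $$\begin{aligned} &\Phi,\qquad \tfrac{k}{\rho_1}(\varphi_x+\psi+lw)_x+\tfrac{lk_0}{\rho_1}(w_x-l\varphi)-\tfrac{l\gamma}{\rho_1}\xi,\\ &\Psi,\qquad \tfrac{b}{\rho_2}\psi_{xx}-\tfrac{k}{\rho_2}(\varphi_x+\psi+lw)-\tfrac{\gamma}{\rho_2}\vartheta_x,\\ &W,\qquad \tfrac{k_0}{\rho_1}(w_x-l\varphi)_x-\tfrac{lk}{\rho_1}(\varphi_x+\psi+lw)-\tfrac{\gamma}{\rho_1}\xi_x,\\ &\tfrac{\varpi}{\rho_3}\Big(\int_0^\infty\mu(s)\eta(s)\,ds\Big)_{xx}-\tfrac{\gamma}{\rho_3}\Psi_x,\qquad T\eta+\vartheta,\\ &\tfrac{\varpi}{\rho_3}\Big(\int_0^\infty\nu(s)\zeta(s)\,ds\Big)_{xx}-\tfrac{\gamma}{\rho_3}(W_x-l\Phi),\qquad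 T\zeta+\xi . \end{aligned}$$ Then $i\mathbb R\subset\varrho(\mathsf A)$: for every $\lambda\in\mathbb R$ the operator $i\lambda-\mathsf A:\mathcal D(\mathsf A)\to\mathcal H$ is bijective with bounded inverse. -/

import Mathlib

noncomputable section

open MeasureTheory Set Filter Topology
open scoped ContDiff ComplexConjugate InnerProductSpace

namespace Bresse

/-! ### Weak derivatives and Sobolev spaces on the interval `(0, ℓ)` -/

/-- The complex Lebesgue space `L²(0, ℓ)`. -/
abbrev L2 (ℓ : ℝ) := Lp ℂ 2 (volume.restrict (Ioo (0 : ℝ) ℓ))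

/-- Smooth complex functions with compact support in the open interval `(0, ℓ)`. -/
structure IsTest (ℓ : ℝ) (v : ℝ → ℂ) : Prop where
  smooth : ContDiff ℝ ∞ v
  compact : HasCompactSupport v
  support : tsupport v ⊆ Ioo (0 : ℝ) ℓ

/-- `g ∈ L²(0, ℓ)` is the weak derivative of `f ∈ L²(0, ℓ)`. -/
def HasWeakDeriv (ℓ : ℝ) (f g : L2 ℓ) : Prop :=
  ∀ v : ℝ → ℂ, IsTest ℓ v →
    ∫ x in Ioo (0 : ℝ) ℓ, f x * deriv v x = -∫ x in Ioo (0 : ℝ) ℓ, g x * v x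

section basic

variable {ℓ : ℝ}

lemma memLp_of_continuous {v : ℝ → ℂ} (hv : Continuous v) :
    MemLp v 2 (volume.restrict (Ioo (0 : ℝ) ℓ)) := by
  obtain ⟨C, hC⟩ := (isCompact_Icc (a := (0 : ℝ)) (b := ℓ)).exists_bound_of_continuousOn
    hv.continuousOn
  refine MemLp.of_bound hv.aestronglyMeasurable C ?_
  filter_upwards [ae_restrict_mem measurableSet_Ioo] with x hx
  exact hC x (Ioo_subset_Icc_self hx)

/-- The continuous functional `f ↦ ∫ f v` on `L²(0, ℓ)` for a continuous weight `v`. -/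
def pairing {v : ℝ → ℂ} (hv : Continuous v) : L2 ℓ →L[ℂ] ℂ :=
  innerSL ℂ ((memLp_of_continuous (ℓ := ℓ)
    (Complex.continuous_conj.comp hv)).toLp (fun x => conj (v x)))

lemma pairing_apply {v : ℝ → ℂ} (hv : Continuous v) (f : L2 ℓ) :
    pairing hv f = ∫ x in Ioo (0 : ℝ) ℓ, f x * v x := by
  rw [pairing, innerSL_apply_apply, L2.inner_def]
  refine integral_congr_ae ?_
  filter_upwards [MemLp.coeFn_toLp (memLp_of_continuous (ℓ := ℓ)
    (Complex.continuous_conj.comp hv))] with x hx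
  simp only [Function.comp_def] at hx
  rw [hx]
  simp

lemma IsTest.continuous_deriv {v : ℝ → ℂ} (hv : IsTest ℓ v) : Continuous (deriv v) :=
  hv.smooth.continuous_deriv (by simp)

lemma hasWeakDeriv_iff {f g : L2 ℓ} : HasWeakDeriv ℓ f g ↔ ∀ (v : ℝ → ℂ) (hv : IsTest ℓ v),
    pairing hv.continuous_deriv f + pairing hv.smooth.continuous g = 0 := by
  simp only [HasWeakDeriv, pairing_apply, eq_neg_iff_add_eq_zero]

lemma HasWeakDeriv.add {f₁ f₂ g₁ g₂ : L2 ℓ} (h₁ : HasWeakDeriv ℓ f₁ g₁)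
    (h₂ : HasWeakDeriv ℓ f₂ g₂) : HasWeakDeriv ℓ (f₁ + f₂) (g₁ + g₂) := by
  rw [hasWeakDeriv_iff] at *
  intro v hv
  rw [map_add, map_add]
  linear_combination h₁ v hv + h₂ v hv

lemma HasWeakDeriv.smul {f g : L2 ℓ} (c : ℂ) (h : HasWeakDeriv ℓ f g) :
    HasWeakDeriv ℓ (c • f) (c • g) := by
  rw [hasWeakDeriv_iff] at *
  intro v hv
  rw [map_smul, map_smul, smul_eq_mul, smul_eq_mul]
  linear_combination c * h v hv

lemma hasWeakDeriv_zero : HasWeakDeriv ℓ 0 0 := by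
  rw [hasWeakDeriv_iff]
  simp

/-- Fundamental lemma of the calculus of variations. -/
lemma ae_zero_of_forall_test (y : L2 ℓ)
    (h : ∀ v : ℝ → ℂ, IsTest ℓ v → ∫ x in Ioo (0 : ℝ) ℓ, y x * v x = 0) : y = 0 := by
  have hint : IntegrableOn y (Ioo (0 : ℝ) ℓ) :=
    (Lp.memLp y).integrable (by norm_num)
  have := isOpen_Ioo.ae_eq_zero_of_integral_contDiff_smul_eq_zero (μ := volume) (f := y)
    (U := Ioo (0 : ℝ) ℓ) hint.locallyIntegrableOn (by
      intro g hg hc hs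
      have h1 := h (fun x => (g x : ℂ)) ⟨Complex.ofRealCLM.contDiff.comp hg,
        hc.comp_left (g := fun t : ℝ => (t : ℂ)) (by simp),
        (tsupport_comp_subset (g := fun t : ℝ => (t : ℂ)) (by simp) g).trans hs⟩
      rw [← h1, ← integral_indicator measurableSet_Ioo]
      refine integral_congr_ae (Eventually.of_forall fun x => ?_)
      by_cases hx : x ∈ Ioo (0 : ℝ) ℓ
      · simp [hx, mul_comm]
      · have : g x = 0 := image_eq_zero_of_notMem_tsupport fun hx' => hx (hs hx')
        simp [hx, this])
  rw [Lp.eq_zero_iff_ae_eq_zero]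
  rw [← ae_restrict_iff' measurableSet_Ioo] at this
  exact this

lemma HasWeakDeriv.unique {f g₁ g₂ : L2 ℓ} (h₁ : HasWeakDeriv ℓ f g₁)
    (h₂ : HasWeakDeriv ℓ f g₂) : g₁ = g₂ := by
  rw [← sub_eq_zero]
  refine ae_zero_of_forall_test _ fun v hv => ?_
  rw [hasWeakDeriv_iff] at h₁ h₂
  rw [← pairing_apply hv.smooth.continuous, map_sub]
  linear_combination h₁ v hv - h₂ v hv

end basic

open Classical in
/-- The weak derivative of `f`, with the value `0` if `f` has no weak derivative in `L²(0, ℓ)`. -/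
def weakDeriv {ℓ : ℝ} (f : L2 ℓ) : L2 ℓ :=
  if h : ∃ g, HasWeakDeriv ℓ f g then h.choose else 0

/-- The Sobolev space `H¹(0, ℓ)`. -/
def H1 (ℓ : ℝ) : Submodule ℂ (L2 ℓ) where
  carrier := {f | ∃ g, HasWeakDeriv ℓ f g}
  add_mem' := fun ⟨_, h₁⟩ ⟨_, h₂⟩ => ⟨_, h₁.add h₂⟩
  zero_mem' := ⟨0, hasWeakDeriv_zero⟩
  smul_mem' c _ := fun ⟨_, h⟩ => ⟨_, h.smul c⟩

section weakDeriv

variable {ℓ : ℝ}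

lemma HasWeakDeriv.weakDeriv_eq {f g : L2 ℓ} (h : HasWeakDeriv ℓ f g) : weakDeriv f = g := by
  have h' : ∃ g, HasWeakDeriv ℓ f g := ⟨g, h⟩
  rw [weakDeriv, dif_pos h']
  exact h'.choose_spec.unique h

lemma hasWeakDeriv_weakDeriv {f : L2 ℓ} (h : f ∈ H1 ℓ) : HasWeakDeriv ℓ f (weakDeriv f) := by
  obtain ⟨g, hg⟩ := h
  rwa [hg.weakDeriv_eq]

lemma weakDeriv_add {f g : L2 ℓ} (hf : f ∈ H1 ℓ) (hg : g ∈ H1 ℓ) :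
    weakDeriv (f + g) = weakDeriv f + weakDeriv g :=
  ((hasWeakDeriv_weakDeriv hf).add (hasWeakDeriv_weakDeriv hg)).weakDeriv_eq

lemma weakDeriv_smul (c : ℂ) {f : L2 ℓ} (hf : f ∈ H1 ℓ) :
    weakDeriv (c • f) = c • weakDeriv f :=
  ((hasWeakDeriv_weakDeriv hf).smul c).weakDeriv_eq

end weakDeriv

/-- The Sobolev space `H²(0, ℓ)`. -/
def H2 (ℓ : ℝ) : Submodule ℂ (L2 ℓ) where
  carrier := {f | f ∈ H1 ℓ ∧ weakDeriv f ∈ H1 ℓ}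
  add_mem' := fun ⟨h₁, h₁'⟩ ⟨h₂, h₂'⟩ =>
    ⟨(H1 ℓ).add_mem h₁ h₂, by rw [weakDeriv_add h₁ h₂]; exact (H1 ℓ).add_mem h₁' h₂'⟩
  zero_mem' := ⟨(H1 ℓ).zero_mem, by
    rw [hasWeakDeriv_zero.weakDeriv_eq]; exact (H1 ℓ).zero_mem⟩
  smul_mem' c _ := fun ⟨h, h'⟩ =>
    ⟨(H1 ℓ).smul_mem c h, by rw [weakDeriv_smul c h]; exact (H1 ℓ).smul_mem c h'⟩

/-- The pairs `(v, v')` in `L² × L²` with `v` a test function on `(0, ℓ)`. -/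
def testGraph (ℓ : ℝ) : Submodule ℂ (L2 ℓ × L2 ℓ) where
  carrier := {p | ∃ v : ℝ → ℂ, IsTest ℓ v ∧ p.1 =ᵐ[volume.restrict (Ioo (0 : ℝ) ℓ)] v ∧
    p.2 =ᵐ[volume.restrict (Ioo (0 : ℝ) ℓ)] deriv v}
  add_mem' := by
    rintro p q ⟨v, hv, h₁, h₂⟩ ⟨w, hw, h₃, h₄⟩
    refine ⟨v + w, ⟨hv.smooth.add hw.smooth, hv.compact.add hw.compact,
      (tsupport_add v w).trans (union_subset hv.support hw.support)⟩, ?_, ?_⟩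
    · exact (Lp.coeFn_add _ _).trans (h₁.add h₃)
    · refine (Lp.coeFn_add _ _).trans ((h₂.add h₄).trans (Eventually.of_forall fun x => ?_))
      exact (deriv_add (hv.smooth.differentiable (by simp) x)
        (hw.smooth.differentiable (by simp) x)).symm
  zero_mem' := ⟨0, ⟨contDiff_const, HasCompactSupport.zero, by simp [tsupport]⟩,
    Lp.coeFn_zero _ _ _, (Lp.coeFn_zero _ _ _).trans (Eventually.of_forall fun x => by simp)⟩
  smul_mem' := by
    rintro c p ⟨v, hv, h₁, h₂⟩
    refine ⟨c • v, ⟨contDiff_const.smul hv.smooth, hv.compact.smul_left (f := fun _ => c),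
      (closure_mono (Function.support_const_smul_subset c v)).trans hv.support⟩, ?_, ?_⟩
    · exact (Lp.coeFn_smul _ _).trans (h₁.const_smul c)
    · refine (Lp.coeFn_smul _ _).trans ((h₂.const_smul c).trans (Eventually.of_forall fun x => ?_))
      exact (deriv_const_smul c (hv.smooth.differentiable (by simp) x)).symm

/-- The Sobolev space `H¹₀(0, ℓ)`: the closure of the test functions in the norm
of `H¹(0, ℓ)`. -/
def H10sub (ℓ : ℝ) : Submodule ℂ (L2 ℓ) :=
  (testGraph ℓ).topologicalClosure.map (LinearMap.fst ℂ (L2 ℓ) (L2 ℓ))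

/-- The space `L²_*` of zero-mean functions. -/
def L2star (ℓ : ℝ) : Submodule ℂ (L2 ℓ) where
  carrier := {f | ∫ x in Ioo (0 : ℝ) ℓ, f x = 0}
  add_mem' := by
    intro f g hf hg
    have := map_add (pairing (ℓ := ℓ) (continuous_const (y := (1 : ℂ)))) f g
    simp only [pairing_apply, mul_one] at this
    simp only [mem_ofPred_eq] at *
    rw [this, hf, hg, add_zero]
  zero_mem' := by
    have := map_zero (pairing (ℓ := ℓ) (continuous_const (y := (1 : ℂ))))
    simp only [pairing_apply, mul_one] at this
    exact this
  smul_mem' := by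
    intro c f hf
    have := map_smul (pairing (ℓ := ℓ) (continuous_const (y := (1 : ℂ)))) c f
    simp only [pairing_apply, mul_one] at this
    simp only [mem_ofPred_eq] at *
    rw [this, hf, smul_zero]

/-- The space `H¹_* = H¹ ∩ L²_*`. -/
def H1star (ℓ : ℝ) : Submodule ℂ (L2 ℓ) := H1 ℓ ⊓ L2star ℓ

section H10

variable {ℓ : ℝ}

lemma mem_L2star_iff {f : L2 ℓ} :
    f ∈ L2star ℓ ↔ pairing (ℓ := ℓ) (continuous_const (y := (1 : ℂ))) f = 0 := by
  simp only [pairing_apply, mul_one]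
  rfl

lemma IsTest.eq_zero {v : ℝ → ℂ} (hv : IsTest ℓ v) {x : ℝ} (hx : x ∉ Ioo (0 : ℝ) ℓ) :
    v x = 0 :=
  image_eq_zero_of_notMem_tsupport fun h => hx (hv.support h)

/-- Integration by parts on test functions. -/
lemma IsTest.integral_deriv_mul {u v : ℝ → ℂ} (hu : IsTest ℓ u) (hv : ContDiff ℝ ∞ v) :
    ∫ x in Ioo (0 : ℝ) ℓ, deriv u x * v x = -∫ x in Ioo (0 : ℝ) ℓ, u x * deriv v x := by
  rcases le_or_gt ℓ 0 with h | h
  · simp [Ioo_eq_empty_of_le h]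
  have h1 := intervalIntegral.integral_deriv_mul_eq_sub (a := 0) (b := ℓ)
    (fun x _ => (hu.smooth.differentiable (by simp) x).hasDerivAt)
    (fun x _ => (hv.differentiable (by simp) x).hasDerivAt)
    (hu.continuous_deriv.intervalIntegrable _ _)
    ((hv.continuous_deriv (by simp)).intervalIntegrable _ _)
  rw [intervalIntegral.integral_add (f := fun x => deriv u x * v x)
    (g := fun x => u x * deriv v x) ((hu.continuous_deriv.mul hv.continuous).intervalIntegrable _ _)
    ((hu.smooth.continuous.mul (hv.continuous_deriv (by simp))).intervalIntegrable _ _),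
    hu.eq_zero (x := ℓ) (by simp), hu.eq_zero (x := 0) (by simp)] at h1
  rw [← integral_Ioc_eq_integral_Ioo, ← integral_Ioc_eq_integral_Ioo,
    ← intervalIntegral.integral_of_le h.le, ← intervalIntegral.integral_of_le h.le]
  linear_combination h1

lemma closure_integral {p : L2 ℓ × L2 ℓ} (hp : p ∈ (testGraph ℓ).topologicalClosure)
    {v : ℝ → ℂ} (hv : ContDiff ℝ ∞ v) :
    pairing (hv.continuous_deriv (by simp)) p.1 + pairing hv.continuous p.2 = 0 := by
  have hcl : IsClosed {p : L2 ℓ × L2 ℓ |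
      pairing (hv.continuous_deriv (by simp)) p.1 + pairing hv.continuous p.2 = 0} :=
    isClosed_eq (by fun_prop) continuous_const
  refine closure_minimal ?_ hcl hp
  rintro ⟨f, g⟩ ⟨u, hu, h₁, h₂⟩
  have e₁ : ∫ x in Ioo (0 : ℝ) ℓ, f x * deriv v x = ∫ x in Ioo (0 : ℝ) ℓ, u x * deriv v x :=
    integral_congr_ae (h₁.mul (ae_eq_refl _))
  have e₂ : ∫ x in Ioo (0 : ℝ) ℓ, g x * v x = ∫ x in Ioo (0 : ℝ) ℓ, deriv u x * v x :=
    integral_congr_ae (h₂.mul (ae_eq_refl _))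
  rw [mem_ofPred_eq, pairing_apply, pairing_apply, e₁, e₂, hu.integral_deriv_mul hv]
  ring

lemma closure_hasWeakDeriv {p : L2 ℓ × L2 ℓ} (hp : p ∈ (testGraph ℓ).topologicalClosure) :
    HasWeakDeriv ℓ p.1 p.2 := by
  rw [hasWeakDeriv_iff]
  exact fun v hv => closure_integral hp hv.smooth

lemma mem_H10sub_iff {f : L2 ℓ} :
    f ∈ H10sub ℓ ↔ (f, weakDeriv f) ∈ (testGraph ℓ).topologicalClosure := by
  constructor
  · rintro ⟨⟨f', g⟩, hp, rfl⟩
    have := (closure_hasWeakDeriv hp).weakDeriv_eq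
    simp only [LinearMap.fst_apply]
    simp only at this
    rw [this]
    exact hp
  · exact fun h => ⟨_, h, rfl⟩

lemma H10sub_le_H1 : H10sub ℓ ≤ H1 ℓ := by
  rintro f ⟨p, hp, rfl⟩
  exact ⟨p.2, closure_hasWeakDeriv hp⟩

lemma H10sub_parts {f : L2 ℓ} (hf : f ∈ H10sub ℓ) {v : ℝ → ℂ} (hv : ContDiff ℝ ∞ v) :
    ∫ x in Ioo (0 : ℝ) ℓ, weakDeriv f x * v x = -∫ x in Ioo (0 : ℝ) ℓ, f x * deriv v x := by
  have := closure_integral (mem_H10sub_iff.1 hf) hv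
  simp only [pairing_apply] at this
  linear_combination this

lemma weakDeriv_mem_L2star {f : L2 ℓ} (hf : f ∈ H10sub ℓ) : weakDeriv f ∈ L2star ℓ := by
  rw [mem_L2star_iff, pairing_apply, H10sub_parts hf contDiff_const]
  simp

/-- The Poincaré inequality on `H¹₀`. -/
lemma closure_poincare {p : L2 ℓ × L2 ℓ} (hp : p ∈ (testGraph ℓ).topologicalClosure) :
    ‖p.1‖ ≤ (volume.restrict (Ioo (0 : ℝ) ℓ)).real univ ^ ((2 : ENNReal).toReal)⁻¹ *
      ((volume.restrict (Ioo (0 : ℝ) ℓ)).real univ ^ ((2 : ENNReal).toReal)⁻¹ * ‖p.2‖) := by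
  have hcl : IsClosed {p : L2 ℓ × L2 ℓ | ‖p.1‖ ≤
      (volume.restrict (Ioo (0 : ℝ) ℓ)).real univ ^ ((2 : ENNReal).toReal)⁻¹ *
      ((volume.restrict (Ioo (0 : ℝ) ℓ)).real univ ^ ((2 : ENNReal).toReal)⁻¹ * ‖p.2‖)} :=
    isClosed_le (by fun_prop) (by fun_prop)
  refine closure_minimal ?_ hcl hp
  rintro ⟨f, g⟩ ⟨u, hu, h₁, h₂⟩
  simp only at h₁ h₂
  rw [mem_ofPred_eq]
  refine Lp.norm_le_of_ae_bound (by positivity) ?_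
  filter_upwards [h₁, ae_restrict_mem measurableSet_Ioo] with x hx hx'
  rw [hx]
  have e1 : u x = ∫ t in Ioc 0 x, g t ∂(volume.restrict (Ioo (0 : ℝ) ℓ)) := by
    rw [Measure.restrict_restrict measurableSet_Ioc,
      inter_eq_left.2 (show Ioc 0 x ⊆ Ioo 0 ℓ from fun t ht => ⟨ht.1, ht.2.trans_lt hx'.2⟩)]
    have h3 : ∫ t in Ioc 0 x, g t = ∫ t in Ioc 0 x, deriv u t :=
      integral_congr_ae (ae_restrict_of_ae_restrict_of_subset
        (show Ioc 0 x ⊆ Ioo 0 ℓ from fun t ht => ⟨ht.1, ht.2.trans_lt hx'.2⟩) h₂)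
    rw [h3, ← intervalIntegral.integral_of_le hx'.1.le,
      intervalIntegral.integral_deriv_eq_sub
        (fun t _ => hu.smooth.differentiable (by simp) t)
        (hu.continuous_deriv.intervalIntegrable _ _), hu.eq_zero (x := 0) (by simp), sub_zero]
  rw [e1, ← L2.inner_indicatorConstLp_one (𝕜 := ℂ) measurableSet_Ioc (measure_ne_top _ _)]
  refine (norm_inner_le_norm _ _).trans ?_
  gcongr
  refine norm_indicatorConstLp_le.trans ?_
  rw [norm_one, one_mul, one_div]
  gcongr
  · simp
  · exact subset_univ _

end H10

/-- The Hilbert space `H¹₀(0, ℓ)` with the gradient inner product `⟨f_x, g_x⟩`. -/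
def H10 (ℓ : ℝ) : Type := H10sub ℓ

namespace H10

variable {ℓ : ℝ}

instance : AddCommGroup (H10 ℓ) := inferInstanceAs (AddCommGroup (H10sub ℓ))

instance : Module ℂ (H10 ℓ) := inferInstanceAs (Module ℂ (H10sub ℓ))

/-- An element of `L²` lying in `H¹₀`, as an element of the Hilbert space `H¹₀`. -/
def mk (f : L2 ℓ) (h : f ∈ H10sub ℓ) : H10 ℓ := ⟨f, h⟩

/-- The inclusion of `H¹₀` into `L²`. -/
def toL2 : H10 ℓ →ₗ[ℂ] L2 ℓ := (H10sub ℓ).subtype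

lemma toL2_mem (f : H10 ℓ) : f.toL2 ∈ H10sub ℓ := Subtype.property (p := (· ∈ H10sub ℓ)) f

/-- The weak derivative `f ↦ f_x` on `H¹₀`. -/
def grad : H10 ℓ →ₗ[ℂ] L2 ℓ where
  toFun f := weakDeriv f.toL2
  map_add' f g := by
    rw [map_add, weakDeriv_add (H10sub_le_H1 f.toL2_mem) (H10sub_le_H1 g.toL2_mem)]
  map_smul' c f := by
    rw [map_smul, weakDeriv_smul c (H10sub_le_H1 f.toL2_mem)]; rfl

lemma mem_closure (f : H10 ℓ) : (f.toL2, f.grad) ∈ (testGraph ℓ).topologicalClosure :=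
  mem_H10sub_iff.1 f.toL2_mem

lemma eq_zero_of_grad {f : H10 ℓ} (h : f.grad = 0) : f = 0 := by
  have := closure_poincare f.mem_closure
  simp only [h, norm_zero, mul_zero] at this
  exact Subtype.ext (norm_le_zero_iff.1 this)

/-- The gradient inner product. -/
instance : InnerProductSpace.Core ℂ (H10 ℓ) where
  inner f g := inner ℂ f.grad g.grad
  conj_inner_symm f g := inner_conj_symm _ _
  re_inner_nonneg f := inner_self_nonneg
  add_left f g h := by rw [map_add, inner_add_left]
  smul_left f g c := by rw [map_smul, inner_smul_left]
  definite f h := eq_zero_of_grad (inner_self_eq_zero.1 h)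

instance : NormedAddCommGroup (H10 ℓ) :=
  InnerProductSpace.Core.toNormedAddCommGroup (𝕜 := ℂ)

instance : InnerProductSpace ℂ (H10 ℓ) := InnerProductSpace.ofCore _

lemma norm_eq (f : H10 ℓ) : ‖f‖ = ‖f.grad‖ := by
  rw [norm_eq_sqrt_re_inner (𝕜 := ℂ) f.grad]
  rfl

instance : CompleteSpace (H10 ℓ) := by
  refine Metric.complete_of_cauchySeq_tendsto fun u hu => ?_
  have key : ∀ f : H10 ℓ, ‖(f.toL2, f.grad)‖ ≤
      max ((volume.restrict (Ioo (0 : ℝ) ℓ)).real univ ^ ((2 : ENNReal).toReal)⁻¹ *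
        (volume.restrict (Ioo (0 : ℝ) ℓ)).real univ ^ ((2 : ENNReal).toReal)⁻¹) 1 * ‖f‖ := by
    intro f
    have h := closure_poincare f.mem_closure
    rw [Prod.norm_def, max_mul_of_nonneg _ _ (norm_nonneg f), norm_eq, mul_assoc, one_mul]
    exact max_le_max h le_rfl
  have hL := AddMonoidHomClass.lipschitz_of_bound (LinearMap.prod (toL2 (ℓ := ℓ)) grad) _ key
  have hc : CauchySeq (fun n => ((u n).toL2, (u n).grad)) := hu.map hL.uniformContinuous
  obtain ⟨p, hp⟩ := cauchySeq_tendsto_of_complete hc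
  have hmem : p ∈ (testGraph ℓ).topologicalClosure :=
    (Submodule.isClosed_topologicalClosure _).mem_of_tendsto hp
      (Eventually.of_forall fun n => (u n).mem_closure)
  let a : H10 ℓ := ⟨p.1, p, hmem, rfl⟩
  have ha : a.grad = p.2 := (closure_hasWeakDeriv hmem).weakDeriv_eq
  refine ⟨a, ?_⟩
  rw [tendsto_iff_norm_sub_tendsto_zero]
  have h2 := (continuous_snd.tendsto p).comp hp
  rw [tendsto_iff_norm_sub_tendsto_zero] at h2
  refine h2.congr fun n => ?_
  rw [norm_eq, map_sub, ha]
  rfl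

end H10

/-! ### Memory kernels and memory spaces -/

/-- A memory kernel `μ : ℝ⁺ → ℝ⁺` (only the values on `(0, ∞)` matter), whose primitive
`g(s) = ∫_s^∞ μ(r) dr` has unit total mass. -/
structure MemoryKernel where
  toFun : ℝ → ℝ
  pos : ∀ s, 0 < s → 0 < toFun s
  antitone : AntitoneOn toFun (Ioi 0)
  absolutelyContinuous : ∀ a b, 0 < a → a ≤ b → AbsolutelyContinuousOnInterval toFun a b
  integrable : IntegrableOn toFun (Ioi 0)
  bounded_zero : ∃ m, Tendsto toFun (𝓝[>] 0) (𝓝 m)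
  total_mass : ∫ s in Ioi (0 : ℝ), ∫ r in Ioi s, toFun r = 1
  dafermos : ∃ δ : ℝ, 0 < δ ∧
    ∀ᵐ s ∂(volume.restrict (Ioi (0 : ℝ))), deriv toFun s + δ * toFun s ≤ 0

/-- The measure `μ(s) ds` on `ℝ⁺`. -/
def MemoryKernel.measure (μ : MemoryKernel) : Measure ℝ :=
  (volume.restrict (Ioi (0 : ℝ))).withDensity fun s => ENNReal.ofReal (μ.toFun s)

instance (μ : MemoryKernel) : IsFiniteMeasure μ.measure :=
  isFiniteMeasure_withDensity_ofReal μ.integrable.2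

/-- The memory space `L²_μ(ℝ⁺; H¹₀)`. -/
abbrev Memory (ℓ : ℝ) (μ : MemoryKernel) := Lp (H10 ℓ) 2 μ.measure

/-- `η'` is the weak derivative of `η` with respect to `s ∈ ℝ⁺`, both in the memory space. -/
def HasMemDeriv {ℓ : ℝ} {μ : MemoryKernel} (η η' : Memory ℓ μ) : Prop :=
  ∀ v : ℝ → ℝ, ContDiff ℝ ∞ v → HasCompactSupport v → tsupport v ⊆ Ioi 0 →
    ∫ s in Ioi (0 : ℝ), deriv v s • η s = -∫ s in Ioi (0 : ℝ), v s • η' s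

section memory

variable {ℓ : ℝ} {μ : MemoryKernel}

lemma MemoryKernel.volume_ac (μ : MemoryKernel) :
    volume.restrict (Ioi (0 : ℝ)) ≪ μ.measure := by
  refine withDensity_absolutelyContinuous' μ.integrable.1.aemeasurable.ennreal_ofReal ?_
  filter_upwards [ae_restrict_mem measurableSet_Ioi] with s hs
  simpa using μ.pos s hs

lemma Memory.coe_add (η₁ η₂ : Memory ℓ μ) :
    ⇑(η₁ + η₂) =ᵐ[volume.restrict (Ioi (0 : ℝ))] ⇑η₁ + ⇑η₂ :=
  μ.volume_ac.ae_eq (Lp.coeFn_add η₁ η₂)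

lemma Memory.coe_smul (c : ℂ) (η : Memory ℓ μ) :
    ⇑(c • η) =ᵐ[volume.restrict (Ioi (0 : ℝ))] c • ⇑η :=
  μ.volume_ac.ae_eq (Lp.coeFn_smul c η)

lemma Memory.locallyIntegrableOn (η : Memory ℓ μ) : LocallyIntegrableOn η (Ioi (0 : ℝ)) := by
  rw [locallyIntegrableOn_iff isOpen_Ioi.isLocallyClosed]
  intro K hK hc
  rcases K.eq_empty_or_nonempty with rfl | hne
  · simp
  have hb : 0 < sSup K := hK (hc.sSup_mem hne)
  have hint : Integrable η μ.measure := (Lp.memLp η).integrable (by norm_num)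
  have hle : volume.restrict K ≤ (ENNReal.ofReal (μ.toFun (sSup K)))⁻¹ • μ.measure := by
    refine Measure.le_iff.2 fun s hs => ?_
    rw [Measure.smul_apply, MemoryKernel.measure, withDensity_apply _ hs, smul_eq_mul,
      Measure.restrict_apply hs, Measure.restrict_restrict hs, mul_comm, ← div_eq_mul_inv,
      ENNReal.le_div_iff_mul_le (by simp [μ.pos _ hb]) (by simp), mul_comm,
      ← setLIntegral_const]
    refine (setLIntegral_mono' (hs.inter hc.measurableSet) fun x hx => ?_).trans
      (lintegral_mono_set (inter_subset_inter_right _ hK))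
    exact ENNReal.ofReal_le_ofReal (μ.antitone (hK hx.2) hb (le_csSup hc.bddAbove hx.2))
  exact (hint.smul_measure (by simp [μ.pos _ hb])).mono_measure hle

lemma Memory.integrable_smul (η : Memory ℓ μ) {v : ℝ → ℝ} (hv : Continuous v)
    (hc : HasCompactSupport v) (hs : tsupport v ⊆ Ioi 0) :
    IntegrableOn (fun s => v s • η s) (Ioi (0 : ℝ)) := by
  have h1 : IntegrableOn η (tsupport v) := by
    have := (Memory.locallyIntegrableOn η)
    rw [locallyIntegrableOn_iff isOpen_Ioi.isLocallyClosed] at this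
    exact this _ hs hc
  have h2 := h1.continuousOn_smul hv.continuousOn hc
  refine Integrable.integrableOn ?_
  rw [← integrableOn_iff_integrable_of_support_subset (s := tsupport v)]
  · exact h2
  · exact (Function.support_smul_subset_left v η).trans (subset_tsupport v)

lemma HasMemDeriv.add {η₁ η₂ θ₁ θ₂ : Memory ℓ μ} (h₁ : HasMemDeriv η₁ θ₁)
    (h₂ : HasMemDeriv η₂ θ₂) : HasMemDeriv (η₁ + η₂) (θ₁ + θ₂) := by
  intro v hv hc hs
  have hd : Continuous (deriv v) := hv.continuous_deriv (by simp)
  have hs' : tsupport (deriv v) ⊆ Ioi 0 := Subset.trans tsupport_deriv_subset hs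
  have e₁ : ∫ s in Ioi (0 : ℝ), deriv v s • (η₁ + η₂) s =
      ∫ s in Ioi (0 : ℝ), (deriv v s • η₁ s + deriv v s • η₂ s) := by
    refine integral_congr_ae ?_
    filter_upwards [Memory.coe_add η₁ η₂] with s hs
    rw [hs, Pi.add_apply, smul_add]
  have e₂ : ∫ s in Ioi (0 : ℝ), v s • (θ₁ + θ₂) s =
      ∫ s in Ioi (0 : ℝ), (v s • θ₁ s + v s • θ₂ s) := by
    refine integral_congr_ae ?_
    filter_upwards [Memory.coe_add θ₁ θ₂] with s hs
    rw [hs, Pi.add_apply, smul_add]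
  rw [e₁, e₂, integral_add (Memory.integrable_smul η₁ hd hc.deriv hs')
    (Memory.integrable_smul η₂ hd hc.deriv hs'), integral_add (Memory.integrable_smul θ₁ hv.continuous hc hs)
    (Memory.integrable_smul θ₂ hv.continuous hc hs), h₁ v hv hc hs, h₂ v hv hc hs, neg_add]

lemma HasMemDeriv.smul {η θ : Memory ℓ μ} (c : ℂ) (h : HasMemDeriv η θ) :
    HasMemDeriv (c • η) (c • θ) := by
  intro v hv hc hs
  have e₁ : ∫ s in Ioi (0 : ℝ), deriv v s • (c • η) s =
      ∫ s in Ioi (0 : ℝ), c • (deriv v s • η s) := by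
    refine integral_congr_ae ?_
    filter_upwards [Memory.coe_smul c η] with s hs
    rw [hs, Pi.smul_apply, smul_comm]
  have e₂ : ∫ s in Ioi (0 : ℝ), v s • (c • θ) s = ∫ s in Ioi (0 : ℝ), c • (v s • θ s) := by
    refine integral_congr_ae ?_
    filter_upwards [Memory.coe_smul c θ] with s hs
    rw [hs, Pi.smul_apply, smul_comm]
  rw [e₁, e₂, integral_smul, integral_smul, h v hv hc hs, smul_neg]

lemma hasMemDeriv_zero : HasMemDeriv (0 : Memory ℓ μ) 0 := by
  intro v _ _ _
  have e : ⇑(0 : Memory ℓ μ) =ᵐ[volume.restrict (Ioi (0 : ℝ))] 0 :=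
    μ.volume_ac.ae_eq (Lp.coeFn_zero _ _ _)
  rw [integral_eq_zero_of_ae, integral_eq_zero_of_ae, neg_zero]
  · filter_upwards [e] with s hs
    simp only [hs, Pi.zero_apply, smul_zero]
  · filter_upwards [e] with s hs
    simp only [hs, Pi.zero_apply, smul_zero]

lemma HasMemDeriv.unique {η θ₁ θ₂ : Memory ℓ μ} (h₁ : HasMemDeriv η θ₁)
    (h₂ : HasMemDeriv η θ₂) : θ₁ = θ₂ := by
  have := isOpen_Ioi.ae_eq_zero_of_integral_contDiff_smul_eq_zero (μ := volume)
    (f := fun s => θ₁ s - θ₂ s) (U := Ioi (0 : ℝ))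
    ((Memory.locallyIntegrableOn θ₁).sub (Memory.locallyIntegrableOn θ₂)) (by
      intro v hv hc hs
      have e : ∫ s, v s • (θ₁ s - θ₂ s) = ∫ s in Ioi (0 : ℝ), (v s • θ₁ s - v s • θ₂ s) := by
        rw [← integral_indicator measurableSet_Ioi]
        refine integral_congr_ae (Eventually.of_forall fun s => ?_)
        by_cases hx : s ∈ Ioi (0 : ℝ)
        · simp only [hx, indicator_of_mem, smul_sub]
        · have : v s = 0 := image_eq_zero_of_notMem_tsupport fun h => hx (hs h)
          simp only [hx, not_false_eq_true, indicator_of_notMem, this, zero_smul]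
      rw [e, integral_sub (Memory.integrable_smul θ₁ hv.continuous hc hs)
        (Memory.integrable_smul θ₂ hv.continuous hc hs), sub_eq_zero, ← neg_inj,
        ← h₁ v hv hc hs, ← h₂ v hv hc hs])
  rw [← ae_restrict_iff' measurableSet_Ioi] at this
  refine Lp.ext ?_
  filter_upwards [(withDensity_absolutelyContinuous _ _).ae_le this] with s hs
  exact sub_eq_zero.1 hs

end memory

open Classical in
/-- The weak derivative of `η` in the memory space, with the value `0` if there is none. -/
def memDeriv {ℓ : ℝ} {μ : MemoryKernel} (η : Memory ℓ μ) : Memory ℓ μ :=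
  if h : ∃ θ, HasMemDeriv η θ then h.choose else 0

lemma HasMemDeriv.memDeriv_eq {ℓ : ℝ} {μ : MemoryKernel} {η θ : Memory ℓ μ}
    (h : HasMemDeriv η θ) : memDeriv η = θ := by
  have h' : ∃ θ, HasMemDeriv η θ := ⟨θ, h⟩
  rw [memDeriv, dif_pos h']
  exact h'.choose_spec.unique h

/-- The domain of the generator of the right translations: `η` has a weak derivative in the
memory space and (for its continuous representative) `‖η_x(s)‖ → 0` as `s → 0`. -/
def transportDomain (ℓ : ℝ) (μ : MemoryKernel) : Submodule ℂ (Memory ℓ μ) where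
  carrier := {η | (∃ θ, HasMemDeriv η θ) ∧ ∃ f : ℝ → H10 ℓ, ContinuousOn f (Ioi 0) ∧
    η =ᵐ[volume.restrict (Ioi (0 : ℝ))] f ∧
    Tendsto (fun s => ‖(f s).grad‖) (𝓝[>] 0) (𝓝 0)}
  add_mem' := by
    rintro η₁ η₂ ⟨⟨θ₁, h₁⟩, f₁, hc₁, he₁, ht₁⟩ ⟨⟨θ₂, h₂⟩, f₂, hc₂, he₂, ht₂⟩
    refine ⟨⟨_, h₁.add h₂⟩, f₁ + f₂, hc₁.add hc₂, (Memory.coe_add _ _).trans (he₁.add he₂), ?_⟩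
    refine squeeze_zero (fun _ => norm_nonneg _) (fun s => ?_) (by simpa using ht₁.add ht₂)
    rw [Pi.add_apply, map_add]
    exact norm_add_le _ _
  zero_mem' := ⟨⟨0, hasMemDeriv_zero⟩, 0, continuousOn_const,
    μ.volume_ac.ae_eq (Lp.coeFn_zero _ _ _), by simp⟩
  smul_mem' := by
    rintro c η ⟨⟨θ, h⟩, f, hc, he, ht⟩
    refine ⟨⟨_, h.smul c⟩, c • f, hc.const_smul c,
      (Memory.coe_smul _ _).trans (he.const_smul c), ?_⟩
    have := ht.const_mul ‖c‖
    simpa only [Pi.smul_apply, map_smul, norm_smul, mul_zero] using this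

/-- The infinitesimal generator `T η = -η'` of the right-translation semigroup. -/
def transport (ℓ : ℝ) (μ : MemoryKernel) : Memory ℓ μ →ₗ.[ℂ] Memory ℓ μ where
  domain := transportDomain ℓ μ
  toFun :=
    { toFun := fun η => -memDeriv (η : Memory ℓ μ)
      map_add' := by
        rintro ⟨η₁, ⟨θ₁, h₁⟩, _⟩ ⟨η₂, ⟨θ₂, h₂⟩, _⟩
        simp only [Submodule.coe_add]
        rw [(h₁.add h₂).memDeriv_eq, h₁.memDeriv_eq, h₂.memDeriv_eq, neg_add]
      map_smul' := by
        rintro c ⟨η, ⟨θ, h⟩, _⟩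
        simp only [Submodule.coe_smul, RingHom.id_apply]
        rw [(h.smul c).memDeriv_eq, h.memDeriv_eq, smul_neg] }

/-! ### First-order equations on `(0, ℓ)` -/

section firstOrder

variable {ℓ : ℝ}

lemma IsTest.mul_smooth {u v : ℝ → ℂ} (hu : IsTest ℓ u) (hv : ContDiff ℝ ∞ v) :
    IsTest ℓ (fun x => u x * v x) :=
  ⟨hu.smooth.mul hv, hu.compact.mul_right,
    (closure_mono (Function.support_mul_subset_left u v)).trans hu.support⟩

lemma exists_test_integral_one (hℓ : 0 < ℓ) :
    ∃ χ : ℝ → ℂ, IsTest ℓ χ ∧ ∫ x in Ioo (0 : ℝ) ℓ, χ x = 1 := by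
  let f : ContDiffBump (ℓ / 2 : ℝ) := ⟨ℓ / 8, ℓ / 4, by positivity, by linarith⟩
  have hs : tsupport (f.normed volume) ⊆ Ioo (0 : ℝ) ℓ := by
    rw [f.tsupport_normed_eq, Real.closedBall_eq_Icc]
    change Icc (ℓ / 2 - ℓ / 4) (ℓ / 2 + ℓ / 4) ⊆ _
    intro x hx
    exact ⟨by linarith [hx.1], by linarith [hx.2]⟩
  have ht : IsTest ℓ (fun x => ((f.normed volume x : ℝ) : ℂ)) :=
    ⟨Complex.ofRealCLM.contDiff.comp f.contDiff_normed,
      f.hasCompactSupport_normed.comp_left (g := fun t : ℝ => (t : ℂ)) (by simp),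
      (tsupport_comp_subset (g := fun t : ℝ => (t : ℂ)) (by simp) _).trans hs⟩
  refine ⟨_, ht, ?_⟩
  rw [setIntegral_eq_integral_of_forall_compl_eq_zero (fun x hx => ht.eq_zero hx),
    integral_complex_ofReal, f.integral_normed, Complex.ofReal_one]

lemma IsTest.exists_primitive (hℓ : 0 < ℓ) {g : ℝ → ℂ} (hg : IsTest ℓ g)
    (h0 : ∫ x in Ioo (0 : ℝ) ℓ, g x = 0) : ∃ v, IsTest ℓ v ∧ deriv v = g := by
  have hc := hg.smooth.continuous
  have hd : deriv (fun x => ∫ t in (0 : ℝ)..x, g t) = g := by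
    ext x
    exact hc.deriv_integral g 0 x
  have hdiff : Differentiable ℝ (fun x => ∫ t in (0 : ℝ)..x, g t) := fun x =>
    (hc.integral_hasStrictDerivAt 0 x).hasDerivAt.differentiableAt
  have hsm : ContDiff ℝ ∞ (fun x => ∫ t in (0 : ℝ)..x, g t) :=
    contDiff_infty_iff_deriv.2 ⟨hdiff, by rw [hd]; exact hg.smooth⟩
  rw [← integral_Ioc_eq_integral_Ioo, ← intervalIntegral.integral_of_le hℓ.le] at h0
  obtain ⟨a, b, ha, hb, hab⟩ : ∃ a b, 0 < a ∧ b < ℓ ∧ tsupport g ⊆ Icc a b := by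
    rcases (tsupport g).eq_empty_or_nonempty with he | hne
    · exact ⟨1, ℓ - 1, one_pos, by linarith, by simp [he]⟩
    · exact ⟨sInf (tsupport g), sSup (tsupport g), (hg.support (hg.compact.isCompact.sInf_mem hne)).1,
        (hg.support (hg.compact.isCompact.sSup_mem hne)).2,
        fun x hx => ⟨csInf_le hg.compact.isCompact.bddBelow hx,
          le_csSup hg.compact.isCompact.bddAbove hx⟩⟩
  have hz : ∀ x, x ∉ Icc a b → g x = 0 := fun x hx =>
    image_eq_zero_of_notMem_tsupport fun h => hx (hab h)
  have hv : Function.support (fun x => ∫ t in (0 : ℝ)..x, g t) ⊆ Icc a b := by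
    intro x hx
    by_contra hx'
    apply hx
    rcases lt_or_ge x a with h | h
    · refine intervalIntegral.integral_zero_ae (Eventually.of_forall fun t ht => hz t fun ht' => ?_)
      rw [mem_uIoc] at ht
      rcases ht with ht | ht <;> linarith [ht.1, ht.2, ht'.1]
    · have hxb : b < x := by
        by_contra hh
        exact hx' ⟨h, not_lt.1 hh⟩
      have h1 := intervalIntegral.integral_add_adjacent_intervals
        (hc.intervalIntegrable (μ := volume) 0 ℓ) (hc.intervalIntegrable ℓ x)
      rw [h0, zero_add] at h1
      change ∫ t in (0 : ℝ)..x, g t = 0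
      rw [← h1]
      refine intervalIntegral.integral_zero_ae (Eventually.of_forall fun t ht => hz t fun ht' => ?_)
      rw [mem_uIoc] at ht
      rcases ht with ht | ht <;> linarith [ht.1, ht.2, ht'.2]
  have hts : tsupport (fun x => ∫ t in (0 : ℝ)..x, g t) ⊆ Icc a b :=
    closure_minimal hv isClosed_Icc
  exact ⟨_, ⟨hsm, isCompact_Icc.of_isClosed_subset (isClosed_tsupport _) hts,
    hts.trans fun x hx => ⟨ha.trans_le hx.1, hx.2.trans_lt hb⟩⟩, hd⟩

lemma contDiff_exp_mul (c : ℂ) : ContDiff ℝ ∞ (fun x : ℝ => Complex.exp (c * x)) :=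
  (contDiff_const.mul Complex.ofRealCLM.contDiff).cexp

lemma hasDerivAt_exp_mul (c : ℂ) (x : ℝ) :
    HasDerivAt (fun x : ℝ => Complex.exp (c * x)) (c * Complex.exp (c * x)) x := by
  have := ((hasDerivAt_id x).ofReal_comp.const_mul c).cexp
  simpa [mul_comm] using this

/-- Weak solutions of `z_x = c z` are exponentials. -/
lemma HasWeakDeriv.eq_exp (hℓ : 0 < ℓ) {z : L2 ℓ} {c : ℂ} (h : HasWeakDeriv ℓ z (c • z)) :
    ∃ C : ℂ, z =ᵐ[volume.restrict (Ioo (0 : ℝ) ℓ)] fun x => C * Complex.exp (c * x) := by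
  obtain ⟨χ, hχ, hχ1⟩ := exists_test_integral_one hℓ
  have key : ∀ v, IsTest ℓ v →
      ∫ x in Ioo (0 : ℝ) ℓ, z x * (deriv v x * Complex.exp (-c * x)) = 0 := by
    intro v hv
    have hu := hv.mul_smooth (contDiff_exp_mul (-c))
    have h1 := h _ hu
    have e1 : ∀ x, deriv (fun x : ℝ => v x * Complex.exp (-c * x)) x =
        deriv v x * Complex.exp (-c * x) + -c * (v x * Complex.exp (-c * x)) := by
      intro x
      refine (((hv.smooth.differentiable (by simp) x).hasDerivAt.mul
        (hasDerivAt_exp_mul (-c) x)).deriv).trans ?_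
      ring
    have c1 : Continuous (fun x : ℝ => deriv v x * Complex.exp (-c * x)) :=
      hv.continuous_deriv.mul (contDiff_exp_mul (-c)).continuous
    have e2 : pairing hu.continuous_deriv z = pairing c1 z +
        -c * pairing hu.smooth.continuous z := by
      rw [← smul_eq_mul, ← map_smul]
      rw [pairing_apply, pairing_apply, pairing_apply]
      have i1 := (memLp_of_continuous (ℓ := ℓ) c1).integrable_mul (Lp.memLp z)
      have i2 := (memLp_of_continuous (ℓ := ℓ) hu.smooth.continuous).integrable_mul
        (Lp.memLp (-c • z))
      rw [← integral_add (i1.congr (Eventually.of_forall fun x => mul_comm _ _))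
        (i2.congr (Eventually.of_forall fun x => mul_comm _ _))]
      refine integral_congr_ae ?_
      filter_upwards [Lp.coeFn_smul (-c) z] with x hx
      rw [hx, e1, Pi.smul_apply, smul_eq_mul]
      ring
    rw [← pairing_apply c1]
    rw [← pairing_apply hu.continuous_deriv, ← pairing_apply hu.smooth.continuous, map_smul,
      smul_eq_mul, e2] at h1
    linear_combination h1
  let C : ℂ := ∫ x in Ioo (0 : ℝ) ℓ, z x * (χ x * Complex.exp (-c * x))
  have cE : Continuous (fun x : ℝ => C * Complex.exp (c * x)) :=
    continuous_const.mul (contDiff_exp_mul c).continuous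
  have hE := MemLp.coeFn_toLp (memLp_of_continuous (ℓ := ℓ) cE)
  refine ⟨C, ?_⟩
  suffices hz : z - (memLp_of_continuous (ℓ := ℓ) cE).toLp = 0 by
    rw [sub_eq_zero] at hz
    rw [hz]
    exact hE
  refine ae_zero_of_forall_test _ fun g hg => ?_
  have hG := hg.mul_smooth (contDiff_exp_mul c)
  let I : ℂ := ∫ x in Ioo (0 : ℝ) ℓ, g x * Complex.exp (c * x)
  have hGint : IntegrableOn (fun x : ℝ => g x * Complex.exp (c * x)) (Ioo (0 : ℝ) ℓ) :=
    (memLp_of_continuous hG.smooth.continuous).integrable (by norm_num)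
  have hχint : IntegrableOn χ (Ioo (0 : ℝ) ℓ) :=
    (memLp_of_continuous hχ.smooth.continuous).integrable (by norm_num)
  have hT : IsTest ℓ (fun x => g x * Complex.exp (c * x) + χ x * (-I)) :=
    ⟨hG.smooth.add (hχ.mul_smooth contDiff_const).smooth,
      hG.compact.add (hχ.mul_smooth contDiff_const).compact,
      (tsupport_add _ _).trans (union_subset hG.support (hχ.mul_smooth contDiff_const).support)⟩
  obtain ⟨v, hv, hdv⟩ := hT.exists_primitive hℓ (by
    rw [integral_add hGint (hχint.mul_const _), integral_mul_const, hχ1]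
    change I + _ = 0
    ring)
  have hk := key v hv
  have cχ : Continuous (fun x : ℝ => χ x * Complex.exp (-c * x)) :=
    hχ.smooth.continuous.mul (contDiff_exp_mul (-c)).continuous
  have i1 : Integrable (fun x => z x * g x) (volume.restrict (Ioo (0 : ℝ) ℓ)) :=
    (Lp.memLp z).integrable_mul (memLp_of_continuous hg.smooth.continuous)
  have i2 : Integrable (fun x => z x * (χ x * Complex.exp (-c * x)))
      (volume.restrict (Ioo (0 : ℝ) ℓ)) :=
    (Lp.memLp z).integrable_mul (memLp_of_continuous cχ)
  have e3 : ∫ x in Ioo (0 : ℝ) ℓ, z x * (deriv v x * Complex.exp (-c * x)) =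
      ∫ x in Ioo (0 : ℝ) ℓ, (z x * g x + (z x * (χ x * Complex.exp (-c * x))) * (-I)) := by
    refine integral_congr_ae (Eventually.of_forall fun x => ?_)
    have : Complex.exp (c * x) * Complex.exp (-c * x) = 1 := by
      rw [← Complex.exp_add]; simp
    simp only [hdv]
    linear_combination (z x * g x) * this
  rw [e3, integral_add i1 (i2.mul_const _), integral_mul_const] at hk
  have e4 : ∫ x in Ioo (0 : ℝ) ℓ, (z - (memLp_of_continuous (ℓ := ℓ) cE).toLp : L2 ℓ) x * g x =
      ∫ x in Ioo (0 : ℝ) ℓ, (z x * g x + (g x * Complex.exp (c * x)) * (-C)) := by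
    refine integral_congr_ae ?_
    filter_upwards [hE, Lp.coeFn_sub z ((memLp_of_continuous (ℓ := ℓ) cE).toLp)] with x h1 h2
    rw [h2, Pi.sub_apply, h1]
    ring
  rw [e4, integral_add i1 (hGint.mul_const _), integral_mul_const]
  change _ + I * (-C) = 0
  change _ + C * (-I) = 0 at hk
  linear_combination hk

/-- The energy of the Bresse displacement vanishes only for the zero displacement. -/
lemma displacement_eq_zero (hℓ : 0 < ℓ) {l : ℝ} (hl : 0 < l)
    (hn : ∀ n : ℕ, 1 ≤ n → l * ℓ ≠ n * Real.pi) {φ ψ w : L2 ℓ} (hφ : φ ∈ H10sub ℓ)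
    (hψ : ψ ∈ H1star ℓ) (hw : w ∈ H1star ℓ) (h₁ : weakDeriv φ + ψ + (l : ℂ) • w = 0)
    (h₂ : weakDeriv ψ = 0) (h₃ : weakDeriv w - (l : ℂ) • φ = 0) :
    φ = 0 ∧ ψ = 0 ∧ w = 0 := by
  have hψ0 : ψ = 0 := by
    have h : HasWeakDeriv ℓ ψ ((0 : ℂ) • ψ) := by
      rw [zero_smul, ← h₂]
      exact hasWeakDeriv_weakDeriv hψ.1
    obtain ⟨C, hC⟩ := h.eq_exp hℓ
    have h0 : ∫ x in Ioo (0 : ℝ) ℓ, ψ x = 0 := hψ.2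
    rw [integral_congr_ae hC] at h0
    simp [hℓ.le, hℓ.ne'] at h0
    rw [Lp.eq_zero_iff_ae_eq_zero]
    filter_upwards [hC] with x hx
    rw [hx, h0, zero_mul]
    rfl
  subst hψ0
  rw [add_zero] at h₁
  have hl' : (l : ℂ) ≠ 0 := by exact_mod_cast hl.ne'
  have dφ := hasWeakDeriv_weakDeriv (H10sub_le_H1 hφ)
  have dw := hasWeakDeriv_weakDeriv hw.1
  have hI := Complex.I_mul_I
  have hφx : weakDeriv φ = -((l : ℂ) • w) := eq_neg_of_add_eq_zero_left h₁
  have hwx : weakDeriv w = (l : ℂ) • φ := sub_eq_zero.1 h₃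
  have dz₁ : HasWeakDeriv ℓ (φ + Complex.I • w) ((Complex.I * l) • (φ + Complex.I • w)) := by
    convert dφ.add (dw.smul Complex.I) using 1
    rw [hφx, hwx, smul_add, smul_smul, smul_smul, mul_right_comm, hI, neg_one_mul, neg_smul,
      add_comm]
  have dz₂ : HasWeakDeriv ℓ (φ + (-Complex.I) • w)
      ((-(Complex.I * l)) • (φ + (-Complex.I) • w)) := by
    convert dφ.add (dw.smul (-Complex.I)) using 1
    rw [hφx, hwx, smul_add, smul_smul, smul_smul, neg_mul_neg, mul_right_comm, hI, neg_one_mul,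
      neg_smul, add_comm, neg_mul, neg_smul, neg_smul]
  obtain ⟨C, hC⟩ := dz₁.eq_exp hℓ
  obtain ⟨D, hD⟩ := dz₂.eq_exp hℓ
  let p : ℝ → ℂ := fun x =>
    (C * Complex.exp (Complex.I * l * x) + D * Complex.exp (-(Complex.I * l) * x)) / 2
  let q : ℝ → ℂ := fun x => (Complex.I * l) *
    (C * Complex.exp (Complex.I * l * x) - D * Complex.exp (-(Complex.I * l) * x)) / 2
  have hp : ∀ x, HasDerivAt p (q x) x := by
    intro x
    refine ((((hasDerivAt_exp_mul (Complex.I * l) x).const_mul C).add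
      ((hasDerivAt_exp_mul (-(Complex.I * l)) x).const_mul D)).div_const 2).congr_deriv ?_
    simp only [q]
    ring
  have hq : Continuous q := by
    have a := (contDiff_exp_mul (Complex.I * l)).continuous
    have b := (contDiff_exp_mul (-(Complex.I * l))).continuous
    exact (continuous_const.mul ((continuous_const.mul a).sub (continuous_const.mul b))).div_const 2
  have eφ : φ =ᵐ[volume.restrict (Ioo (0 : ℝ) ℓ)] p := by
    filter_upwards [hC, hD, Lp.coeFn_add φ (Complex.I • w), Lp.coeFn_add φ ((-Complex.I) • w),
      Lp.coeFn_smul Complex.I w, Lp.coeFn_smul (-Complex.I) w] with x a1 a2 a3 a4 a5 a6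
    simp only [a3, a4, Pi.add_apply, a5, a6, Pi.smul_apply, smul_eq_mul] at a1 a2
    simp only [p]
    linear_combination (a1 + a2) / 2
  have eφx : weakDeriv φ =ᵐ[volume.restrict (Ioo (0 : ℝ) ℓ)] q := by
    rw [hφx]
    filter_upwards [hC, hD, Lp.coeFn_add φ (Complex.I • w), Lp.coeFn_add φ ((-Complex.I) • w),
      Lp.coeFn_smul Complex.I w, Lp.coeFn_smul (-Complex.I) w, Lp.coeFn_neg ((l : ℂ) • w),
      Lp.coeFn_smul (l : ℂ) w] with x a1 a2 a3 a4 a5 a6 a7 a8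
    simp only [a3, a4, Pi.add_apply, a5, a6, Pi.smul_apply, smul_eq_mul] at a1 a2
    simp only [a7, Pi.neg_apply, a8, Pi.smul_apply, smul_eq_mul, q]
    linear_combination (Complex.I * l) * (a1 - a2) / 2 - (l * w x) * hI
  have bdry : ∀ v : ℝ → ℂ, ContDiff ℝ ∞ v → p ℓ * v ℓ - p 0 * v 0 = 0 := by
    intro v hv
    have h1 := H10sub_parts hφ hv
    have e1 : ∫ x in Ioo (0 : ℝ) ℓ, weakDeriv φ x * v x = ∫ x in Ioo (0 : ℝ) ℓ, q x * v x :=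
      integral_congr_ae (eφx.mul (ae_eq_refl _))
    have e2 : ∫ x in Ioo (0 : ℝ) ℓ, φ x * deriv v x = ∫ x in Ioo (0 : ℝ) ℓ, p x * deriv v x :=
      integral_congr_ae (eφ.mul (ae_eq_refl _))
    rw [e1, e2, ← integral_Ioc_eq_integral_Ioo, ← integral_Ioc_eq_integral_Ioo,
      ← intervalIntegral.integral_of_le hℓ.le, ← intervalIntegral.integral_of_le hℓ.le] at h1
    have hpc : Continuous p := continuous_iff_continuousAt.2 fun x => (hp x).continuousAt
    rw [← intervalIntegral.integral_deriv_mul_eq_sub (fun x _ => hp x)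
      (fun x _ => (hv.differentiable (by simp) x).hasDerivAt) (hq.intervalIntegrable _ _)
      ((hv.continuous_deriv (by simp)).intervalIntegrable _ _),
      intervalIntegral.integral_add (f := fun x => q x * v x) (g := fun x => p x * deriv v x)
      ((hq.mul hv.continuous).intervalIntegrable _ _)
      ((hpc.mul (hv.continuous_deriv (by simp))).intervalIntegrable _ _), h1]
    ring
  have b1 := bdry _ (contDiff_const (c := (1 : ℂ)))
  have b2 := bdry _ Complex.ofRealCLM.contDiff
  have hℓ' : (ℓ : ℂ) ≠ 0 := by exact_mod_cast hℓ.ne'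
  have pℓ : p ℓ = 0 := by simpa [hℓ'] using b2
  have p0 : p 0 = 0 := by simpa [pℓ] using b1
  have hDC : D = -C := by
    simp [p] at p0
    exact eq_neg_of_add_eq_zero_right p0
  have hsin : Complex.sin ((l * ℓ : ℝ) : ℂ) ≠ 0 := by
    rw [← Complex.ofReal_sin]
    intro h
    rw [Complex.ofReal_eq_zero, Real.sin_eq_zero_iff] at h
    obtain ⟨n, h⟩ := h
    have hpos : (0 : ℝ) < n * Real.pi := h ▸ mul_pos hl hℓ
    have hn0 : 0 < n := by
      have := (pos_iff_pos_of_mul_pos hpos).2 Real.pi_pos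
      exact_mod_cast this
    refine hn n.toNat (by omega) ?_
    rw [← h]
    congr 1
    have : ((n.toNat : ℤ) : ℝ) = (n : ℝ) := by rw [Int.toNat_of_nonneg hn0.le]
    exact_mod_cast this.symm
  have hC0 : C = 0 := by
    have e : p ℓ = C * (Complex.I * Complex.sin ((l * ℓ : ℝ) : ℂ)) := by
      simp only [p, hDC, Complex.sin]
      push_cast
      rw [show Complex.I * l * ℓ = l * ℓ * Complex.I by ring,
        show -(Complex.I * l) * ℓ = -(l * ℓ) * Complex.I by ring]
      linear_combination (C * (Complex.exp (l * ℓ * Complex.I) -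
        Complex.exp (-(l * ℓ) * Complex.I)) / 2) * hI
    rw [e] at pℓ
    rcases mul_eq_zero.1 pℓ with h | h
    · exact h
    · exact absurd h (mul_ne_zero Complex.I_ne_zero hsin)
  have hφ0 : φ = 0 := by
    rw [Lp.eq_zero_iff_ae_eq_zero]
    filter_upwards [eφ] with x hx
    rw [hx]
    simp [p, hDC, hC0]
  have hw0 : w = 0 := by
    have : (l : ℂ) • w = 0 := by
      rw [hφ0, hasWeakDeriv_zero.weakDeriv_eq, eq_comm, neg_eq_zero] at hφx
      exact hφx
    exact (smul_eq_zero.1 this).resolve_left hl'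
  exact ⟨hφ0, rfl, hw0⟩

end firstOrder

/-! ### The Bresse-Gurtin-Pipkin system -/

/-- The structural data: positive constants with `l ℓ ∉ π ℕ`, and the two memory kernels. -/
structure BGPData where
  (ℓ ρ₁ ρ₂ ρ₃ k k₀ b ϖ l γ : ℝ)
  ℓ_pos : 0 < ℓ
  ρ₁_pos : 0 < ρ₁
  ρ₂_pos : 0 < ρ₂
  ρ₃_pos : 0 < ρ₃
  k_pos : 0 < k
  k₀_pos : 0 < k₀
  b_pos : 0 < b
  ϖ_pos : 0 < ϖ
  l_pos : 0 < l
  γ_pos : 0 < γ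
  lℓ_ne : ∀ n : ℕ, 1 ≤ n → l * ℓ ≠ n * Real.pi
  μ : MemoryKernel
  ν : MemoryKernel

/-- The extended memory space
`H¹₀ × L² × H¹_* × L²_* × H¹_* × L²_* × L² × L²_μ(ℝ⁺; H¹₀) × L² × L²_ν(ℝ⁺; H¹₀)`. -/
@[ext] structure PhaseSpace (S : BGPData) where
  φ : H10 S.ℓ
  Φ : L2 S.ℓ
  ψ : H1star S.ℓ
  Ψ : L2star S.ℓ
  w : H1star S.ℓ
  W : L2star S.ℓ
  θ : L2 S.ℓ
  η : Memory S.ℓ S.μ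
  ξ : L2 S.ℓ
  ζ : Memory S.ℓ S.ν

namespace PhaseSpace

variable {S : BGPData}

/-- The phase space as a product, used to transfer the componentwise vector space structure. -/
def equivProd (S : BGPData) : PhaseSpace S ≃ H10 S.ℓ × L2 S.ℓ × H1star S.ℓ × L2star S.ℓ ×
    H1star S.ℓ × L2star S.ℓ × L2 S.ℓ × Memory S.ℓ S.μ × L2 S.ℓ × Memory S.ℓ S.ν where
  toFun u := (u.φ, u.Φ, u.ψ, u.Ψ, u.w, u.W, u.θ, u.η, u.ξ, u.ζ)
  invFun := fun ⟨φ, Φ, ψ, Ψ, w, W, θ, η, ξ, ζ⟩ => ⟨φ, Φ, ψ, Ψ, w, W, θ, η, ξ, ζ⟩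
  left_inv _ := rfl
  right_inv _ := rfl

instance : AddCommGroup (PhaseSpace S) := (equivProd S).addCommGroup

instance : Module ℂ (PhaseSpace S) := (equivProd S).module ℂ

section components

variable (u v : PhaseSpace S) (c : ℂ)

@[simp] lemma add_φ : (u + v).φ = u.φ + v.φ := rfl
@[simp] lemma add_Φ : (u + v).Φ = u.Φ + v.Φ := rfl
@[simp] lemma add_ψ : (u + v).ψ = u.ψ + v.ψ := rfl
@[simp] lemma add_Ψ : (u + v).Ψ = u.Ψ + v.Ψ := rfl
@[simp] lemma add_w : (u + v).w = u.w + v.w := rfl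
@[simp] lemma add_W : (u + v).W = u.W + v.W := rfl
@[simp] lemma add_θ : (u + v).θ = u.θ + v.θ := rfl
@[simp] lemma add_η : (u + v).η = u.η + v.η := rfl
@[simp] lemma add_ξ : (u + v).ξ = u.ξ + v.ξ := rfl
@[simp] lemma add_ζ : (u + v).ζ = u.ζ + v.ζ := rfl
@[simp] lemma smul_φ : (c • u).φ = c • u.φ := rfl
@[simp] lemma smul_Φ : (c • u).Φ = c • u.Φ := rfl
@[simp] lemma smul_ψ : (c • u).ψ = c • u.ψ := rfl
@[simp] lemma smul_Ψ : (c • u).Ψ = c • u.Ψ := rfl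
@[simp] lemma smul_w : (c • u).w = c • u.w := rfl
@[simp] lemma smul_W : (c • u).W = c • u.W := rfl
@[simp] lemma smul_θ : (c • u).θ = c • u.θ := rfl
@[simp] lemma smul_η : (c • u).η = c • u.η := rfl
@[simp] lemma smul_ξ : (c • u).ξ = c • u.ξ := rfl
@[simp] lemma smul_ζ : (c • u).ζ = c • u.ζ := rfl
@[simp] lemma zero_φ : (0 : PhaseSpace S).φ = 0 := rfl
@[simp] lemma zero_Φ : (0 : PhaseSpace S).Φ = 0 := rfl
@[simp] lemma zero_ψ : (0 : PhaseSpace S).ψ = 0 := rfl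
@[simp] lemma zero_Ψ : (0 : PhaseSpace S).Ψ = 0 := rfl
@[simp] lemma zero_w : (0 : PhaseSpace S).w = 0 := rfl
@[simp] lemma zero_W : (0 : PhaseSpace S).W = 0 := rfl
@[simp] lemma zero_θ : (0 : PhaseSpace S).θ = 0 := rfl
@[simp] lemma zero_η : (0 : PhaseSpace S).η = 0 := rfl
@[simp] lemma zero_ξ : (0 : PhaseSpace S).ξ = 0 := rfl
@[simp] lemma zero_ζ : (0 : PhaseSpace S).ζ = 0 := rfl

end components

/-- `ψ_x` for `ψ ∈ H¹_*`. -/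
def gradStar (ℓ : ℝ) : H1star ℓ →ₗ[ℂ] L2 ℓ where
  toFun f := weakDeriv (f : L2 ℓ)
  map_add' f g := by rw [Submodule.coe_add, weakDeriv_add f.2.1 g.2.1]
  map_smul' c f := by rw [Submodule.coe_smul, weakDeriv_smul c f.2.1]; rfl

/-- `φ_x + ψ + l w`. -/
def shear (S : BGPData) : PhaseSpace S →ₗ[ℂ] L2 S.ℓ where
  toFun u := u.φ.grad + (u.ψ : L2 S.ℓ) + (S.l : ℂ) • (u.w : L2 S.ℓ)
  map_add' u v := by
    simp only [add_φ, add_ψ, add_w, map_add, Submodule.coe_add, smul_add]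
    abel
  map_smul' c u := by
    simp only [smul_φ, smul_ψ, smul_w, map_smul, Submodule.coe_smul, smul_add, RingHom.id_apply,
      smul_comm c]

/-- `w_x - l φ`. -/
def axial (S : BGPData) : PhaseSpace S →ₗ[ℂ] L2 S.ℓ where
  toFun u := gradStar S.ℓ u.w - (S.l : ℂ) • u.φ.toL2
  map_add' u v := by
    simp only [add_φ, add_w, map_add, smul_add]
    abel
  map_smul' c u := by
    simp only [smul_φ, smul_w, map_smul, smul_sub, RingHom.id_apply, smul_comm c]

/-- The energy inner product. -/
def energyInner (u v : PhaseSpace S) : ℂ :=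
  S.k * inner ℂ (shear S u) (shear S v) + S.ρ₁ * inner ℂ u.Φ v.Φ +
  S.b * inner ℂ (gradStar S.ℓ u.ψ) (gradStar S.ℓ v.ψ) + S.ρ₂ * inner ℂ (u.Ψ : L2 S.ℓ) (v.Ψ : L2 S.ℓ) +
  S.k₀ * inner ℂ (axial S u) (axial S v) + S.ρ₁ * inner ℂ (u.W : L2 S.ℓ) (v.W : L2 S.ℓ) +
  S.ρ₃ * inner ℂ u.θ v.θ + S.ϖ * inner ℂ u.η v.η +
  S.ρ₃ * inner ℂ u.ξ v.ξ + S.ϖ * inner ℂ u.ζ v.ζ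

lemma energyInner_self_re (u : PhaseSpace S) : (energyInner u u).re =
    S.k * ‖shear S u‖ ^ 2 + S.ρ₁ * ‖u.Φ‖ ^ 2 + S.b * ‖gradStar S.ℓ u.ψ‖ ^ 2 +
    S.ρ₂ * ‖u.Ψ‖ ^ 2 + S.k₀ * ‖axial S u‖ ^ 2 + S.ρ₁ * ‖u.W‖ ^ 2 + S.ρ₃ * ‖u.θ‖ ^ 2 +
    S.ϖ * ‖u.η‖ ^ 2 + S.ρ₃ * ‖u.ξ‖ ^ 2 + S.ϖ * ‖u.ζ‖ ^ 2 := by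
  simp only [energyInner, Complex.add_re, Complex.re_ofReal_mul]
  simp only [norm_sq_eq_re_inner (𝕜 := ℂ)]
  rfl

lemma eq_zero_of_energy {u : PhaseSpace S} (h : energyInner u u = 0) : u = 0 := by
  have h' := energyInner_self_re u
  rw [h, Complex.zero_re] at h'
  have := S.ρ₁_pos
  have := S.ρ₂_pos
  have := S.ρ₃_pos
  have := S.k_pos
  have := S.k₀_pos
  have := S.b_pos
  have := S.ϖ_pos
  have aux : ∀ {E : Type} [NormedAddCommGroup E] {a : ℝ} {x : E}, 0 < a →
      a * ‖x‖ ^ 2 ≤ 0 → x = 0 := by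
    intro E _ a x ha hx
    have h1 : ‖x‖ ^ 2 ≤ 0 := nonpos_of_mul_nonpos_right hx ha
    exact norm_eq_zero.1 (pow_eq_zero_iff (two_ne_zero) |>.1 (le_antisymm h1 (sq_nonneg _)))
  have p1 : 0 ≤ S.k * ‖shear S u‖ ^ 2 := by positivity
  have p2 : 0 ≤ S.ρ₁ * ‖u.Φ‖ ^ 2 := by positivity
  have p3 : 0 ≤ S.b * ‖gradStar S.ℓ u.ψ‖ ^ 2 := by positivity
  have p4 : 0 ≤ S.ρ₂ * ‖u.Ψ‖ ^ 2 := by positivity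
  have p5 : 0 ≤ S.k₀ * ‖axial S u‖ ^ 2 := by positivity
  have p6 : 0 ≤ S.ρ₁ * ‖u.W‖ ^ 2 := by positivity
  have p7 : 0 ≤ S.ρ₃ * ‖u.θ‖ ^ 2 := by positivity
  have p8 : 0 ≤ S.ϖ * ‖u.η‖ ^ 2 := by positivity
  have p9 : 0 ≤ S.ρ₃ * ‖u.ξ‖ ^ 2 := by positivity
  have p10 : 0 ≤ S.ϖ * ‖u.ζ‖ ^ 2 := by positivity
  have z1 : shear S u = 0 := aux S.k_pos (by linarith)
  have z3 : gradStar S.ℓ u.ψ = 0 := aux S.b_pos (by linarith)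
  have z5 : axial S u = 0 := aux S.k₀_pos (by linarith)
  obtain ⟨hφ, hψ, hw⟩ := displacement_eq_zero S.ℓ_pos S.l_pos S.lℓ_ne u.φ.toL2_mem u.ψ.2 u.w.2
    z1 z3 z5
  ext1
  · exact Subtype.ext hφ
  · exact aux S.ρ₁_pos (by linarith)
  · exact Subtype.ext hψ
  · exact aux S.ρ₂_pos (by linarith)
  · exact Subtype.ext hw
  · exact aux S.ρ₁_pos (by linarith)
  · exact aux S.ρ₃_pos (by linarith)
  · exact aux S.ϖ_pos (by linarith)
  · exact aux S.ρ₃_pos (by linarith)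
  · exact aux S.ϖ_pos (by linarith)

instance : InnerProductSpace.Core ℂ (PhaseSpace S) where
  inner u v := energyInner u v
  conj_inner_symm u v := by
    simp only [energyInner, map_add, map_mul, Complex.conj_ofReal, inner_conj_symm]
  re_inner_nonneg u := by
    have := S.ρ₁_pos
    have := S.ρ₂_pos
    have := S.ρ₃_pos
    have := S.k_pos
    have := S.k₀_pos
    have := S.b_pos
    have := S.ϖ_pos
    refine le_of_le_of_eq ?_ (energyInner_self_re u).symm
    positivity
  add_left u v z := by
    simp only [energyInner, map_add, add_Φ, add_ψ, add_Ψ, add_W, add_θ, add_η, add_ξ, add_ζ,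
      Submodule.coe_add,
      inner_add_left]
    ring
  smul_left u v c := by
    simp only [energyInner, map_smul, smul_Φ, smul_ψ, smul_Ψ, smul_W, smul_θ, smul_η, smul_ξ,
      smul_ζ, Submodule.coe_smul, inner_smul_left]
    ring
  definite u h := eq_zero_of_energy h

instance : NormedAddCommGroup (PhaseSpace S) :=
  InnerProductSpace.Core.toNormedAddCommGroup (𝕜 := ℂ)

instance : InnerProductSpace ℂ (PhaseSpace S) := InnerProductSpace.ofCore _

/-- The norm of the phase space is the energy norm. -/
lemma norm_sq_eq (u : PhaseSpace S) : ‖u‖ ^ 2 =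
    S.k * ‖u.φ.grad + (u.ψ : L2 S.ℓ) + (S.l : ℂ) • (u.w : L2 S.ℓ)‖ ^ 2 + S.ρ₁ * ‖u.Φ‖ ^ 2 +
    S.b * ‖weakDeriv (u.ψ : L2 S.ℓ)‖ ^ 2 + S.ρ₂ * ‖u.Ψ‖ ^ 2 +
    S.k₀ * ‖weakDeriv (u.w : L2 S.ℓ) - (S.l : ℂ) • u.φ.toL2‖ ^ 2 + S.ρ₁ * ‖u.W‖ ^ 2 +
    S.ρ₃ * ‖u.θ‖ ^ 2 + S.ϖ * ‖u.η‖ ^ 2 + S.ρ₃ * ‖u.ξ‖ ^ 2 + S.ϖ * ‖u.ζ‖ ^ 2 := by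
  rw [norm_sq_eq_re_inner (𝕜 := ℂ) u]
  exact energyInner_self_re u

end PhaseSpace

/-- `∫₀^∞ μ(s) η(s) ds`, a Bochner integral in `H¹₀`. -/
def memMean {ℓ : ℝ} (μ : MemoryKernel) : Memory ℓ μ →ₗ[ℂ] H10 ℓ where
  toFun η := ∫ s, η s ∂μ.measure
  map_add' η₁ η₂ := by
    rw [← integral_add ((Lp.memLp η₁).integrable (by norm_num))
      ((Lp.memLp η₂).integrable (by norm_num))]
    exact integral_congr_ae (Lp.coeFn_add _ _)
  map_smul' c η := by
    rw [RingHom.id_apply, ← integral_smul]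
    exact integral_congr_ae (Lp.coeFn_smul _ _)

open PhaseSpace

/-- The domain `D(A)`. -/
structure InDomain {S : BGPData} (u : PhaseSpace S) : Prop where
  φ : u.φ.toL2 ∈ H2 S.ℓ
  Φ : u.Φ ∈ H10sub S.ℓ
  ψ_x : gradStar S.ℓ u.ψ ∈ H10sub S.ℓ
  w_x : gradStar S.ℓ u.w ∈ H10sub S.ℓ
  Ψ : (u.Ψ : L2 S.ℓ) ∈ H1 S.ℓ
  W : (u.W : L2 S.ℓ) ∈ H1 S.ℓ
  θ : u.θ ∈ H10sub S.ℓ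
  ξ : u.ξ ∈ H10sub S.ℓ
  η_mean : (memMean S.μ u.η).toL2 ∈ H2 S.ℓ
  ζ_mean : (memMean S.ν u.ζ).toL2 ∈ H2 S.ℓ
  η : u.η ∈ (transport S.ℓ S.μ).domain
  ζ : u.ζ ∈ (transport S.ℓ S.ν).domain

/-- The domain `D(A)` as a subspace of the phase space. -/
def bgpDomain (S : BGPData) : Submodule ℂ (PhaseSpace S) where
  carrier := {u | InDomain u}
  add_mem' {u v} hu hv := by
    constructor
    · simpa only [add_φ, map_add] using add_mem hu.φ hv.φ
    · exact add_mem hu.Φ hv.Φ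
    · simpa only [add_ψ, map_add] using add_mem hu.ψ_x hv.ψ_x
    · simpa only [add_w, map_add] using add_mem hu.w_x hv.w_x
    · exact add_mem hu.Ψ hv.Ψ
    · exact add_mem hu.W hv.W
    · exact add_mem hu.θ hv.θ
    · exact add_mem hu.ξ hv.ξ
    · simpa only [add_η, map_add] using add_mem hu.η_mean hv.η_mean
    · simpa only [add_ζ, map_add] using add_mem hu.ζ_mean hv.ζ_mean
    · exact add_mem hu.η hv.η
    · exact add_mem hu.ζ hv.ζ
  zero_mem' := by
    constructor
    · simpa only [zero_φ, map_zero] using zero_mem _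
    · exact zero_mem _
    · simpa only [zero_ψ, map_zero] using zero_mem _
    · simpa only [zero_w, map_zero] using zero_mem _
    · exact zero_mem (H1 S.ℓ)
    · exact zero_mem (H1 S.ℓ)
    · exact zero_mem _
    · exact zero_mem _
    · simpa only [zero_η, map_zero] using zero_mem _
    · simpa only [zero_ζ, map_zero] using zero_mem _
    · exact zero_mem _
    · exact zero_mem _
  smul_mem' c u hu := by
    constructor
    · simpa only [smul_φ, map_smul] using Submodule.smul_mem _ c hu.φ
    · exact Submodule.smul_mem _ c hu.Φ
    · simpa only [smul_ψ, map_smul] using Submodule.smul_mem _ c hu.ψ_x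
    · simpa only [smul_w, map_smul] using Submodule.smul_mem _ c hu.w_x
    · exact Submodule.smul_mem _ c hu.Ψ
    · exact Submodule.smul_mem _ c hu.W
    · exact Submodule.smul_mem _ c hu.θ
    · exact Submodule.smul_mem _ c hu.ξ
    · simpa only [smul_η, map_smul] using Submodule.smul_mem _ c hu.η_mean
    · simpa only [smul_ζ, map_smul] using Submodule.smul_mem _ c hu.ζ_mean
    · exact Submodule.smul_mem _ c hu.η
    · exact Submodule.smul_mem _ c hu.ζ

section generator

variable {S : BGPData}

lemma InDomain.shear_mem {u : PhaseSpace S} (h : InDomain u) : shear S u ∈ H1 S.ℓ :=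
  add_mem (add_mem h.φ.2 u.ψ.2.1) (Submodule.smul_mem _ _ u.w.2.1)

lemma InDomain.axial_mem {u : PhaseSpace S} (h : InDomain u) : axial S u ∈ H10sub S.ℓ :=
  sub_mem h.w_x (Submodule.smul_mem _ _ u.φ.toL2_mem)

lemma shear_mem_L2star (u : PhaseSpace S) : shear S u ∈ L2star S.ℓ :=
  add_mem (add_mem (weakDeriv_mem_L2star u.φ.toL2_mem) u.ψ.2.2) (Submodule.smul_mem _ _ u.w.2.2)

/-- The action of `A` on `u ∈ D(A)`, component by component. -/
def bgpAction (u : PhaseSpace S) (h : InDomain u) : PhaseSpace S where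
  φ := H10.mk u.Φ h.Φ
  Φ := (S.k / S.ρ₁ : ℂ) • weakDeriv (shear S u) + (S.l * S.k₀ / S.ρ₁ : ℂ) • axial S u -
    (S.l * S.γ / S.ρ₁ : ℂ) • u.ξ
  ψ := ⟨u.Ψ, h.Ψ, u.Ψ.2⟩
  Ψ := ⟨(S.b / S.ρ₂ : ℂ) • weakDeriv (gradStar S.ℓ u.ψ) - (S.k / S.ρ₂ : ℂ) • shear S u -
      (S.γ / S.ρ₂ : ℂ) • weakDeriv u.θ,
    sub_mem (sub_mem (Submodule.smul_mem _ _ (weakDeriv_mem_L2star h.ψ_x))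
      (Submodule.smul_mem _ _ (shear_mem_L2star u)))
      (Submodule.smul_mem _ _ (weakDeriv_mem_L2star h.θ))⟩
  w := ⟨u.W, h.W, u.W.2⟩
  W := ⟨(S.k₀ / S.ρ₁ : ℂ) • weakDeriv (axial S u) - (S.l * S.k / S.ρ₁ : ℂ) • shear S u -
      (S.γ / S.ρ₁ : ℂ) • weakDeriv u.ξ,
    sub_mem (sub_mem (Submodule.smul_mem _ _ (weakDeriv_mem_L2star h.axial_mem))
      (Submodule.smul_mem _ _ (shear_mem_L2star u)))
      (Submodule.smul_mem _ _ (weakDeriv_mem_L2star h.ξ))⟩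
  θ := (S.ϖ / S.ρ₃ : ℂ) • weakDeriv (memMean S.μ u.η).grad -
    (S.γ / S.ρ₃ : ℂ) • weakDeriv (u.Ψ : L2 S.ℓ)
  η := transport S.ℓ S.μ ⟨u.η, h.η⟩ + Lp.const 2 S.μ.measure (H10.mk u.θ h.θ)
  ξ := (S.ϖ / S.ρ₃ : ℂ) • weakDeriv (memMean S.ν u.ζ).grad -
    (S.γ / S.ρ₃ : ℂ) • (weakDeriv (u.W : L2 S.ℓ) - (S.l : ℂ) • u.Φ)
  ζ := transport S.ℓ S.ν ⟨u.ζ, h.ζ⟩ + Lp.const 2 S.ν.measure (H10.mk u.ξ h.ξ)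

lemma bgpAction_add {u v : PhaseSpace S} (hu : InDomain u) (hv : InDomain v)
    (huv : InDomain (u + v)) : bgpAction (u + v) huv = bgpAction u hu + bgpAction v hv := by
  ext1
  · rfl
  · simp only [bgpAction, add_Φ, map_add, weakDeriv_add hu.shear_mem hv.shear_mem, add_ξ, smul_add]
    abel
  · rfl
  · refine Subtype.ext ?_
    simp only [bgpAction, add_Ψ, add_ψ, add_θ, map_add, Submodule.coe_add,
      weakDeriv_add (H10sub_le_H1 hu.ψ_x) (H10sub_le_H1 hv.ψ_x),
      weakDeriv_add (H10sub_le_H1 hu.θ) (H10sub_le_H1 hv.θ), smul_add]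
    abel
  · rfl
  · refine Subtype.ext ?_
    simp only [bgpAction, add_W, add_ξ, map_add, Submodule.coe_add,
      weakDeriv_add (H10sub_le_H1 hu.axial_mem) (H10sub_le_H1 hv.axial_mem),
      weakDeriv_add (H10sub_le_H1 hu.ξ) (H10sub_le_H1 hv.ξ), smul_add]
    abel
  · simp only [bgpAction, add_θ, add_η, add_Ψ, map_add, Submodule.coe_add,
      weakDeriv_add (f := (memMean S.μ u.η).grad) (g := (memMean S.μ v.η).grad) hu.η_mean.2 hv.η_mean.2,
      weakDeriv_add hu.Ψ hv.Ψ, smul_add]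
    abel
  · have e1 : transport S.ℓ S.μ ⟨(u + v).η, huv.η⟩ =
        transport S.ℓ S.μ ⟨u.η, hu.η⟩ + transport S.ℓ S.μ ⟨v.η, hv.η⟩ :=
      (transport S.ℓ S.μ).map_add ⟨u.η, hu.η⟩ ⟨v.η, hv.η⟩
    have e2 := map_add (Lp.const 2 S.μ.measure) (H10.mk u.θ hu.θ) (H10.mk v.θ hv.θ)
    change transport S.ℓ S.μ ⟨(u + v).η, huv.η⟩ +
      Lp.const 2 S.μ.measure ((H10.mk u.θ hu.θ) + (H10.mk v.θ hv.θ)) = _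
    rw [e1, e2]
    simp only [bgpAction, add_η]
    abel
  · simp only [bgpAction, add_ξ, add_ζ, add_W, add_Φ, map_add, Submodule.coe_add,
      weakDeriv_add (f := (memMean S.ν u.ζ).grad) (g := (memMean S.ν v.ζ).grad) hu.ζ_mean.2 hv.ζ_mean.2,
      weakDeriv_add hu.W hv.W, smul_add, smul_sub]
    abel
  · have e1 : transport S.ℓ S.ν ⟨(u + v).ζ, huv.ζ⟩ =
        transport S.ℓ S.ν ⟨u.ζ, hu.ζ⟩ + transport S.ℓ S.ν ⟨v.ζ, hv.ζ⟩ :=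
      (transport S.ℓ S.ν).map_add ⟨u.ζ, hu.ζ⟩ ⟨v.ζ, hv.ζ⟩
    have e2 := map_add (Lp.const 2 S.ν.measure) (H10.mk u.ξ hu.ξ) (H10.mk v.ξ hv.ξ)
    change transport S.ℓ S.ν ⟨(u + v).ζ, huv.ζ⟩ +
      Lp.const 2 S.ν.measure ((H10.mk u.ξ hu.ξ) + (H10.mk v.ξ hv.ξ)) = _
    rw [e1, e2]
    simp only [bgpAction, add_ζ]
    abel

lemma bgpAction_smul {u : PhaseSpace S} (c : ℂ) (hu : InDomain u)
    (huv : InDomain (c • u)) : bgpAction (c • u) huv = c • bgpAction u hu := by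
  ext1
  · rfl
  · simp only [bgpAction, smul_Φ, map_smul, weakDeriv_smul c hu.shear_mem, smul_ξ, smul_add,
      smul_sub, smul_comm c]
  · rfl
  · refine Subtype.ext ?_
    simp only [bgpAction, smul_Ψ, smul_ψ, smul_θ, map_smul, Submodule.coe_smul,
      weakDeriv_smul c (H10sub_le_H1 hu.ψ_x), weakDeriv_smul c (H10sub_le_H1 hu.θ), smul_sub,
      smul_comm c]
  · rfl
  · refine Subtype.ext ?_
    simp only [bgpAction, smul_W, smul_ξ, map_smul, Submodule.coe_smul,
      weakDeriv_smul c (H10sub_le_H1 hu.axial_mem), weakDeriv_smul c (H10sub_le_H1 hu.ξ),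
      smul_sub, smul_comm c]
  · simp only [bgpAction, smul_θ, smul_η, smul_Ψ, map_smul, Submodule.coe_smul,
      weakDeriv_smul (f := (memMean S.μ u.η).grad) c hu.η_mean.2,
      weakDeriv_smul c hu.Ψ, smul_sub, smul_comm c]
  · have e1 : transport S.ℓ S.μ ⟨(c • u).η, huv.η⟩ = c • transport S.ℓ S.μ ⟨u.η, hu.η⟩ :=
      (transport S.ℓ S.μ).map_smul c ⟨u.η, hu.η⟩
    have e2 := map_smul (Lp.constₗ 2 S.μ.measure ℂ) c (H10.mk u.θ hu.θ)
    change transport S.ℓ S.μ ⟨(c • u).η, huv.η⟩ +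
      Lp.constₗ 2 S.μ.measure ℂ (c • (H10.mk u.θ hu.θ)) = _
    rw [e1, e2, ← smul_add]
    rfl
  · simp only [bgpAction, smul_ξ, smul_ζ, smul_W, smul_Φ, map_smul, Submodule.coe_smul,
      weakDeriv_smul (f := (memMean S.ν u.ζ).grad) c hu.ζ_mean.2,
      weakDeriv_smul c hu.W, smul_sub, smul_comm c]
  · have e1 : transport S.ℓ S.ν ⟨(c • u).ζ, huv.ζ⟩ = c • transport S.ℓ S.ν ⟨u.ζ, hu.ζ⟩ :=
      (transport S.ℓ S.ν).map_smul c ⟨u.ζ, hu.ζ⟩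
    have e2 := map_smul (Lp.constₗ 2 S.ν.measure ℂ) c (H10.mk u.ξ hu.ξ)
    change transport S.ℓ S.ν ⟨(c • u).ζ, huv.ζ⟩ +
      Lp.constₗ 2 S.ν.measure ℂ (c • (H10.mk u.ξ hu.ξ)) = _
    rw [e1, e2, ← smul_add]
    rfl

end generator

/-- The generator `A` of the Bresse-Gurtin-Pipkin system. -/
def bgpGenerator (S : BGPData) : PhaseSpace S →ₗ.[ℂ] PhaseSpace S where
  domain := bgpDomain S
  toFun :=
    { toFun := fun u => bgpAction u.1 u.2
      map_add' := fun u v => bgpAction_add u.2 v.2 (u + v).2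
      map_smul' := fun c u => bgpAction_smul c u.2 (c • u).2 }

/-- The resolvent set of an unbounded operator `A : D(A) ⊆ X → X`: the complex numbers `z` for
which `z - A : D(A) → X` is a bijection with bounded inverse `R : X → X`. -/
def unboundedResolventSet {X : Type*} [NormedAddCommGroup X] [NormedSpace ℂ X]
    (A : X →ₗ.[ℂ] X) : Set ℂ :=
  {z | ∃ R : X →L[ℂ] X, (∀ x : X, ∃ h : R x ∈ A.domain, z • R x - A ⟨R x, h⟩ = x) ∧
    ∀ u : A.domain, R (z • (u : X) - A u) = u}

end Bresse

end

noncomputable section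

open MeasureTheory Set Filter Topology
open scoped ContDiff ComplexConjugate InnerProductSpace

namespace Bresse

/-! ### Weak derivatives in terms of the inner product of `L²` -/

section interval

variable {ℓ : ℝ}

/-! The imaginary axis is swept by continuation from `0`. For `z` with `z.re = 0`,
`exists_norm_le_residual` gives a bound `c * ‖u‖ ≤ ‖(z - A) u‖` with `c > 0`. A Neumann series
around a point of the resolvent set has radius at least `c`, so such bounds make the set of `r` with
`I * r` in the resolvent set both open and closed (`I_mul_mem_unboundedResolventSet`). It contains
`0`, because `A` is onto (`exists_bgpAction_eq`) and bounded below. Connectedness of the real line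
concludes.

The lower bound is proved by contradiction, with unit vectors `u n` whose residuals tend to zero.
All couplings in `A` are skew except the two transport terms, so pairing the residual with `u n`
forces `η, ζ → 0` (`inner_bgpAction_re_le`, `memory_norm_sq_le`). An element of the domain of the
transport operator is the primitive of its derivative, and the primitive is a bounded operator on
the memory space thanks to the exponential decay of the kernel (`memLp_primitive`,
`eq_primitive_of_mem`). Averaging the memory equation therefore expresses `θ` and `ξ` through null
quantities, and they vanish in `H¹₀` (`IsNull.of_memory`). The first heat equation then gives `Ψ →
0` (`Psi_null`).

If `z ≠ 0`, then `ψ → 0`. An interpolation gives `ψ_x → 0`, the rotation equation gives `shear → 0`,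
and the second heat equation gives `axial → 0` (`strain_null`). The energy norm controls `φ` and `w`
through the strains, so the displacements and then the velocities vanish. If `z = 0`, the velocities
are minus residual components, and testing the three elastic equations with `φ, ψ, w` yields the
elastic energy (`strain_null_of_velocity`).

The condition on `l * ℓ` makes the system `φ_x + l w = a`, `w_x - l φ = d` solvable with `φ ∈ H¹₀`
and `w` of zero mean (`exists_displacement`). This is used for the displacements, which gives
completeness of the phase space and so the closed graph theorem, and again for the stresses when
solving `A u = f`. -/

/-- A continuous function as an element of `L²(0, ℓ)`. -/
def ofCont (ℓ : ℝ) {v : ℝ → ℂ} (hv : Continuous v) : L2 ℓ := (memLp_of_continuous hv).toLp v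

lemma coeFn_ofCont {v : ℝ → ℂ} (hv : Continuous v) :
    ofCont ℓ hv =ᵐ[volume.restrict (Ioo (0 : ℝ) ℓ)] v :=
  MemLp.coeFn_toLp _

lemma inner_ofCont {v : ℝ → ℂ} (hv : Continuous v) (f : L2 ℓ) :
    inner ℂ (ofCont ℓ hv) f = ∫ x in Ioo (0 : ℝ) ℓ, f x * conj (v x) := by
  rw [L2.inner_def]
  refine integral_congr_ae ?_
  filter_upwards [coeFn_ofCont (ℓ := ℓ) hv] with x hx
  rw [hx]
  simp

lemma deriv_conj_comp {v : ℝ → ℂ} (hv : ContDiff ℝ ∞ v) :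
    deriv (fun x => conj (v x)) = fun x => conj (deriv v x) := by
  ext x
  exact ((hv.differentiable (by simp) x).hasDerivAt.star).deriv

lemma contDiff_conj {v : ℝ → ℂ} (hv : ContDiff ℝ ∞ v) : ContDiff ℝ ∞ (fun x => conj (v x)) :=
  Complex.conjCLE.contDiff.comp hv

lemma IsTest.conj {v : ℝ → ℂ} (hv : IsTest ℓ v) : IsTest ℓ (fun x => conj (v x)) :=
  ⟨contDiff_conj hv.smooth, hv.compact.comp_left (g := fun z : ℂ => conj z) (by simp),
    (tsupport_comp_subset (g := fun z : ℂ => conj z) (by simp) v).trans hv.support⟩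

lemma hasWeakDeriv_iff_inner {f g : L2 ℓ} : HasWeakDeriv ℓ f g ↔
    ∀ (v : ℝ → ℂ) (hv : IsTest ℓ v),
      inner ℂ (ofCont ℓ hv.continuous_deriv) f = -inner ℂ (ofCont ℓ hv.smooth.continuous) g := by
  simp only [inner_ofCont]
  constructor
  · intro h v hv
    have := h _ hv.conj
    rwa [deriv_conj_comp hv.smooth] at this
  · intro h v hv
    have := h _ hv.conj
    rw [deriv_conj_comp hv.smooth] at this
    simpa using this

lemma IsTest.mem_testGraph {v : ℝ → ℂ} (hv : IsTest ℓ v) :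
    (ofCont ℓ hv.smooth.continuous, ofCont ℓ hv.continuous_deriv) ∈ testGraph ℓ :=
  ⟨v, hv, coeFn_ofCont hv.smooth.continuous, coeFn_ofCont hv.continuous_deriv⟩

/-- Integration by parts between `H¹₀` and `H¹`. -/
lemma inner_weakDeriv {f a a' : L2 ℓ} (hf : f ∈ H10sub ℓ) (ha : HasWeakDeriv ℓ a a') :
    inner ℂ (weakDeriv f) a = -inner ℂ f a' := by
  have hcl : IsClosed {p : L2 ℓ × L2 ℓ | inner ℂ p.2 a = -inner ℂ p.1 a'} :=
    isClosed_eq (by fun_prop) (by fun_prop)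
  refine closure_minimal ?_ hcl (mem_H10sub_iff.1 hf)
  rintro ⟨p, q⟩ ⟨v, hv, h₁, h₂⟩
  have e₁ : p = ofCont ℓ hv.smooth.continuous := Lp.ext (h₁.trans (coeFn_ofCont _).symm)
  have e₂ : q = ofCont ℓ hv.continuous_deriv := Lp.ext (h₂.trans (coeFn_ofCont _).symm)
  rw [mem_ofPred_eq, e₁, e₂]
  exact hasWeakDeriv_iff_inner.1 ha v hv

lemma inner_weakDeriv_right {f a a' : L2 ℓ} (hf : f ∈ H10sub ℓ) (ha : HasWeakDeriv ℓ a a') :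
    inner ℂ a (weakDeriv f) = -inner ℂ a' f := by
  rw [← inner_conj_symm, inner_weakDeriv hf ha, map_neg, inner_conj_symm]

lemma HasWeakDeriv.mem_H1 {f g : L2 ℓ} (h : HasWeakDeriv ℓ f g) : f ∈ H1 ℓ := ⟨g, h⟩

lemma HasWeakDeriv.sub {f₁ f₂ g₁ g₂ : L2 ℓ} (h₁ : HasWeakDeriv ℓ f₁ g₁)
    (h₂ : HasWeakDeriv ℓ f₂ g₂) : HasWeakDeriv ℓ (f₁ - f₂) (g₁ - g₂) := by
  have := h₁.add (h₂.smul (-1))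
  simpa only [neg_one_smul, ← sub_eq_add_neg] using this

/-- The graph of the weak derivative is closed. -/
lemma HasWeakDeriv.of_tendsto {f g : ℕ → L2 ℓ} {f₀ g₀ : L2 ℓ}
    (h : ∀ n, HasWeakDeriv ℓ (f n) (g n)) (hf : Tendsto f atTop (𝓝 f₀))
    (hg : Tendsto g atTop (𝓝 g₀)) : HasWeakDeriv ℓ f₀ g₀ := by
  rw [hasWeakDeriv_iff]
  intro v hv
  have h1 : Tendsto (fun n => pairing hv.continuous_deriv (f n) +
      pairing hv.smooth.continuous (g n)) atTop
      (𝓝 (pairing hv.continuous_deriv f₀ + pairing hv.smooth.continuous g₀)) :=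
    (((pairing hv.continuous_deriv).continuous.tendsto _).comp hf).add
      (((pairing hv.smooth.continuous).continuous.tendsto _).comp hg)
  refine tendsto_nhds_unique h1 ?_
  simp only [hasWeakDeriv_iff.1 (h _) v hv]
  exact tendsto_const_nhds

/-- Smooth functions are weakly differentiable. -/
lemma hasWeakDeriv_ofCont {v v' : ℝ → ℂ} (hv : ContDiff ℝ ∞ v)
    (hd : ∀ x, HasDerivAt v (v' x) x) (hv' : Continuous v') :
    HasWeakDeriv ℓ (ofCont ℓ hv.continuous) (ofCont ℓ hv') := by
  intro u hu
  have e : v' = deriv v := funext fun x => (hd x).deriv.symm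
  have e₁ : ∫ x in Ioo (0 : ℝ) ℓ, ofCont ℓ hv.continuous x * deriv u x =
      ∫ x in Ioo (0 : ℝ) ℓ, deriv u x * v x := by
    refine integral_congr_ae ?_
    filter_upwards [coeFn_ofCont (ℓ := ℓ) hv.continuous] with x hx
    rw [hx, mul_comm]
  have e₂ : ∫ x in Ioo (0 : ℝ) ℓ, ofCont ℓ hv' x * u x =
      ∫ x in Ioo (0 : ℝ) ℓ, u x * deriv v x := by
    refine integral_congr_ae ?_
    filter_upwards [coeFn_ofCont (ℓ := ℓ) hv'] with x hx
    rw [hx, mul_comm, e]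
  rw [e₁, e₂, hu.integral_deriv_mul hv]

/-- The constant function `1` in `L²(0, ℓ)`. -/
def oneL2 (ℓ : ℝ) : L2 ℓ := ofCont ℓ (continuous_const (y := (1 : ℂ)))

/-- The function `x` in `L²(0, ℓ)`. -/
def idL2 (ℓ : ℝ) : L2 ℓ := ofCont ℓ Complex.continuous_ofReal

lemma hasWeakDeriv_oneL2 : HasWeakDeriv ℓ (oneL2 ℓ) 0 := by
  have := hasWeakDeriv_ofCont (ℓ := ℓ) (contDiff_const (c := (1 : ℂ)) (n := ∞))
    (v' := fun _ => 0) (fun x => hasDerivAt_const x (1 : ℂ)) continuous_const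
  have e : ofCont ℓ (continuous_const (y := (0 : ℂ))) = 0 :=
    Lp.ext ((coeFn_ofCont continuous_const).trans (Lp.coeFn_zero _ _ _).symm)
  rwa [e] at this

lemma hasWeakDeriv_idL2 : HasWeakDeriv ℓ (idL2 ℓ) (oneL2 ℓ) :=
  hasWeakDeriv_ofCont Complex.ofRealCLM.contDiff
    (fun _ => Complex.ofRealCLM.hasDerivAt) continuous_const

lemma mem_L2star_iff_inner {f : L2 ℓ} : f ∈ L2star ℓ ↔ inner ℂ (oneL2 ℓ) f = 0 := by
  rw [oneL2, inner_ofCont]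
  simp only [map_one, mul_one]
  rfl

lemma inner_oneL2_self (hℓ : 0 ≤ ℓ) : inner ℂ (oneL2 ℓ) (oneL2 ℓ) = (ℓ : ℂ) := by
  rw [oneL2, inner_ofCont]
  have e : ∫ x in Ioo (0 : ℝ) ℓ, ofCont ℓ (continuous_const (y := (1 : ℂ))) x * conj (1 : ℂ) =
      ∫ x in Ioo (0 : ℝ) ℓ, (1 : ℂ) := by
    refine integral_congr_ae ?_
    filter_upwards [coeFn_ofCont (ℓ := ℓ) (continuous_const (y := (1 : ℂ)))] with x hx
    rw [hx]
    simp
  rw [e]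
  simp [hℓ]

lemma isClosed_L2star : IsClosed (L2star ℓ : Set (L2 ℓ)) := by
  have : (L2star ℓ : Set (L2 ℓ)) = {f | inner ℂ (oneL2 ℓ) f = 0} :=
    Set.ext fun f => mem_L2star_iff_inner
  rw [this]
  exact isClosed_eq (by fun_prop) continuous_const

lemma HasWeakDeriv.eq_const (hℓ : 0 < ℓ) {f : L2 ℓ} (h : HasWeakDeriv ℓ f 0) :
    ∃ C : ℂ, f = C • oneL2 ℓ := by
  have h' : HasWeakDeriv ℓ f ((0 : ℂ) • f) := by rwa [zero_smul]
  obtain ⟨C, hC⟩ := h'.eq_exp hℓ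
  refine ⟨C, Lp.ext ?_⟩
  filter_upwards [hC, Lp.coeFn_smul C (oneL2 ℓ),
    coeFn_ofCont (ℓ := ℓ) (continuous_const (y := (1 : ℂ)))] with x h1 h2 h3
  rw [h2, Pi.smul_apply, oneL2, h3, h1]
  simp

lemma H10.norm_grad (f : H10 ℓ) : ‖f.grad‖ = ‖f‖ := (H10.norm_eq f).symm

/-- The gradient as an isometry. -/
def H10.gradIso (ℓ : ℝ) : H10 ℓ →ₗᵢ[ℂ] L2 ℓ := ⟨H10.grad, H10.norm_grad⟩

lemma H10.hasWeakDeriv (f : H10 ℓ) : HasWeakDeriv ℓ f.toL2 f.grad :=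
  hasWeakDeriv_weakDeriv (H10sub_le_H1 f.toL2_mem)

/-- Every function of zero mean is the gradient of an element of `H¹₀`. -/
lemma exists_grad_eq (hℓ : 0 < ℓ) {f : L2 ℓ} (hf : f ∈ L2star ℓ) : ∃ h : H10 ℓ, h.grad = f := by
  have hcl : IsClosed (LinearMap.range (H10.gradIso ℓ).toLinearMap : Set (L2 ℓ)) := by
    have := (H10.gradIso ℓ).isometry.isClosedEmbedding.isClosed_range
    rwa [LinearMap.coe_range]
  suffices hmem : f ∈ LinearMap.range (H10.gradIso ℓ).toLinearMap by
    obtain ⟨h, hh⟩ := hmem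
    exact ⟨h, hh⟩
  have : CompleteSpace (LinearMap.range (H10.gradIso ℓ).toLinearMap) := hcl.completeSpace_coe
  -- The gradient is an isometry from a complete space, so its range is closed and equals its double
  -- orthogonal complement. A vector orthogonal to all derivatives of test functions has weak
  -- derivative zero, hence is a constant, and constants are orthogonal to `f`.
  rw [← Submodule.orthogonal_orthogonal (LinearMap.range (H10.gradIso ℓ).toLinearMap),
    Submodule.mem_orthogonal]
  intro g hg
  rw [Submodule.mem_orthogonal] at hg
  have h0 : HasWeakDeriv ℓ g 0 := by
    rw [hasWeakDeriv_iff_inner]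
    intro v hv
    rw [inner_zero_right, neg_zero]
    have hm := hv.mem_testGraph
    refine hg _ ⟨H10.mk (ofCont ℓ hv.smooth.continuous)
      ⟨_, Submodule.le_topologicalClosure _ hm, rfl⟩, ?_⟩
    exact (closure_hasWeakDeriv (Submodule.le_topologicalClosure _ hm)).weakDeriv_eq
  obtain ⟨C, rfl⟩ := h0.eq_const hℓ
  rw [inner_smul_left, mem_L2star_iff_inner.1 hf, mul_zero]

/-- The norm of the embedding of `H¹₀` into `L²`. -/
lemma H10.exists_norm_toL2_le (ℓ : ℝ) : ∃ C, 0 ≤ C ∧ ∀ f : H10 ℓ, ‖f.toL2‖ ≤ C * ‖f‖ := by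
  refine ⟨(volume.restrict (Ioo (0 : ℝ) ℓ)).real univ ^ ((2 : ENNReal).toReal)⁻¹ *
      (volume.restrict (Ioo (0 : ℝ) ℓ)).real univ ^ ((2 : ENNReal).toReal)⁻¹, by positivity,
      fun f => ?_⟩
  have := closure_poincare f.mem_closure
  rwa [← mul_assoc, H10.norm_grad] at this

/-- The embedding of `H¹₀` into `L²`. -/
def H10.toL2L (ℓ : ℝ) : H10 ℓ →L[ℂ] L2 ℓ :=
  H10.toL2.mkContinuousOfExistsBound
    ⟨(H10.exists_norm_toL2_le ℓ).choose, (H10.exists_norm_toL2_le ℓ).choose_spec.2⟩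

/-- The Poincaré-Wirtinger inequality on `H¹_*`. -/
lemma exists_norm_le_weakDeriv (hℓ : 0 < ℓ) :
    ∃ C, ∀ f g : L2 ℓ, f ∈ L2star ℓ → HasWeakDeriv ℓ f g → ‖f‖ ≤ C * ‖g‖ := by
  obtain ⟨C, hC0, hC⟩ := H10.exists_norm_toL2_le ℓ
  refine ⟨C, fun f g hf hg => ?_⟩
  -- Duality with Poincaré on `H¹₀`: writing `f = h_x` gives `‖f‖² = -⟨h, g⟩`, and `‖h‖` in `L²` is
  -- at most `C * ‖f‖`.
  obtain ⟨h, rfl⟩ := exists_grad_eq hℓ hf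
  have h1 := inner_weakDeriv h.toL2_mem hg
  have h2 : ‖h.grad‖ * ‖h.grad‖ ≤ ‖h.grad‖ * (C * ‖g‖) := by
    calc ‖h.grad‖ * ‖h.grad‖ = ‖inner ℂ h.grad h.grad‖ := by
          rw [inner_self_eq_norm_sq_to_K]; simp [sq]
      _ = ‖inner ℂ h.toL2 g‖ := by
          change ‖inner ℂ (weakDeriv h.toL2) h.grad‖ = _
          rw [h1, norm_neg]
      _ ≤ ‖h.toL2‖ * ‖g‖ := norm_inner_le_norm _ _
      _ ≤ (C * ‖h‖) * ‖g‖ := by gcongr; exact hC h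
      _ = _ := by rw [H10.norm_grad]; ring
  rcases (norm_nonneg h.grad).eq_or_lt with h0 | h0
  · rw [← h0]; positivity
  · exact le_of_mul_le_mul_left h2 h0

/-- Every `a ∈ L²` has a primitive of zero mean. -/
lemma exists_primitive (hℓ : 0 < ℓ) (a : L2 ℓ) : ∃ β ∈ L2star ℓ, HasWeakDeriv ℓ β a := by
  have hℓ' : (ℓ : ℂ) ≠ 0 := by exact_mod_cast hℓ.ne'
  have center : ∀ g : L2 ℓ, g - (inner ℂ (oneL2 ℓ) g / ℓ) • oneL2 ℓ ∈ L2star ℓ := by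
    intro g
    rw [mem_L2star_iff_inner, inner_sub_right, inner_smul_right, inner_oneL2_self hℓ.le]
    field_simp
    ring
  -- The zero-mean part of `a` is a gradient, and its mean has a multiple of `x` as primitive.
  -- Subtracting a constant finally centres the result.
  obtain ⟨h, hh⟩ := exists_grad_eq hℓ (center a)
  have hw := h.hasWeakDeriv
  rw [hh] at hw
  have h1 := hw.add (hasWeakDeriv_idL2.smul (inner ℂ (oneL2 ℓ) a / ℓ))
  rw [sub_add_cancel] at h1
  refine ⟨_, center (h.toL2 + (inner ℂ (oneL2 ℓ) a / ℓ) • idL2 ℓ), ?_⟩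
  have h2 := h1.sub (hasWeakDeriv_oneL2.smul (inner ℂ (oneL2 ℓ)
    (h.toL2 + (inner ℂ (oneL2 ℓ) a / ℓ) • idL2 ℓ) / ℓ))
  rwa [smul_zero, sub_zero] at h2

/-- A function of `H¹` lies in `H¹₀` as soon as integration by parts against `1` and `x` produces
no boundary terms. -/
lemma HasWeakDeriv.mem_H10sub (hℓ : 0 < ℓ) {f g : L2 ℓ} (h : HasWeakDeriv ℓ f g)
    (h₀ : inner ℂ (oneL2 ℓ) g = 0) (h₁ : inner ℂ (idL2 ℓ) g + inner ℂ (oneL2 ℓ) f = 0) :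
    f ∈ H10sub ℓ := by
  -- The hypotheses encode `f(ℓ) - f(0) = 0` and `ℓ f(ℓ) = 0`. The first writes `g` as the gradient
  -- of some `k ∈ H¹₀`, so `f - k` is a constant `C`, and the second reduces to `C ℓ = 0`.
  obtain ⟨k, rfl⟩ := exists_grad_eq hℓ (mem_L2star_iff_inner.2 h₀)
  have hd := h.sub k.hasWeakDeriv
  rw [sub_self] at hd
  obtain ⟨C, hC⟩ := hd.eq_const hℓ
  have hf : f = k.toL2 + C • oneL2 ℓ := by rw [← hC]; abel
  have h2 : inner ℂ (idL2 ℓ) k.grad = -inner ℂ (oneL2 ℓ) k.toL2 :=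
    inner_weakDeriv_right k.toL2_mem hasWeakDeriv_idL2
  rw [h2, hf, inner_add_right, inner_smul_right, inner_oneL2_self hℓ.le, neg_add_cancel_left] at h₁
  have hC0 : C = 0 := (mul_eq_zero.1 h₁).resolve_right (by exact_mod_cast hℓ.ne')
  rw [hf, hC0, zero_smul, add_zero]
  exact k.toL2_mem

lemma memLp_continuous_mul {w : ℝ → ℂ} (hw : Continuous w) (k : L2 ℓ) :
    MemLp (fun x => w x * k x) 2 (volume.restrict (Ioo (0 : ℝ) ℓ)) := by
  obtain ⟨C, hC⟩ := (isCompact_Icc (a := (0 : ℝ)) (b := ℓ)).exists_bound_of_continuousOn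
    hw.continuousOn
  refine (Lp.memLp k).of_le_mul (c := C)
    (hw.aestronglyMeasurable.mul (Lp.aestronglyMeasurable k)) ?_
  filter_upwards [ae_restrict_mem measurableSet_Ioo] with x hx
  rw [norm_mul]
  gcongr
  exact hC x (Ioo_subset_Icc_self hx)

/-- Weak product rule with a smooth factor. -/
lemma HasWeakDeriv.of_mul {f g p q : L2 ℓ} (h : HasWeakDeriv ℓ f g) {v v' : ℝ → ℂ}
    (hv : ContDiff ℝ ∞ v) (hd : ∀ x, HasDerivAt v (v' x) x)
    (hp : p =ᵐ[volume.restrict (Ioo (0 : ℝ) ℓ)] fun x => v x * f x)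
    (hq : q =ᵐ[volume.restrict (Ioo (0 : ℝ) ℓ)] fun x => v x * g x + v' x * f x) :
    HasWeakDeriv ℓ p q := by
  intro u hu
  have e : v' = deriv v := funext fun x => (hd x).deriv.symm
  have hv' : Continuous v' := e ▸ hv.continuous_deriv (by simp)
  have hk := h _ (hu.mul_smooth hv)
  have int : ∀ {w : ℝ → ℂ} (_ : Continuous w) (k : L2 ℓ),
      Integrable (fun x => k x * w x) (volume.restrict (Ioo (0 : ℝ) ℓ)) := fun hw k =>
    (Lp.memLp k).integrable_mul (memLp_of_continuous hw)
  have e₁ : ∫ x in Ioo (0 : ℝ) ℓ, p x * deriv u x =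
      ∫ x in Ioo (0 : ℝ) ℓ, f x * (v x * deriv u x) := by
    refine integral_congr_ae ?_
    filter_upwards [hp] with x hx
    rw [hx]; ring
  have e₂ : ∫ x in Ioo (0 : ℝ) ℓ, q x * u x =
      ∫ x in Ioo (0 : ℝ) ℓ, (g x * (u x * v x) + f x * (v' x * u x)) := by
    refine integral_congr_ae ?_
    filter_upwards [hq] with x hx
    rw [hx]; ring
  have e₃ : ∫ x in Ioo (0 : ℝ) ℓ, f x * deriv (fun x => u x * v x) x =
      ∫ x in Ioo (0 : ℝ) ℓ, (f x * (v x * deriv u x) + f x * (v' x * u x)) := by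
    refine integral_congr_ae (Eventually.of_forall fun x => ?_)
    have : deriv (fun x => u x * v x) x = _ :=
      ((hu.smooth.differentiable (by simp) x).hasDerivAt.mul (hd x)).deriv
    simp only [this]
    ring
  have i₁ : Integrable (fun x => f x * (v x * deriv u x)) (volume.restrict (Ioo (0 : ℝ) ℓ)) :=
    int (hv.continuous.mul hu.continuous_deriv) f
  have i₂ : Integrable (fun x => f x * (v' x * u x)) (volume.restrict (Ioo (0 : ℝ) ℓ)) :=
    int (hv'.mul hu.smooth.continuous) f
  have i₃ : Integrable (fun x => g x * (u x * v x)) (volume.restrict (Ioo (0 : ℝ) ℓ)) :=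
    int (hu.smooth.continuous.mul hv.continuous) g
  rw [e₃, integral_add i₁ i₂] at hk
  rw [e₁, e₂, integral_add i₃ i₂]
  linear_combination hk

/-- Solvability of `z_x = c z + F`. -/
lemma exists_hasWeakDeriv_smul_add (hℓ : 0 < ℓ) (c : ℂ) (F : L2 ℓ) :
    ∃ z : L2 ℓ, HasWeakDeriv ℓ z (c • z + F) := by
  -- Variation of constants: `z = exp (c x) β` with `β` a primitive of `exp (-c x) F`.
  have hG := memLp_continuous_mul (contDiff_exp_mul (-c)).continuous F
  obtain ⟨β, -, hβ⟩ := exists_primitive hℓ (hG.toLp _)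
  have hp := memLp_continuous_mul (contDiff_exp_mul c).continuous β
  refine ⟨hp.toLp _, hβ.of_mul (contDiff_exp_mul c) (hasDerivAt_exp_mul c) hp.coeFn_toLp ?_⟩
  filter_upwards [hG.coeFn_toLp, hp.coeFn_toLp, Lp.coeFn_add (c • hp.toLp _) F,
    Lp.coeFn_smul c (hp.toLp _)] with x h1 h2 h3 h4
  have : Complex.exp (c * x) * Complex.exp (-c * x) = 1 := by
    rw [← Complex.exp_add]; simp
  rw [h3, h1, Pi.add_apply, h4, Pi.smul_apply, h2, smul_eq_mul]
  linear_combination -(F x) * this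

/-- The fundamental theorem of calculus. With `inner_idL2_ofCont_deriv` it evaluates, for smooth
functions, the two boundary functionals in `HasWeakDeriv.mem_H10sub`. -/
lemma inner_oneL2_ofCont_deriv (hℓ : 0 < ℓ) {v v' : ℝ → ℂ} (hd : ∀ x, HasDerivAt v (v' x) x)
    (hv' : Continuous v') : inner ℂ (oneL2 ℓ) (ofCont ℓ hv') = v ℓ - v 0 := by
  rw [oneL2, inner_ofCont, ← intervalIntegral.integral_eq_sub_of_hasDerivAt (fun x _ => hd x)
    (hv'.intervalIntegrable 0 ℓ), intervalIntegral.integral_of_le hℓ.le,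
    integral_Ioc_eq_integral_Ioo]
  refine integral_congr_ae ?_
  filter_upwards [coeFn_ofCont (ℓ := ℓ) hv'] with x hx
  simp [hx]

lemma inner_idL2_ofCont_deriv (hℓ : 0 < ℓ) {v v' : ℝ → ℂ} (hv : Continuous v)
    (hd : ∀ x, HasDerivAt v (v' x) x) (hv' : Continuous v') :
    inner ℂ (idL2 ℓ) (ofCont ℓ hv') + inner ℂ (oneL2 ℓ) (ofCont ℓ hv) = ℓ * v ℓ := by
  have e := intervalIntegral.integral_eq_sub_of_hasDerivAt (a := 0) (b := ℓ)
    (fun x _ => (Complex.ofRealCLM.hasDerivAt (x := x)).mul (hd x))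
    (Continuous.intervalIntegrable (by fun_prop) _ _)
  simp only [Complex.ofRealCLM_apply, Complex.ofReal_zero, zero_mul, sub_zero,
    Complex.ofReal_one, one_mul, Pi.mul_apply] at e
  rw [← e, intervalIntegral.integral_of_le hℓ.le, integral_Ioc_eq_integral_Ioo,
    integral_add (f := v) (g := fun x : ℝ => (x : ℂ) * v' x)
      ((memLp_of_continuous hv).integrable (by norm_num))
      ((memLp_of_continuous (Complex.continuous_ofReal.mul hv')).integrable (by norm_num)),
    idL2, oneL2, inner_ofCont, inner_ofCont, add_comm]
  congr 1 <;> refine integral_congr_ae ?_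
  · filter_upwards [coeFn_ofCont (ℓ := ℓ) hv] with x hx
    simp [hx]
  · filter_upwards [coeFn_ofCont (ℓ := ℓ) hv'] with x hx
    rw [hx, Complex.conj_ofReal, mul_comm]

/-- The zeros of the sine are the integer multiples of `π`; positivity of `l * ℓ` leaves only
positive integers, which `hn` excludes. -/
lemma sin_mul_ne_zero (hℓ : 0 < ℓ) {l : ℝ} (hl : 0 < l)
    (hn : ∀ n : ℕ, 1 ≤ n → l * ℓ ≠ n * Real.pi) : Complex.sin (l * ℓ) ≠ 0 := by
  rw [← Complex.ofReal_mul, ← Complex.ofReal_sin]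
  intro h
  rw [Complex.ofReal_eq_zero, Real.sin_eq_zero_iff] at h
  obtain ⟨n, h⟩ := h
  have hpos : (0 : ℝ) < n * Real.pi := h ▸ mul_pos hl hℓ
  have hn0 : 0 < n := by
    have := (pos_iff_pos_of_mul_pos hpos).2 Real.pi_pos
    exact_mod_cast this
  refine hn n.toNat (by omega) ?_
  rw [← h]
  congr 1
  have : ((n.toNat : ℤ) : ℝ) = (n : ℝ) := by rw [Int.toNat_of_nonneg hn0.le]
  exact_mod_cast this.symm

/-- Solvability of the system `φ_x + l w = a`, `w_x - l φ = d` in `H¹₀ × H¹_*`. -/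
lemma exists_displacement (hℓ : 0 < ℓ) {l : ℝ} (hl : 0 < l)
    (hn : ∀ n : ℕ, 1 ≤ n → l * ℓ ≠ n * Real.pi) {a : L2 ℓ} (ha : a ∈ L2star ℓ) (d : L2 ℓ) :
    ∃ φ w : L2 ℓ, φ ∈ H10sub ℓ ∧ w ∈ L2star ℓ ∧ HasWeakDeriv ℓ φ (a - (l : ℂ) • w) ∧
      HasWeakDeriv ℓ w (d + (l : ℂ) • φ) := by
  have hl' : (l : ℂ) ≠ 0 := by exact_mod_cast hl.ne'
  have hℓ' : (ℓ : ℂ) ≠ 0 := by exact_mod_cast hℓ.ne'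
  have hI := Complex.I_mul_I
  -- The combinations `φ ± i w` diagonalise the system, with eigenvalues `± i l`. This produces a
  -- particular solution `(φp, wp)` without boundary conditions.
  obtain ⟨z₁, hz₁⟩ := exists_hasWeakDeriv_smul_add hℓ (Complex.I * l) (a + Complex.I • d)
  obtain ⟨z₂, hz₂⟩ := exists_hasWeakDeriv_smul_add hℓ (-(Complex.I * l)) (a - Complex.I • d)
  have hφp := (hz₁.add hz₂).smul (1 / 2)
  have hwp := (hz₁.sub hz₂).smul (-Complex.I / 2)
  set φp := (1 / 2 : ℂ) • (z₁ + z₂) with eφp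
  set wp := (-Complex.I / 2 : ℂ) • (z₁ - z₂) with ewp
  -- The homogeneous solutions `(φ, w)` are `(sin (l x), -cos (l x))` and `(cos (l x), sin (l x))`;
  -- they will correct the boundary values of `φp`.
  have es : ∀ x : ℝ, HasDerivAt (fun x : ℝ => Complex.sin (l * x)) (l * Complex.cos (l * x)) x := by
    intro x
    have := (((hasDerivAt_id (x : ℂ)).const_mul (l : ℂ)).csin).comp_ofReal
    simpa [mul_comm] using this
  have ec : ∀ x : ℝ, HasDerivAt (fun x : ℝ => Complex.cos (l * x)) (-(l * Complex.sin (l * x))) x := by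
    intro x
    have := (((hasDerivAt_id (x : ℂ)).const_mul (l : ℂ)).ccos).comp_ofReal
    simpa [mul_comm] using this
  have ss : ContDiff ℝ ∞ (fun x : ℝ => Complex.sin (l * x)) :=
    (Complex.contDiff_sin.restrict_scalars ℝ).comp (contDiff_const.mul Complex.ofRealCLM.contDiff)
  have sc : ContDiff ℝ ∞ (fun x : ℝ => Complex.cos (l * x)) :=
    (Complex.contDiff_cos.restrict_scalars ℝ).comp (contDiff_const.mul Complex.ofRealCLM.contDiff)
  have ds := hasWeakDeriv_ofCont (ℓ := ℓ) ss es (by fun_prop)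
  have dc := hasWeakDeriv_ofCont (ℓ := ℓ) sc ec (by fun_prop)
  have s₀ := inner_oneL2_ofCont_deriv hℓ es (by fun_prop)
  have c₀ := inner_oneL2_ofCont_deriv hℓ ec (by fun_prop)
  have s₁ := inner_idL2_ofCont_deriv hℓ ss.continuous es (by fun_prop)
  have c₁ := inner_idL2_ofCont_deriv hℓ sc.continuous ec (by fun_prop)
  have hsin := sin_mul_ne_zero hℓ hl hn
  set s := ofCont ℓ ss.continuous
  set c := ofCont ℓ sc.continuous
  have e₁ : ofCont ℓ (v := fun x : ℝ => l * Complex.cos (l * x)) (by fun_prop) = (l : ℂ) • c := by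
    refine Lp.ext ?_
    filter_upwards [coeFn_ofCont (ℓ := ℓ) (v := fun x : ℝ => l * Complex.cos (l * x)) (by fun_prop),
      coeFn_ofCont (ℓ := ℓ) sc.continuous, Lp.coeFn_smul (l : ℂ) c] with x h1 h2 h3
    rw [h1, h3, Pi.smul_apply, h2, smul_eq_mul]
  have e₂ : ofCont ℓ (v := fun x : ℝ => -(l * Complex.sin (l * x))) (by fun_prop) =
      (-l : ℂ) • s := by
    refine Lp.ext ?_
    filter_upwards [coeFn_ofCont (ℓ := ℓ) (v := fun x : ℝ => -(l * Complex.sin (l * x)))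
      (by fun_prop), coeFn_ofCont (ℓ := ℓ) ss.continuous, Lp.coeFn_smul (-l : ℂ) s] with x h1 h2 h3
    rw [h1, h3, Pi.smul_apply, h2, smul_eq_mul, neg_mul]
  rw [e₁] at ds s₀ s₁
  rw [e₂] at dc c₀ c₁
  have hφp' : HasWeakDeriv ℓ φp (a - (l : ℂ) • wp) := by
    convert hφp using 1
    rw [ewp]
    module
  have hwp' : HasWeakDeriv ℓ wp (d + (l : ℂ) • φp) := by
    convert hwp using 1
    rw [eφp]
    match_scalars <;> first | ring1 | linear_combination hI | linear_combination (l / 2 : ℂ) * hI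
  clear_value φp wp
  -- In terms of traces, `p = φp(ℓ) - φp(0)` and `q = ℓ φp(ℓ)`. Thus `β = -φp(0)` cancels the value
  -- at `0`, and `α` then cancels the value at `ℓ`, which requires dividing by `sin (l ℓ)`.
  obtain ⟨p, hp⟩ : ∃ p, inner ℂ (oneL2 ℓ) (a - (l : ℂ) • wp) = p := ⟨_, rfl⟩
  obtain ⟨q, hq⟩ : ∃ q, inner ℂ (idL2 ℓ) (a - (l : ℂ) • wp) + inner ℂ (oneL2 ℓ) φp = q := ⟨_, rfl⟩
  obtain ⟨β, hβ⟩ : ∃ β, β = p - q / ℓ := ⟨_, rfl⟩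
  obtain ⟨α, hα⟩ : ∃ α, α = (β - p - β * Complex.cos (l * ℓ)) / Complex.sin (l * ℓ) := ⟨_, rfl⟩
  have hα' : α * Complex.sin (l * ℓ) = β - p - β * Complex.cos (l * ℓ) := by
    rw [hα]; field_simp
  have hβ' : β * ℓ = p * ℓ - q := by
    rw [hβ]; field_simp
  have hφ := (hφp'.add (ds.smul α)).add (dc.smul β)
  have hw := (hwp'.add (dc.smul (-α))).add (ds.smul β)
  have hφ' : HasWeakDeriv ℓ (φp + α • s + β • c)
      (a - (l : ℂ) • (wp + (-α) • c + β • s)) := by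
    convert hφ using 1
    module
  have hw' : HasWeakDeriv ℓ (wp + (-α) • c + β • s)
      (d + (l : ℂ) • (φp + α • s + β • c)) := by
    convert hw using 1
    module
  have hmem : φp + α • s + β • c ∈ H10sub ℓ := by
    refine hφ.mem_H10sub hℓ ?_ ?_
    · simp only [inner_add_right, inner_smul_right _ _ α, inner_smul_right _ _ β, hp, s₀, c₀]
      simp
      linear_combination hα'
    · simp only [inner_add_right, inner_smul_right _ _ α, inner_smul_right _ _ β]
      linear_combination hq + α * s₁ + β * c₁ + ℓ * hα' + hβ'
  refine ⟨_, _, hmem, ?_, hφ', hw'⟩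
  -- The zero mean of `w` costs nothing: `l w = a - φ_x`, where both terms have zero mean.
  have h1 : a - (l : ℂ) • (wp + (-α) • c + β • s) ∈ L2star ℓ := by
    rw [← hφ'.weakDeriv_eq]
    exact weakDeriv_mem_L2star hmem
  have h2 := (L2star ℓ).smul_mem (l : ℂ)⁻¹ ((L2star ℓ).sub_mem ha h1)
  rwa [sub_sub_cancel, inv_smul_smul₀ hl'] at h2

end interval

/-! ### Primitives of square summable functions with respect to a memory kernel -/

lemma absolutelyContinuousOnInterval_of_dist_le {X Y : Type*} [PseudoMetricSpace X]
    [PseudoMetricSpace Y] {f : ℝ → X} {g : ℝ → Y} {a b : ℝ}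
    (hg : AbsolutelyContinuousOnInterval g a b)
    (h : ∀ x ∈ uIcc a b, ∀ y ∈ uIcc a b, dist (f x) (f y) ≤ dist (g x) (g y)) :
    AbsolutelyContinuousOnInterval f a b := by
  rw [absolutelyContinuousOnInterval_iff] at hg ⊢
  intro ε hε
  obtain ⟨δ, hδ, H⟩ := hg ε hε
  refine ⟨δ, hδ, fun E hE hEδ => (Finset.sum_le_sum fun i hi => ?_).trans_lt (H E hE hEδ)⟩
  exact h _ (hE.1 i hi).1 _ (hE.1 i hi).2

section primitive

variable {E : Type*} [NormedAddCommGroup E] [InnerProductSpace ℝ E]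

/-- With `K = ∫₀ᴺ ‖F‖`, the increments of `‖∫ F‖²` are at most `2 K` times those of the scalar
primitive of `‖F‖`. This gives access to scalar integration by parts against the kernel. -/
lemma absolutelyContinuous_norm_sq_primitive {F : ℝ → E} {N : ℝ} (hN : 0 ≤ N)
    (hF : IntervalIntegrable F volume 0 N) :
    AbsolutelyContinuousOnInterval (fun s => ‖∫ t in (0 : ℝ)..s, F t‖ ^ 2) 0 N := by
  have hsub : ∀ {x y : ℝ}, x ∈ uIcc 0 N → y ∈ uIcc 0 N → IntervalIntegrable F volume x y :=
    fun hx hy => hF.mono_set (uIcc_subset_uIcc hx hy)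
  have h0 : (0 : ℝ) ∈ uIcc 0 N := left_mem_uIcc
  have hg := ((hF.norm).absolutelyContinuousOnInterval_intervalIntegral h0).const_mul
    (2 * ∫ t in (0 : ℝ)..N, ‖F t‖)
  refine absolutelyContinuousOnInterval_of_dist_le hg fun x hx y hy => ?_
  have bd : ∀ z ∈ uIcc 0 N, ‖∫ t in (0 : ℝ)..z, F t‖ ≤ ∫ t in (0 : ℝ)..N, ‖F t‖ := by
    intro z hz
    rw [uIcc_of_le hN] at hz
    exact (intervalIntegral.norm_integral_le_integral_norm hz.1).trans
      (intervalIntegral.integral_mono_interval le_rfl hz.1 hz.2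
        (Eventually.of_forall fun t => norm_nonneg _) hF.norm)
  have hd : ‖(∫ t in (0 : ℝ)..x, F t) - ∫ t in (0 : ℝ)..y, F t‖ ≤
      |(∫ t in (0 : ℝ)..x, ‖F t‖) - ∫ t in (0 : ℝ)..y, ‖F t‖| := by
    rw [intervalIntegral.integral_interval_sub_left (hsub h0 hx) (hsub h0 hy),
      intervalIntegral.integral_interval_sub_left (hsub h0 hx).norm (hsub h0 hy).norm]
    exact intervalIntegral.norm_integral_le_abs_integral_norm
  have hK : 0 ≤ ∫ t in (0 : ℝ)..N, ‖F t‖ :=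
    intervalIntegral.integral_nonneg hN fun t _ => norm_nonneg _
  rw [Real.dist_eq, Real.dist_eq, ← mul_sub, abs_mul,
    abs_of_nonneg (mul_nonneg zero_le_two hK), sq_sub_sq, abs_mul]
  refine mul_le_mul ?_ ((abs_norm_sub_norm_le _ _).trans hd) (abs_nonneg _)
    (mul_nonneg zero_le_two hK)
  rw [abs_of_nonneg (by positivity), two_mul]
  exact add_le_add (bd x hx) (bd y hy)

variable (μ : MemoryKernel)

/-- A rate of exponential decay of the kernel. -/
def MemoryKernel.rate : ℝ := μ.dafermos.choose

lemma MemoryKernel.rate_pos : 0 < μ.rate := μ.dafermos.choose_spec.1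

lemma MemoryKernel.exists_bound : ∃ M, ∀ s, 0 < s → μ.toFun s ≤ M := by
  obtain ⟨m, hm⟩ := μ.bounded_zero
  refine ⟨m, fun s hs => ge_of_tendsto hm ?_⟩
  filter_upwards [Ioo_mem_nhdsGT hs] with t ht
  exact μ.antitone ht.1 hs ht.2.le

variable {μ}

lemma continuousOn_primitive {F : ℝ → E} {N : ℝ} (hF : IntervalIntegrable F volume 0 N) :
    ContinuousOn (fun s => ∫ t in (0 : ℝ)..s, F t) (uIcc 0 N) :=
  intervalIntegral.continuousOn_primitive_interval' hF left_mem_uIcc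

lemma MemoryKernel.intervalIntegrable (μ : MemoryKernel) {N : ℝ} (hN : 0 ≤ N) :
    IntervalIntegrable μ.toFun volume 0 N :=
  (intervalIntegrable_iff_integrableOn_Ioc_of_le hN).2
    (μ.integrable.mono_set fun _ ht => ht.1)

lemma intervalIntegrable_kernel_mul_norm_sq {F : ℝ → E} {N : ℝ} (hN : 0 ≤ N)
    (hF : IntervalIntegrable F volume 0 N) :
    IntervalIntegrable (fun s => μ.toFun s * ‖∫ t in (0 : ℝ)..s, F t‖ ^ 2) volume 0 N :=
  (μ.intervalIntegrable hN).mul_continuousOn ((continuousOn_primitive hF).norm.pow 2)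

/-- Since `F` is only integrable here, the kernel must be bounded up to `0`. The domination is by `M
* (2 * (K * ‖F s‖))`, with `M` bounding the kernel and `K` the primitive. -/
lemma intervalIntegrable_kernel_mul_inner {F : ℝ → E} {N : ℝ} (hN : 0 ≤ N)
    (hF : IntervalIntegrable F volume 0 N) :
    IntervalIntegrable (fun s => μ.toFun s * (2 * inner ℝ (∫ t in (0 : ℝ)..s, F t) (F s)))
      volume 0 N := by
  obtain ⟨M, hM⟩ := μ.exists_bound
  have hc := continuousOn_primitive hF
  obtain ⟨K, hK⟩ := isCompact_uIcc.exists_bound_of_continuousOn hc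
  rw [uIcc_of_le hN] at hc hK
  have h1 : IntegrableOn F (Ioc 0 N) := (intervalIntegrable_iff_integrableOn_Ioc_of_le hN).1 hF
  rw [intervalIntegrable_iff_integrableOn_Ioc_of_le hN]
  have hm : AEStronglyMeasurable (fun s => ∫ t in (0 : ℝ)..s, F t) (volume.restrict (Ioc 0 N)) :=
    (hc.mono Ioc_subset_Icc_self).aestronglyMeasurable measurableSet_Ioc
  refine Integrable.mono' (g := fun s => M * (2 * (K * ‖F s‖)))
    (((h1.norm.const_mul K).const_mul 2).const_mul M)
    ((μ.integrable.mono_set fun _ ht => ht.1).1.mul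
      ((hm.inner h1.1).const_mul 2)) ?_
  filter_upwards [ae_restrict_mem measurableSet_Ioc] with s hs
  have hμ := (μ.pos s hs.1).le
  rw [norm_mul, norm_mul, Real.norm_of_nonneg hμ, Real.norm_of_nonneg (by norm_num : (0 : ℝ) ≤ 2)]
  have h2 : ‖inner ℝ (∫ t in (0 : ℝ)..s, F t) (F s)‖ ≤ K * ‖F s‖ :=
    (norm_inner_le_norm _ _).trans (by gcongr; exact hK s (Ioc_subset_Icc_self hs))
  exact mul_le_mul (hM s hs.1) (by gcongr) (by positivity) (hμ.trans (hM s hs.1))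

variable [CompleteSpace E]

/-- The energy inequality for the primitive `G` of `F`: `δ ∫ μ ‖G‖² ≤ 2 ∫ μ ⟨G, F⟩`. -/
lemma rate_mul_integral_le {F : ℝ → E} {N : ℝ} (hN : 0 < N)
    (hF : IntervalIntegrable F volume 0 N) :
    μ.rate * ∫ s in (0 : ℝ)..N, μ.toFun s * ‖∫ t in (0 : ℝ)..s, F t‖ ^ 2 ≤
      ∫ s in (0 : ℝ)..N, μ.toFun s * (2 * inner ℝ (∫ t in (0 : ℝ)..s, F t) (F s)) := by
  set G : ℝ → E := fun s => ∫ t in (0 : ℝ)..s, F t with hG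
  set p : ℝ → ℝ := fun s => ‖G s‖ ^ 2 with hp
  have hpac : AbsolutelyContinuousOnInterval p 0 N :=
    absolutelyContinuous_norm_sq_primitive hN.le hF
  have hpd : ∀ᵐ s, s ∈ uIcc 0 N → deriv p s = 2 * inner ℝ (G s) (F s) := by
    filter_upwards [hF.ae_hasDerivAt_integral] with s hs hmem
    exact (hs hmem 0 left_mem_uIcc).norm_sq.deriv
  have i₁ := intervalIntegrable_kernel_mul_norm_sq (μ := μ) hN.le hF
  have i₂ := intervalIntegrable_kernel_mul_inner (μ := μ) hN.le hF
  -- The kernel is absolutely continuous only away from `0`, so integration by parts is done on `[ε,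
  -- N]`. The boundary term at `N` has the good sign, and `-μ' ≥ δ μ` produces the left side. The
  -- term at `ε` disappears in the limit, because `G(0) = 0` and `μ` has a finite limit at `0`.
  have step : ∀ ε, ε ∈ Ioc 0 N → μ.rate * ∫ s in ε..N, μ.toFun s * p s ≤
      (∫ s in ε..N, μ.toFun s * (2 * inner ℝ (G s) (F s))) + μ.toFun ε * p ε := by
    intro ε hε
    have hsub : uIcc ε N ⊆ uIcc 0 N := by
      rw [uIcc_of_le hε.2, uIcc_of_le hN.le]
      exact Icc_subset_Icc_left hε.1.le
    have hμac := μ.absolutelyContinuous ε N hε.1 hε.2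
    have hpac' := hpac.mono hsub
    have ibp := hμac.integral_mul_deriv_eq_deriv_mul hpac'
    have e : ∫ s in ε..N, μ.toFun s * deriv p s =
        ∫ s in ε..N, μ.toFun s * (2 * inner ℝ (G s) (F s)) := by
      refine intervalIntegral.integral_congr_ae ?_
      filter_upwards [hpd] with s hs hmem
      rw [hs (hsub (uIoc_subset_uIcc hmem))]
    have hle : ∫ s in ε..N, deriv μ.toFun s * p s ≤ ∫ s in ε..N, -μ.rate * (μ.toFun s * p s) := by
      refine intervalIntegral.integral_mono_ae_restrict hε.2
        (hμac.intervalIntegrable_deriv.mul_continuousOn hpac'.continuousOn)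
        ((i₁.mono_set hsub).const_mul _) ?_
      have := ae_restrict_of_ae_restrict_of_subset
        (show Icc ε N ⊆ Ioi 0 from fun t ht => hε.1.trans_le ht.1) μ.dafermos.choose_spec.2
      filter_upwards [this] with s hs
      have hs' : deriv μ.toFun s ≤ -(μ.rate * μ.toFun s) := by
        change deriv μ.toFun s + μ.rate * μ.toFun s ≤ 0 at hs
        linarith
      calc deriv μ.toFun s * p s ≤ -(μ.rate * μ.toFun s) * p s :=
            mul_le_mul_of_nonneg_right hs' (sq_nonneg _)
        _ = _ := by ring
    rw [intervalIntegral.integral_const_mul] at hle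
    rw [e] at ibp
    have : 0 ≤ μ.toFun N * p N := mul_nonneg (μ.pos N hN).le (sq_nonneg _)
    linarith
  have t₁ : Tendsto (fun ε => ∫ s in ε..N, μ.toFun s * p s) (𝓝[>] 0)
      (𝓝 (∫ s in (0 : ℝ)..N, μ.toFun s * p s)) := by
    have := intervalIntegral.continuousOn_primitive_interval_left
      ((intervalIntegrable_iff' enorm_ne_top).1 i₁) 0 left_mem_uIcc
    exact this.mono_left (nhdsWithin_le_of_mem (by
      rw [uIcc_of_le hN.le]; exact mem_of_superset (Ioc_mem_nhdsGT hN) Ioc_subset_Icc_self))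
  have t₂ : Tendsto (fun ε => ∫ s in ε..N, μ.toFun s * (2 * inner ℝ (G s) (F s))) (𝓝[>] 0)
      (𝓝 (∫ s in (0 : ℝ)..N, μ.toFun s * (2 * inner ℝ (G s) (F s)))) := by
    have := intervalIntegral.continuousOn_primitive_interval_left
      ((intervalIntegrable_iff' enorm_ne_top).1 i₂) 0 left_mem_uIcc
    exact this.mono_left (nhdsWithin_le_of_mem (by
      rw [uIcc_of_le hN.le]; exact mem_of_superset (Ioc_mem_nhdsGT hN) Ioc_subset_Icc_self))
  have t₃ : Tendsto (fun ε => μ.toFun ε * p ε) (𝓝[>] 0) (𝓝 0) := by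
    obtain ⟨m, hm⟩ := μ.bounded_zero
    have hp0 : Tendsto p (𝓝[>] 0) (𝓝 (p 0)) :=
      (hpac.continuousOn 0 left_mem_uIcc).mono_left (nhdsWithin_le_of_mem (by
      rw [uIcc_of_le hN.le]; exact mem_of_superset (Ioc_mem_nhdsGT hN) Ioc_subset_Icc_self))
    have := hm.mul hp0
    simpa [p, G] using this
  have := le_of_tendsto_of_tendsto (t₁.const_mul μ.rate) (t₂.add t₃)
    (by filter_upwards [Ioc_mem_nhdsGT hN] with ε hε using step ε hε)
  rwa [add_zero] at this

lemma MemoryKernel.measure_ac (μ : MemoryKernel) : μ.measure ≪ volume.restrict (Ioi (0 : ℝ)) :=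
  withDensity_absolutelyContinuous _ _

omit [CompleteSpace E] in
lemma MemoryKernel.integrable_iff (μ : MemoryKernel) {f : ℝ → E} :
    Integrable f μ.measure ↔ IntegrableOn (fun s => μ.toFun s • f s) (Ioi (0 : ℝ)) := by
  rw [MemoryKernel.measure, integrable_withDensity_iff_integrable_smul₀'
    μ.integrable.1.aemeasurable.ennreal_ofReal (by simp)]
  refine integrable_congr ?_
  filter_upwards [ae_restrict_mem measurableSet_Ioi] with s hs
  rw [ENNReal.toReal_ofReal (μ.pos s hs).le]

omit [CompleteSpace E] in
lemma MemoryKernel.integral_eq (μ : MemoryKernel) (f : ℝ → E) :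
    ∫ s, f s ∂μ.measure = ∫ s in Ioi (0 : ℝ), μ.toFun s • f s := by
  rw [MemoryKernel.measure, integral_withDensity_eq_integral_toReal_smul₀
    μ.integrable.1.aemeasurable.ennreal_ofReal (by simp)]
  refine integral_congr_ae ?_
  filter_upwards [ae_restrict_mem measurableSet_Ioi] with s hs
  rw [ENNReal.toReal_ofReal (μ.pos s hs).le]

omit [InnerProductSpace ℝ E] [CompleteSpace E] in
-- By monotonicity the kernel is at least `μ(N) > 0` on `(0, N]`, so Lebesgue measure there is at
-- most `μ(N)⁻¹` times the weighted measure, which is finite.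
lemma intervalIntegrable_of_memLp {F : ℝ → E} (hF : MemLp F 2 μ.measure) {N : ℝ} (hN : 0 < N) :
    IntervalIntegrable F volume 0 N := by
  rw [intervalIntegrable_iff_integrableOn_Ioc_of_le hN.le]
  have hint : Integrable F μ.measure := hF.integrable (by norm_num)
  have hle : volume.restrict (Ioc 0 N) ≤ (ENNReal.ofReal (μ.toFun N))⁻¹ • μ.measure := by
    refine Measure.le_iff.2 fun s hs => ?_
    rw [Measure.smul_apply, MemoryKernel.measure, withDensity_apply _ hs, smul_eq_mul,
      Measure.restrict_apply hs, Measure.restrict_restrict hs, mul_comm, ← div_eq_mul_inv,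
      ENNReal.le_div_iff_mul_le (by simp [μ.pos _ hN]) (by simp), mul_comm,
      ← setLIntegral_const]
    refine (setLIntegral_mono' (hs.inter measurableSet_Ioc) fun x hx => ?_).trans
      (lintegral_mono_set (inter_subset_inter_right _ fun t ht => ht.1))
    exact ENNReal.ofReal_le_ofReal (μ.antitone hx.2.1 hN hx.2.2)
  exact (hint.smul_measure (by simp [μ.pos _ hN])).mono_measure hle

omit [CompleteSpace E] in
lemma continuousOn_primitive_Ici {F : ℝ → E} (hF : MemLp F 2 μ.measure) :
    ContinuousOn (fun s => ∫ t in (0 : ℝ)..s, F t) (Ici 0) := by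
  intro x (hx : 0 ≤ x)
  have h1 : (0 : ℝ) < x + 1 := by linarith
  have := continuousOn_primitive (intervalIntegrable_of_memLp hF h1) x
    (by rw [uIcc_of_le h1.le]; exact ⟨hx, by linarith⟩)
  rw [uIcc_of_le h1.le] at this
  refine this.mono_of_mem_nhdsWithin ?_
  rw [← Ici_inter_Iic]
  exact inter_mem_nhdsWithin _ (Iic_mem_nhds (by linarith))

omit [CompleteSpace E] in
lemma aestronglyMeasurable_primitive {F : ℝ → E} (hF : MemLp F 2 μ.measure) :
    AEStronglyMeasurable (fun s => ∫ t in (0 : ℝ)..s, F t) (volume.restrict (Ioi (0 : ℝ))) :=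
  ((continuousOn_primitive_Ici hF).mono Ioi_subset_Ici_self).aestronglyMeasurable measurableSet_Ioi

omit [InnerProductSpace ℝ E] [CompleteSpace E] in
lemma MemoryKernel.memLp_iff (μ : MemoryKernel) {F : ℝ → E}
    (hF : AEStronglyMeasurable F μ.measure) :
    MemLp F 2 μ.measure ↔ IntegrableOn (fun s => μ.toFun s * ‖F s‖ ^ 2) (Ioi (0 : ℝ)) := by
  rw [memLp_two_iff_integrable_sq_norm hF, μ.integrable_iff]
  rfl

/-- The primitive of a square summable function is square summable. -/
lemma memLp_primitive {F : ℝ → E} (hF : MemLp F 2 μ.measure) :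
    MemLp (fun s => ∫ t in (0 : ℝ)..s, F t) 2 μ.measure := by
  have hδ := μ.rate_pos
  have hFi := (μ.memLp_iff hF.1).1 hF
  rw [μ.memLp_iff ((aestronglyMeasurable_primitive hF).mono_ac μ.measure_ac)]
  -- It suffices to bound `∫₀ᴺ μ ‖G‖²` uniformly in `N`. Young's inequality with weights `δ / 2` and
  -- `2 / δ` absorbs half of the left side of `rate_mul_integral_le`, leaving the constant `(2 / δ)
  -- ^ 2`.
  refine integrableOn_Ioi_of_intervalIntegral_norm_bounded
    ((2 / μ.rate) ^ 2 * ∫ s in Ioi (0 : ℝ), μ.toFun s * ‖F s‖ ^ 2) 0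
    (b := fun n : ℕ => ((n : ℝ) + 1)) (l := atTop) (fun n => ?_)
    (tendsto_atTop_add_const_right _ _ tendsto_natCast_atTop_atTop)
    (Eventually.of_forall fun n => ?_)
  · have hN : (0 : ℝ) < (n : ℝ) + 1 := by positivity
    exact (intervalIntegrable_iff_integrableOn_Ioc_of_le hN.le).1
      (intervalIntegrable_kernel_mul_norm_sq hN.le (intervalIntegrable_of_memLp hF hN))
  · have hN : (0 : ℝ) < (n : ℝ) + 1 := by positivity
    generalize (n : ℝ) + 1 = N at hN
    have hI := intervalIntegrable_of_memLp hF hN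
    have i₁ := intervalIntegrable_kernel_mul_norm_sq (μ := μ) hN.le hI
    have i₂ := intervalIntegrable_kernel_mul_inner (μ := μ) hN.le hI
    have i₃ : IntervalIntegrable (fun s => μ.toFun s * ‖F s‖ ^ 2) volume 0 N :=
      (intervalIntegrable_iff_integrableOn_Ioc_of_le hN.le).2 (hFi.mono_set fun t ht => ht.1)
    have key := rate_mul_integral_le (μ := μ) hN hI
    have e : ∫ s in (0 : ℝ)..N, ‖μ.toFun s * ‖∫ t in (0 : ℝ)..s, F t‖ ^ 2‖ =
        ∫ s in (0 : ℝ)..N, μ.toFun s * ‖∫ t in (0 : ℝ)..s, F t‖ ^ 2 := by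
      refine intervalIntegral.integral_congr_ae (Eventually.of_forall fun s hs => ?_)
      rw [uIoc_of_le hN.le] at hs
      exact Real.norm_of_nonneg (mul_nonneg (μ.pos s hs.1).le (sq_nonneg _))
    rw [e]
    have young : ∫ s in (0 : ℝ)..N, μ.toFun s * (2 * inner ℝ (∫ t in (0 : ℝ)..s, F t) (F s)) ≤
        ∫ s in (0 : ℝ)..N, (μ.rate / 2 * (μ.toFun s * ‖∫ t in (0 : ℝ)..s, F t‖ ^ 2) +
          2 / μ.rate * (μ.toFun s * ‖F s‖ ^ 2)) := by
      refine intervalIntegral.integral_mono_on_of_le_Ioo hN.le i₂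
        ((i₁.const_mul _).add (i₃.const_mul _)) fun s hs => ?_
      have h1 : 2 * inner ℝ (∫ t in (0 : ℝ)..s, F t) (F s) ≤
          μ.rate / 2 * ‖∫ t in (0 : ℝ)..s, F t‖ ^ 2 + 2 / μ.rate * ‖F s‖ ^ 2 := by
        have h2 := real_inner_le_norm (∫ t in (0 : ℝ)..s, F t) (F s)
        generalize ‖∫ t in (0 : ℝ)..s, F t‖ = x at *
        generalize ‖F s‖ = y at *
        have h3 : μ.rate / 2 * x ^ 2 + 2 / μ.rate * y ^ 2 - 2 * (x * y) =
            μ.rate / 2 * (x - 2 / μ.rate * y) ^ 2 := by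
          field_simp
          ring
        have h4 : 0 ≤ μ.rate / 2 * (x - 2 / μ.rate * y) ^ 2 := by positivity
        linarith
      calc _ ≤ μ.toFun s * (μ.rate / 2 * ‖∫ t in (0 : ℝ)..s, F t‖ ^ 2 + 2 / μ.rate * ‖F s‖ ^ 2) :=
            mul_le_mul_of_nonneg_left h1 (μ.pos s hs.1).le
        _ = _ := by ring
    rw [intervalIntegral.integral_add (i₁.const_mul _) (i₃.const_mul _),
      intervalIntegral.integral_const_mul, intervalIntegral.integral_const_mul] at young
    have hle : ∫ s in (0 : ℝ)..N, μ.toFun s * ‖F s‖ ^ 2 ≤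
        ∫ s in Ioi (0 : ℝ), μ.toFun s * ‖F s‖ ^ 2 := by
      rw [intervalIntegral.integral_of_le hN.le]
      refine setIntegral_mono_set hFi ?_ (Eventually.of_forall fun t ht => ht.1)
      filter_upwards [ae_restrict_mem measurableSet_Ioi] with s hs
      exact mul_nonneg (μ.pos s hs).le (sq_nonneg _)
    generalize ∫ s in (0 : ℝ)..N, μ.toFun s * ‖∫ t in (0 : ℝ)..s, F t‖ ^ 2 = A at *
    generalize ∫ s in (0 : ℝ)..N, μ.toFun s * ‖F s‖ ^ 2 = B at *
    generalize ∫ s in Ioi (0 : ℝ), μ.toFun s * ‖F s‖ ^ 2 = C at *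
    have h5 : μ.rate / 2 * A ≤ 2 / μ.rate * B := by linarith
    have h6 : A ≤ (2 / μ.rate) ^ 2 * B := by
      have : A = 2 / μ.rate * (μ.rate / 2 * A) := by field_simp
      rw [this, sq, mul_assoc]
      gcongr
    exact h6.trans (by gcongr)

/-- The dissipation inequality on the half line. -/
lemma rate_mul_integral_measure_le {F : ℝ → E} (hF : MemLp F 2 μ.measure) :
    μ.rate * ∫ s, ‖∫ t in (0 : ℝ)..s, F t‖ ^ 2 ∂μ.measure ≤
      ∫ s, 2 * inner ℝ (∫ t in (0 : ℝ)..s, F t) (F s) ∂μ.measure := by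
  have hG := memLp_primitive hF
  have hGi := (μ.memLp_iff hG.1).1 hG
  have hi : Integrable (fun s => 2 * inner ℝ (∫ t in (0 : ℝ)..s, F t) (F s)) μ.measure :=
    ((hG.norm.integrable_mul hF.norm).mono (hG.1.inner hF.1) (Eventually.of_forall fun s => by
      simpa using norm_inner_le_norm (𝕜 := ℝ) (∫ t in (0 : ℝ)..s, F t) (F s))).const_mul 2
  rw [μ.integrable_iff] at hi
  rw [μ.integral_eq, μ.integral_eq]
  have hb := tendsto_id (α := ℝ) (x := atTop)
  refine le_of_tendsto_of_tendsto
    ((intervalIntegral_tendsto_integral_Ioi 0 hGi hb).const_mul μ.rate)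
    (intervalIntegral_tendsto_integral_Ioi 0 hi hb) ?_
  filter_upwards [eventually_gt_atTop 0] with N hN
  exact rate_mul_integral_le hN (intervalIntegrable_of_memLp hF hN)

end primitive

/-! ### The primitive operator on the memory space and the inverse of the transport operator. -/

section memoryPrimitive

variable {ℓ : ℝ} {μ : MemoryKernel}

instance : InnerProductSpace ℝ (H10 ℓ) := InnerProductSpace.rclikeToReal ℂ (H10 ℓ)

/-- The primitive `s ↦ ∫₀ˢ η` of an element of the memory space. -/
def memPrimitive (η : Memory ℓ μ) : Memory ℓ μ := (memLp_primitive (Lp.memLp η)).toLp _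

lemma Memory.coeFn_primitive (η : Memory ℓ μ) :
    (memPrimitive η) =ᵐ[volume.restrict (Ioi (0 : ℝ))] fun s => ∫ t in (0 : ℝ)..s, η t :=
  μ.volume_ac.ae_eq (MemLp.coeFn_toLp _)

lemma Memory.intervalIntegrable (η : Memory ℓ μ) {N : ℝ} (hN : 0 < N) :
    IntervalIntegrable η volume 0 N :=
  intervalIntegrable_of_memLp (Lp.memLp η) hN

lemma intervalIntegral_congr_Ioi {E : Type*} [NormedAddCommGroup E] [NormedSpace ℝ E]
    {f g : ℝ → E} (h : f =ᵐ[volume.restrict (Ioi (0 : ℝ))] g) {s : ℝ} (hs : 0 ≤ s) :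
    ∫ t in (0 : ℝ)..s, f t = ∫ t in (0 : ℝ)..s, g t := by
  refine intervalIntegral.integral_congr_ae ?_
  rw [EventuallyEq, ae_restrict_iff' measurableSet_Ioi] at h
  filter_upwards [h] with t ht hmem
  rw [uIoc_of_le hs] at hmem
  exact ht hmem.1

lemma Memory.primitive_add (η₁ η₂ : Memory ℓ μ) :
    memPrimitive (η₁ + η₂) = (memPrimitive η₁) + (memPrimitive η₂) := by
  refine Lp.ext (μ.measure_ac.ae_eq ?_)
  filter_upwards [(Memory.coeFn_primitive (η₁ + η₂)), (Memory.coeFn_primitive η₁), (Memory.coeFn_primitive η₂),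
    Memory.coe_add (memPrimitive η₁) (memPrimitive η₂), ae_restrict_mem measurableSet_Ioi]
    with s h1 h2 h3 h4 (hs : 0 < s)
  rw [h1, h4, Pi.add_apply, h2, h3, intervalIntegral_congr_Ioi (Memory.coe_add η₁ η₂) hs.le]
  exact intervalIntegral.integral_add (Memory.intervalIntegrable η₁ hs) (Memory.intervalIntegrable η₂ hs)

lemma Memory.primitive_smul (c : ℂ) (η : Memory ℓ μ) :
    memPrimitive (c • η) = c • (memPrimitive η) := by
  refine Lp.ext (μ.measure_ac.ae_eq ?_)
  filter_upwards [(Memory.coeFn_primitive (c • η)), (Memory.coeFn_primitive η),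
    Memory.coe_smul c (memPrimitive η), ae_restrict_mem measurableSet_Ioi]
    with s h1 h2 h3 (hs : 0 < s)
  rw [h1, h3, Pi.smul_apply, h2, intervalIntegral_congr_Ioi (Memory.coe_smul c η) hs.le]
  exact intervalIntegral.integral_smul c _

/-- Dissipativity of the transport operator. -/
lemma Memory.rate_mul_norm_sq_le (η : Memory ℓ μ) :
    μ.rate * ‖(memPrimitive η)‖ ^ 2 ≤ 2 * (inner ℂ (memPrimitive η) η).re := by
  have h := rate_mul_integral_measure_le (Lp.memLp η)
  have hae : (memPrimitive η) =ᵐ[μ.measure] fun s => ∫ t in (0 : ℝ)..s, η t := MemLp.coeFn_toLp _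
  have e₁ : (inner ℂ (memPrimitive η) η).re =
      ∫ s, inner ℝ (∫ t in (0 : ℝ)..s, η t) (η s) ∂μ.measure := by
    rw [L2.inner_def, ← RCLike.re_eq_complex_re, ← integral_re (L2.integrable_inner _ _)]
    refine integral_congr_ae ?_
    filter_upwards [hae] with s hs
    rw [hs, real_inner_eq_re_inner ℂ]
  have e₂ : ‖(memPrimitive η)‖ ^ 2 = ∫ s, ‖∫ t in (0 : ℝ)..s, η t‖ ^ 2 ∂μ.measure := by
    rw [norm_sq_eq_re_inner (𝕜 := ℂ), L2.inner_def, ← integral_re (L2.integrable_inner _ _)]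
    refine integral_congr_ae ?_
    filter_upwards [hae] with s hs
    rw [hs, ← norm_sq_eq_re_inner]
  rw [e₁, e₂, ← integral_const_mul (2 : ℝ)]
  exact h

/-- Cauchy–Schwarz in the dissipation inequality, divided by one factor of the norm. -/
lemma Memory.norm_primitive_le (η : Memory ℓ μ) : ‖(memPrimitive η)‖ ≤ 2 / μ.rate * ‖η‖ := by
  have h := (Memory.rate_mul_norm_sq_le η)
  have h2 : (inner ℂ (memPrimitive η) η).re ≤ ‖(memPrimitive η)‖ * ‖η‖ := re_inner_le_norm (𝕜 := ℂ) _ _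
  have hδ := μ.rate_pos
  rcases (norm_nonneg (memPrimitive η)).eq_or_lt with h0 | h0
  · rw [← h0]; positivity
  · have h3 : μ.rate * ‖(memPrimitive η)‖ ≤ 2 * ‖η‖ := by
      refine le_of_mul_le_mul_right ?_ h0
      nlinarith
    rw [div_mul_eq_mul_div, le_div_iff₀ hδ]
    linarith

/-- The primitive as a continuous operator on the memory space. -/
def memPrimitiveL (ℓ : ℝ) (μ : MemoryKernel) : Memory ℓ μ →L[ℂ] Memory ℓ μ :=
  LinearMap.mkContinuous
    { toFun := memPrimitive
      map_add' := Memory.primitive_add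
      map_smul' := Memory.primitive_smul } (2 / μ.rate) Memory.norm_primitive_le

/-- The primitive is a weak antiderivative. -/
lemma Memory.hasMemDeriv_primitive (η : Memory ℓ μ) : HasMemDeriv (memPrimitive η) η := by
  intro v hv hc hs
  rw [eq_neg_iff_add_eq_zero]
  have hd : Continuous (deriv v) := hv.continuous_deriv (by simp)
  have hs' : tsupport (deriv v) ⊆ Ioi 0 := Subset.trans tsupport_deriv_subset hs
  have i₁ := Memory.integrable_smul (memPrimitive η) hd hc.deriv hs'
  have i₂ := Memory.integrable_smul η hv.continuous hc hs
  -- Pairing the defect `y` with itself turns the vector identity into a scalar one: `⟨y, ∫ η⟩` is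
  -- the absolutely continuous primitive of `⟨y, η⟩`, ordinary integration by parts applies, and
  -- `⟨y, y⟩ = 0`.
  obtain ⟨y, hy⟩ : ∃ y, (∫ s in Ioi (0 : ℝ), deriv v s • (memPrimitive η) s) +
    ∫ s in Ioi (0 : ℝ), v s • η s = y := ⟨_, rfl⟩
  rw [hy, ← inner_self_eq_zero (𝕜 := ℝ)]
  nth_rw 2 [← hy]
  rw [inner_add_right, ← integral_inner i₁, ← integral_inner i₂]
  obtain ⟨N, hN, hvN⟩ : ∃ N : ℝ, 0 < N ∧ tsupport v ⊆ Iio N := by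
    obtain ⟨b, hb⟩ := hc.isCompact.bddAbove
    exact ⟨max b 0 + 1, by positivity, fun x hx => by
      have := hb hx
      have := le_max_left b 0
      simp only [mem_Iio]
      linarith⟩
  have hz : ∀ s, s ∉ Ioo 0 N → v s = 0 := fun s h =>
    image_eq_zero_of_notMem_tsupport fun h' => h ⟨hs h', hvN h'⟩
  have hz' : ∀ s, s ∉ Ioo 0 N → deriv v s = 0 := fun s h =>
    image_eq_zero_of_notMem_tsupport fun h' =>
      h ⟨hs' h', hvN (tsupport_deriv_subset h')⟩
  have hI := Memory.intervalIntegrable η hN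
  let q : ℝ → ℝ := fun t => inner ℝ y (η t)
  have hq : IntervalIntegrable q volume 0 N := by
    have := (innerSL ℝ y).integrable_comp
      ((intervalIntegrable_iff_integrableOn_Ioc_of_le hN.le).1 hI)
    exact (intervalIntegrable_iff_integrableOn_Ioc_of_le hN.le).2 this
  have hqi : ∀ s ∈ Icc 0 N, inner ℝ y (∫ t in (0 : ℝ)..s, η t) = ∫ t in (0 : ℝ)..s, q t := by
    intro s hs
    exact ((innerSL ℝ y).intervalIntegral_comp_comm
      (hI.mono_set (by rw [uIcc_of_le hs.1, uIcc_of_le hN.le]; exact Icc_subset_Icc_right hs.2))).symm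
  have gac := hq.absolutelyContinuousOnInterval_intervalIntegral (c := 0) left_mem_uIcc
  have vac : AbsolutelyContinuousOnInterval v 0 N :=
    (hv.contDiffOn.of_le (by simp)).absolutelyContinuousOnInterval
  have key := vac.integral_deriv_mul_eq_sub gac
  rw [hz N (by simp), hz 0 (by simp), zero_mul, zero_mul, sub_zero] at key
  have e₁ : ∫ s in Ioi (0 : ℝ), inner ℝ y (deriv v s • (memPrimitive η) s) =
      ∫ s in (0 : ℝ)..N, deriv v s * ∫ t in (0 : ℝ)..s, q t := by
    rw [intervalIntegral.integral_of_le hN.le,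
      setIntegral_eq_of_subset_of_ae_sdiff_eq_zero measurableSet_Ioi.nullMeasurableSet
        (s := Ioc 0 N) (fun t ht => ht.1)
        (Eventually.of_forall fun t ht => by
          rw [hz' t fun h => ht.2 ⟨h.1, h.2.le⟩, zero_smul, inner_zero_right])]
    refine integral_congr_ae ?_
    filter_upwards [ae_restrict_mem measurableSet_Ioc, ae_restrict_of_ae_restrict_of_subset
      (show Ioc 0 N ⊆ Ioi 0 from fun t ht => ht.1) (Memory.coeFn_primitive η)] with s hs h1
    rw [h1, inner_smul_right, hqi s ⟨hs.1.le, hs.2⟩]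
  have e₂ : ∫ s in Ioi (0 : ℝ), inner ℝ y (v s • η s) =
      ∫ s in (0 : ℝ)..N, v s * deriv (fun s => ∫ t in (0 : ℝ)..s, q t) s := by
    rw [intervalIntegral.integral_of_le hN.le,
      setIntegral_eq_of_subset_of_ae_sdiff_eq_zero measurableSet_Ioi.nullMeasurableSet
        (s := Ioc 0 N) (fun t ht => ht.1)
        (Eventually.of_forall fun t ht => by
          rw [hz t fun h => ht.2 ⟨h.1, h.2.le⟩, zero_smul, inner_zero_right])]
    refine integral_congr_ae ?_
    rw [EventuallyEq, ae_restrict_iff' measurableSet_Ioc]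
    filter_upwards [hq.ae_hasDerivAt_integral] with s h1 hs
    rw [(h1 (by rw [uIcc_of_le hN.le]; exact Ioc_subset_Icc_self hs) 0 left_mem_uIcc).deriv,
      inner_smul_right]
  rw [e₁, e₂]
  have j₁ := (hd.intervalIntegrable (μ := volume) 0 N).mul_continuousOn gac.continuousOn
  have j₂ := gac.intervalIntegrable_deriv.continuousOn_mul hv.continuous.continuousOn
  exact (intervalIntegral.integral_add j₁ j₂).symm.trans key

/-- The integral from `0` is itself the continuous representative, with trace zero. Together with
`eq_primitive_of_mem` this says that the transport operator is invertible, its inverse being minus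
the primitive. -/
lemma Memory.primitive_mem (η : Memory ℓ μ) : (memPrimitive η) ∈ transportDomain ℓ μ := by
  refine ⟨⟨η, (Memory.hasMemDeriv_primitive η)⟩, fun s => ∫ t in (0 : ℝ)..s, η t,
    (continuousOn_primitive_Ici (Lp.memLp η)).mono Ioi_subset_Ici_self, (Memory.coeFn_primitive η), ?_⟩
  have := ((continuousOn_primitive_Ici (Lp.memLp η)) 0 self_mem_Ici).norm.mono_left
    (nhdsWithin_mono _ Ioi_subset_Ici_self)
  simpa only [H10.norm_grad, intervalIntegral.integral_same, norm_zero] using this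

/-- The support lies in some `(0, N)`, where `IsTest.exists_primitive` applies to the complexified
function; the real part of the resulting primitive is the one sought. -/
lemma exists_real_primitive {g : ℝ → ℝ} (hg : ContDiff ℝ ∞ g) (hc : HasCompactSupport g)
    (hs : tsupport g ⊆ Ioi 0) (h0 : ∫ s in Ioi (0 : ℝ), g s = 0) :
    ∃ v : ℝ → ℝ, ContDiff ℝ ∞ v ∧ HasCompactSupport v ∧ tsupport v ⊆ Ioi 0 ∧ deriv v = g := by
  obtain ⟨N, hN, hgN⟩ : ∃ N : ℝ, 0 < N ∧ tsupport g ⊆ Iio N := by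
    obtain ⟨b, hb⟩ := hc.isCompact.bddAbove
    exact ⟨max b 0 + 1, by positivity, fun x hx => by
      have := hb hx
      have := le_max_left b 0
      simp only [mem_Iio]
      linarith⟩
  have ht : IsTest N (fun x => (g x : ℂ)) :=
    ⟨Complex.ofRealCLM.contDiff.comp hg, hc.comp_left (g := fun t : ℝ => (t : ℂ)) (by simp),
      (tsupport_comp_subset (g := fun t : ℝ => (t : ℂ)) (by simp) g).trans
        fun x hx => ⟨hs hx, hgN hx⟩⟩
  obtain ⟨v, hv, hdv⟩ := ht.exists_primitive hN (by
    rw [integral_complex_ofReal, Complex.ofReal_eq_zero]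
    refine Eq.trans (Eq.symm (setIntegral_eq_of_subset_of_forall_sdiff_eq_zero (f := g) measurableSet_Ioi
      (s := Ioo 0 N) (fun t ht => ht.1) fun t ht => ?_)) h0
    exact image_eq_zero_of_notMem_tsupport fun h => ht.2 ⟨hs h, hgN h⟩)
  refine ⟨fun x => (v x).re, Complex.reCLM.contDiff.comp hv.smooth,
    hv.compact.comp_left (g := Complex.re) (by simp),
    ((tsupport_comp_subset (g := Complex.re) (by simp) v).trans hv.support).trans
      fun x hx => hx.1, funext fun x => ?_⟩
  have h1 : HasDerivAt v (g x : ℂ) x := by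
    rw [← congrFun hdv x]
    exact (hv.smooth.differentiable (by simp) x).hasDerivAt
  exact (Complex.reCLM.hasFDerivAt.comp_hasDerivAt x h1).deriv

/-- An element of the memory space with vanishing weak derivative is constant. -/
lemma HasMemDeriv.exists_const {η : Memory ℓ μ} (h : HasMemDeriv η 0) :
    ∃ c : H10 ℓ, ∀ᵐ s ∂volume.restrict (Ioi (0 : ℝ)), η s = c := by
  have hz : ∀ v : ℝ → ℝ, ContDiff ℝ ∞ v → HasCompactSupport v → tsupport v ⊆ Ioi 0 →
      ∫ s in Ioi (0 : ℝ), deriv v s • η s = 0 := by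
    intro v hv hc hs
    rw [h v hv hc hs, neg_eq_zero]
    refine integral_eq_zero_of_ae ?_
    filter_upwards [μ.volume_ac.ae_eq (Lp.coeFn_zero (H10 ℓ) 2 μ.measure)] with s hs
    rw [hs]
    simp
  let b : ContDiffBump (1 : ℝ) := ⟨1 / 4, 1 / 2, by positivity, by norm_num⟩
  set χ : ℝ → ℝ := b.normed volume with hχ
  have χs : tsupport χ ⊆ Ioi 0 := by
    rw [hχ, b.tsupport_normed_eq, Real.closedBall_eq_Icc]
    change Icc ((1 : ℝ) - 1 / 2) (1 + 1 / 2) ⊆ _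
    intro x hx
    have := hx.1
    simp only [mem_Ioi]
    linarith
  have χd : ContDiff ℝ ∞ χ := b.contDiff_normed
  have χc : HasCompactSupport χ := b.hasCompactSupport_normed
  have χ1 : ∫ s in Ioi (0 : ℝ), χ s = 1 := by
    rw [setIntegral_eq_integral_of_forall_compl_eq_zero, hχ, b.integral_normed]
    exact fun x hx => image_eq_zero_of_notMem_tsupport fun h => hx (χs h)
  have χi : IntegrableOn χ (Ioi (0 : ℝ)) :=
    (χd.continuous.integrable_of_hasCompactSupport χc).integrableOn
  -- Du Bois-Reymond's argument with a bump `χ` of integral one. For a test function `g`, the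
  -- function `g - (∫ g) χ` has zero integral, so it is `v'` for a test function `v`, and `∫ v' η =
  -- 0` says `∫ g (η - c) = 0`.
  refine ⟨∫ s in Ioi (0 : ℝ), χ s • η s, ?_⟩
  set c := ∫ s in Ioi (0 : ℝ), χ s • η s with hcdef
  have := isOpen_Ioi.ae_eq_zero_of_integral_contDiff_smul_eq_zero (μ := volume)
    (f := fun s => η s - c) (U := Ioi (0 : ℝ))
    ((Memory.locallyIntegrableOn η).sub (continuousOn_const.locallyIntegrableOn
      measurableSet_Ioi)) (by
      intro g hg gc gs
      have gi : IntegrableOn g (Ioi (0 : ℝ)) :=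
        (hg.continuous.integrable_of_hasCompactSupport gc).integrableOn
      set I := ∫ s in Ioi (0 : ℝ), g s
      obtain ⟨v, hv, vc, vs, dv⟩ := exists_real_primitive (g := fun s => g s + χ s * (-I))
        (hg.add (χd.mul contDiff_const)) (gc.add χc.mul_right)
        ((tsupport_add _ _).trans (union_subset gs
          ((closure_mono (Function.support_mul_subset_left χ _)).trans χs)))
        (by
          rw [integral_add gi (χi.mul_const _), integral_mul_const, χ1]
          change I + _ = 0
          ring)
      have h1 := hz v hv vc vs
      have e : ∀ s, deriv v s • η s = g s • η s + (-I) • (χ s • η s) := by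
        intro s
        rw [dv]
        module
      have i₁ := Memory.integrable_smul η hg.continuous gc gs
      have i₂ := Memory.integrable_smul η χd.continuous χc χs
      simp only [e] at h1
      rw [integral_add (g := fun s => (-I) • (χ s • η s)) i₁ (i₂.smul (-I)), integral_smul,
        ← hcdef] at h1
      rw [← setIntegral_eq_integral_of_forall_compl_eq_zero (s := Ioi (0 : ℝ)) (fun s hs => by
        rw [image_eq_zero_of_notMem_tsupport fun h => hs (gs h), zero_smul])]
      simp only [smul_sub]
      rw [integral_sub i₁ (gi.smul_const c), integral_smul_const]
      rw [← h1]
      module)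
  rw [ae_restrict_iff' measurableSet_Ioi]
  filter_upwards [this] with s hs hmem
  exact sub_eq_zero.1 (hs hmem)

/-- Elements of the domain of the transport operator are primitives. -/
lemma eq_primitive_of_mem {η θ : Memory ℓ μ} (hη : η ∈ transportDomain ℓ μ)
    (h : HasMemDeriv η θ) : η = (memPrimitive θ) := by
  obtain ⟨-, f, hfc, hfe, hft⟩ := hη
  have h0 : HasMemDeriv (η + (-1 : ℂ) • (memPrimitive θ)) 0 := by
    have := h.add ((Memory.hasMemDeriv_primitive θ).smul (-1))
    simpa using this
  obtain ⟨c, hc⟩ := h0.exists_const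
  have hG := continuousOn_primitive_Ici (Lp.memLp θ)
  have hGc := hG.mono Ioi_subset_Ici_self
  have hae : (fun s => f s - ∫ t in (0 : ℝ)..s, θ t) =ᵐ[volume.restrict (Ioi (0 : ℝ))]
      fun _ => c := by
    filter_upwards [hc, hfe, Memory.coe_add η ((-1 : ℂ) • (memPrimitive θ)),
      Memory.coe_smul (-1) (memPrimitive θ), (Memory.coeFn_primitive θ)] with s h1 h2 h3 h4 h5
    rw [← h1, h3, Pi.add_apply, h4, Pi.smul_apply, h5, h2, neg_one_smul, ← sub_eq_add_neg]
  -- Both sides are continuous on `(0, ∞)`, so the equality holds everywhere and the limit at `0` is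
  -- legitimate. There `f` and the primitive both vanish, which kills the constant.
  have heq := Measure.eqOn_open_of_ae_eq hae isOpen_Ioi (hfc.sub hGc) continuousOn_const
  have hc0 : c = 0 := by
    have t₁ : Tendsto f (𝓝[>] 0) (𝓝 0) := by
      rw [tendsto_zero_iff_norm_tendsto_zero]
      simpa only [H10.norm_grad] using hft
    have t₂ := (hG 0 self_mem_Ici).mono_left (nhdsWithin_mono _ Ioi_subset_Ici_self)
    have t₃ := t₁.sub t₂
    simp only [intervalIntegral.integral_same, sub_zero] at t₃
    refine tendsto_nhds_unique (Tendsto.congr' ?_ t₃) tendsto_const_nhds |>.symm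
    filter_upwards [self_mem_nhdsWithin] with s hs using heq hs
  refine Lp.ext (μ.measure_ac.ae_eq ?_)
  filter_upwards [hae, hfe, (Memory.coeFn_primitive θ)] with s h1 h2 h3
  rw [h2, h3, ← sub_eq_zero, h1, hc0]

/-! ### Means of the memory variable -/

/-- The mean is the adjoint of the embedding of constants. This yields its boundedness, and it is
why the thermal and memory exchange terms cancel in the energy balance. -/
lemma inner_memMean (η : Memory ℓ μ) (x : H10 ℓ) :
    inner ℂ x (memMean μ η) = inner ℂ (Lp.const 2 μ.measure x) η := by
  change inner ℂ x (∫ s, η s ∂μ.measure) = _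
  rw [← integral_inner ((Lp.memLp η).integrable (by norm_num)), L2.inner_def]
  refine integral_congr_ae ?_
  filter_upwards [Lp.coeFn_const 2 μ.measure x] with s hs
  rw [hs]
  rfl

/-- The mean as a continuous operator. -/
def memMeanL (ℓ : ℝ) (μ : MemoryKernel) : Memory ℓ μ →L[ℂ] H10 ℓ :=
  (memMean μ).mkContinuousOfExistsBound ⟨‖Lp.constL 2 μ.measure ℂ (E := H10 ℓ)‖, fun η => by
    have h : ‖memMean μ η‖ * ‖memMean μ η‖ ≤
        ‖memMean μ η‖ * (‖Lp.constL 2 μ.measure ℂ (E := H10 ℓ)‖ * ‖η‖) := by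
      calc ‖memMean μ η‖ * ‖memMean μ η‖ = ‖inner ℂ (memMean μ η) (memMean μ η)‖ := by
            rw [inner_self_eq_norm_sq_to_K]; simp [sq]
        _ = ‖inner ℂ (Lp.constL 2 μ.measure ℂ (memMean μ η)) η‖ := by
            rw [inner_memMean]; rfl
        _ ≤ ‖Lp.constL 2 μ.measure ℂ (memMean μ η)‖ * ‖η‖ := norm_inner_le_norm _ _
        _ ≤ (‖Lp.constL 2 μ.measure ℂ (E := H10 ℓ)‖ * ‖memMean μ η‖) * ‖η‖ := by
            gcongr; exact ContinuousLinearMap.le_opNorm _ _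
        _ = _ := by ring
    rcases (norm_nonneg (memMean μ η)).eq_or_lt with h0 | h0
    · rw [← h0]; positivity
    · exact le_of_mul_le_mul_left h h0⟩

/-- The first moment of the kernel. -/
def MemoryKernel.moment (μ : MemoryKernel) : ℝ := ∫ s, s ∂μ.measure

/-- The function `s` is the primitive of `1`, so `memLp_primitive` and the finiteness of the measure
make it integrable; the integrand is positive. Dividing by the moment later recovers the temperature
from the memory. -/
lemma MemoryKernel.moment_pos (μ : MemoryKernel) : 0 < μ.moment := by
  have h1 : MemLp (fun s => ∫ _ in (0 : ℝ)..s, (1 : ℝ)) 2 μ.measure :=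
    memLp_primitive (memLp_const 1)
  have h2 : Integrable (fun s => ∫ _ in (0 : ℝ)..s, (1 : ℝ)) μ.measure :=
    h1.integrable (by norm_num)
  simp only [intervalIntegral.integral_const, sub_zero, smul_eq_mul, mul_one] at h2
  rw [μ.integrable_iff] at h2
  rw [MemoryKernel.moment, μ.integral_eq, setIntegral_pos_iff_support_of_nonneg_ae]
  · have : Function.support (fun s => μ.toFun s • s) ∩ Ioi 0 = Ioi 0 := by
      refine inter_eq_right.2 fun s (hs : 0 < s) => ?_
      exact (mul_pos (μ.pos s hs) hs).ne'
    rw [this]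
    simp
  · filter_upwards [ae_restrict_mem measurableSet_Ioi] with s (hs : 0 < s)
    exact (mul_pos (μ.pos s hs) hs).le
  · exact h2

/-- The primitive of the constant `x` is `s • x`. Averaging after taking primitives is therefore a
nonzero scalar on constants, which makes the memory equation solvable for the temperature. -/
lemma memMean_primitive_const (x : H10 ℓ) :
    memMean μ (memPrimitive (Lp.const 2 μ.measure x)) = (μ.moment : ℂ) • x := by
  change ∫ s, _ ∂μ.measure = _
  have e : ∫ s, (memPrimitive (Lp.const 2 μ.measure x) : Memory ℓ μ) s ∂μ.measure =
      ∫ s, s • x ∂μ.measure := by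
    refine integral_congr_ae (μ.measure_ac.ae_eq ?_)
    filter_upwards [Memory.coeFn_primitive (Lp.const 2 μ.measure x : Memory ℓ μ),
      ae_restrict_mem measurableSet_Ioi] with s h1 (hs : 0 < s)
    rw [h1, intervalIntegral_congr_Ioi (g := fun _ => x)
      (μ.volume_ac.ae_eq (Lp.coeFn_const 2 μ.measure x)) hs.le]
    simp
  rw [e, integral_smul_const]
  rfl

lemma transport_eq {η θ : Memory ℓ μ} (hη : η ∈ transportDomain ℓ μ) (h : HasMemDeriv η θ) :
    transport ℓ μ ⟨η, hη⟩ = -θ := by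
  change -memDeriv η = -θ
  rw [h.memDeriv_eq]

end memoryPrimitive

open PhaseSpace

/-! ### Continuity of the components, completeness of the phase space, control of the displacements.
-/

section phaseSpace

variable {S : BGPData}

lemma le_inv_sqrt_mul {a x y : ℝ} (ha : 0 < a) (hy : 0 ≤ y) (h : a * x ^ 2 ≤ y ^ 2) :
    x ≤ (√a)⁻¹ * y := by
  have h1 : 0 < √a := Real.sqrt_pos.2 ha
  rw [inv_mul_eq_div, le_div_iff₀ h1]
  refine le_of_sq_le_sq ?_ hy
  rw [mul_pow, Real.sq_sqrt ha.le]
  linarith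

lemma PhaseSpace.norm_sq_components (u : PhaseSpace S) : ‖u‖ ^ 2 =
    S.k * ‖shear S u‖ ^ 2 + S.ρ₁ * ‖u.Φ‖ ^ 2 + S.b * ‖gradStar S.ℓ u.ψ‖ ^ 2 +
    S.ρ₂ * ‖u.Ψ‖ ^ 2 + S.k₀ * ‖axial S u‖ ^ 2 + S.ρ₁ * ‖u.W‖ ^ 2 + S.ρ₃ * ‖u.θ‖ ^ 2 +
    S.ϖ * ‖u.η‖ ^ 2 + S.ρ₃ * ‖u.ξ‖ ^ 2 + S.ϖ * ‖u.ζ‖ ^ 2 :=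
  norm_sq_eq u

lemma PhaseSpace.component_bounds (u : PhaseSpace S) :
    ‖shear S u‖ ≤ (√S.k)⁻¹ * ‖u‖ ∧ ‖u.Φ‖ ≤ (√S.ρ₁)⁻¹ * ‖u‖ ∧
    ‖gradStar S.ℓ u.ψ‖ ≤ (√S.b)⁻¹ * ‖u‖ ∧ ‖u.Ψ‖ ≤ (√S.ρ₂)⁻¹ * ‖u‖ ∧
    ‖axial S u‖ ≤ (√S.k₀)⁻¹ * ‖u‖ ∧ ‖u.W‖ ≤ (√S.ρ₁)⁻¹ * ‖u‖ ∧ ‖u.θ‖ ≤ (√S.ρ₃)⁻¹ * ‖u‖ ∧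
    ‖u.η‖ ≤ (√S.ϖ)⁻¹ * ‖u‖ ∧ ‖u.ξ‖ ≤ (√S.ρ₃)⁻¹ * ‖u‖ ∧ ‖u.ζ‖ ≤ (√S.ϖ)⁻¹ * ‖u‖ := by
  have h := u.norm_sq_components
  have h1 := S.ρ₁_pos
  have h2 := S.ρ₂_pos
  have h3 := S.ρ₃_pos
  have h4 := S.k_pos
  have h5 := S.k₀_pos
  have h6 := S.b_pos
  have h7 := S.ϖ_pos
  have p1 : 0 ≤ S.k * ‖shear S u‖ ^ 2 := by positivity
  have p2 : 0 ≤ S.ρ₁ * ‖u.Φ‖ ^ 2 := by positivity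
  have p3 : 0 ≤ S.b * ‖gradStar S.ℓ u.ψ‖ ^ 2 := by positivity
  have p4 : 0 ≤ S.ρ₂ * ‖u.Ψ‖ ^ 2 := by positivity
  have p5 : 0 ≤ S.k₀ * ‖axial S u‖ ^ 2 := by positivity
  have p6 : 0 ≤ S.ρ₁ * ‖u.W‖ ^ 2 := by positivity
  have p7 : 0 ≤ S.ρ₃ * ‖u.θ‖ ^ 2 := by positivity
  have p8 : 0 ≤ S.ϖ * ‖u.η‖ ^ 2 := by positivity
  have p9 : 0 ≤ S.ρ₃ * ‖u.ξ‖ ^ 2 := by positivity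
  have p10 : 0 ≤ S.ϖ * ‖u.ζ‖ ^ 2 := by positivity
  refine ⟨?_, ?_, ?_, ?_, ?_, ?_, ?_, ?_, ?_, ?_⟩ <;>
    refine le_inv_sqrt_mul (by assumption) (norm_nonneg _) (by linarith)

/-- `φ_x + ψ + l w` as a continuous operator. -/
def shearL (S : BGPData) : PhaseSpace S →L[ℂ] L2 S.ℓ :=
  (shear S).mkContinuous _ fun u => u.component_bounds.1

/-- `w_x - l φ` as a continuous operator. -/
def axialL (S : BGPData) : PhaseSpace S →L[ℂ] L2 S.ℓ :=
  (axial S).mkContinuous _ fun u => u.component_bounds.2.2.2.2.1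

/-- `ψ_x` as a continuous operator. -/
def psiGradL (S : BGPData) : PhaseSpace S →L[ℂ] L2 S.ℓ :=
  LinearMap.mkContinuous
    { toFun := fun u => gradStar S.ℓ u.ψ
      map_add' := fun u v => map_add (gradStar S.ℓ) u.ψ v.ψ
      map_smul' := fun c u => map_smul (gradStar S.ℓ) c u.ψ } _
    fun u => u.component_bounds.2.2.1

/-- The component `Φ` as a continuous operator. -/
def PhiL (S : BGPData) : PhaseSpace S →L[ℂ] L2 S.ℓ :=
  LinearMap.mkContinuous ⟨⟨fun u => u.Φ, fun _ _ => rfl⟩, fun _ _ => rfl⟩ _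
    fun u => u.component_bounds.2.1

/-- The component `Ψ` as a continuous operator. -/
def PsiL (S : BGPData) : PhaseSpace S →L[ℂ] L2star S.ℓ :=
  LinearMap.mkContinuous ⟨⟨fun u => u.Ψ, fun _ _ => rfl⟩, fun _ _ => rfl⟩ _
    fun u => u.component_bounds.2.2.2.1

/-- The component `W` as a continuous operator. -/
def WL (S : BGPData) : PhaseSpace S →L[ℂ] L2star S.ℓ :=
  LinearMap.mkContinuous ⟨⟨fun u => u.W, fun _ _ => rfl⟩, fun _ _ => rfl⟩ _
    fun u => u.component_bounds.2.2.2.2.2.1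

/-- The component `θ` as a continuous operator. -/
def thetaL (S : BGPData) : PhaseSpace S →L[ℂ] L2 S.ℓ :=
  LinearMap.mkContinuous ⟨⟨fun u => u.θ, fun _ _ => rfl⟩, fun _ _ => rfl⟩ _
    fun u => u.component_bounds.2.2.2.2.2.2.1

/-- The component `η` as a continuous operator. -/
def etaL (S : BGPData) : PhaseSpace S →L[ℂ] Memory S.ℓ S.μ :=
  LinearMap.mkContinuous ⟨⟨fun u => u.η, fun _ _ => rfl⟩, fun _ _ => rfl⟩ _
    fun u => u.component_bounds.2.2.2.2.2.2.2.1

/-- The component `ξ` as a continuous operator. -/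
def xiL (S : BGPData) : PhaseSpace S →L[ℂ] L2 S.ℓ :=
  LinearMap.mkContinuous ⟨⟨fun u => u.ξ, fun _ _ => rfl⟩, fun _ _ => rfl⟩ _
    fun u => u.component_bounds.2.2.2.2.2.2.2.2.1

/-- The component `ζ` as a continuous operator. -/
def zetaL (S : BGPData) : PhaseSpace S →L[ℂ] Memory S.ℓ S.ν :=
  LinearMap.mkContinuous ⟨⟨fun u => u.ζ, fun _ _ => rfl⟩, fun _ _ => rfl⟩ _
    fun u => u.component_bounds.2.2.2.2.2.2.2.2.2

/-- The energy norm sees `φ, ψ, w` only through the three strains, so nothing has to be checked on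
the displacements themselves. -/
lemma PhaseSpace.tendsto_zero {u : ℕ → PhaseSpace S}
    (h₁ : Tendsto (fun n => shear S (u n)) atTop (𝓝 0))
    (h₂ : Tendsto (fun n => (u n).Φ) atTop (𝓝 0))
    (h₃ : Tendsto (fun n => gradStar S.ℓ (u n).ψ) atTop (𝓝 0))
    (h₄ : Tendsto (fun n => (u n).Ψ) atTop (𝓝 0))
    (h₅ : Tendsto (fun n => axial S (u n)) atTop (𝓝 0))
    (h₆ : Tendsto (fun n => (u n).W) atTop (𝓝 0))
    (h₇ : Tendsto (fun n => (u n).θ) atTop (𝓝 0))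
    (h₈ : Tendsto (fun n => (u n).η) atTop (𝓝 0))
    (h₉ : Tendsto (fun n => (u n).ξ) atTop (𝓝 0))
    (h₀ : Tendsto (fun n => (u n).ζ) atTop (𝓝 0)) : Tendsto u atTop (𝓝 0) := by
  have aux : ∀ {E : Type} [NormedAddCommGroup E] {x : ℕ → E} (a : ℝ), Tendsto x atTop (𝓝 0) →
      Tendsto (fun n => a * ‖x n‖ ^ 2) atTop (𝓝 0) := by
    intro E _ x a hx
    simpa using (hx.norm.pow 2).const_mul a
  have h : Tendsto (fun n => ‖u n‖ ^ 2) atTop (𝓝 0) := by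
    simp only [PhaseSpace.norm_sq_components]
    simpa only [add_zero] using (((((((((aux S.k h₁).add (aux S.ρ₁ h₂)).add (aux S.b h₃)).add
      (aux S.ρ₂ h₄)).add (aux S.k₀ h₅)).add (aux S.ρ₁ h₆)).add (aux S.ρ₃ h₇)).add
      (aux S.ϖ h₈)).add (aux S.ρ₃ h₉)).add (aux S.ϖ h₀)
  rw [tendsto_zero_iff_norm_tendsto_zero]
  simpa using h.sqrt

/-- Every strain is attained by a displacement. -/
lemma exists_strain (S : BGPData) {s : L2 S.ℓ} (hs : s ∈ L2star S.ℓ) (p d : L2 S.ℓ) :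
    ∃ (φ : H10 S.ℓ) (ψ w : H1star S.ℓ), φ.grad + (ψ : L2 S.ℓ) + (S.l : ℂ) • (w : L2 S.ℓ) = s ∧
      gradStar S.ℓ ψ = p ∧ gradStar S.ℓ w - (S.l : ℂ) • φ.toL2 = d := by
  -- The equation `ψ_x = p` decouples and fixes `ψ = β`; `(φ, w)` then solves the displacement
  -- system with data `s - β` and `d`.
  obtain ⟨β, hβ, hβ'⟩ := exists_primitive S.ℓ_pos p
  obtain ⟨φ, w, hφ, hw, hφ', hw'⟩ := exists_displacement S.ℓ_pos S.l_pos S.lℓ_ne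
    ((L2star S.ℓ).sub_mem hs hβ) d
  refine ⟨H10.mk φ hφ, ⟨β, hβ'.mem_H1, hβ⟩, ⟨w, hw'.mem_H1, hw⟩, ?_, hβ'.weakDeriv_eq, ?_⟩
  · change weakDeriv φ + β + (S.l : ℂ) • w = s
    rw [hφ'.weakDeriv_eq]
    abel
  · change weakDeriv w - (S.l : ℂ) • φ = d
    rw [hw'.weakDeriv_eq]
    abel

/-- A Cauchy sequence provides limits of the strains, not of the displacements. The limit shear
still has zero mean, so `exists_strain` realises all three limits by an actual displacement. -/
instance : CompleteSpace (PhaseSpace S) := by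
  refine Metric.complete_of_cauchySeq_tendsto fun u hu => ?_
  have lim : ∀ {E : Type} [NormedAddCommGroup E] [NormedSpace ℂ E] [CompleteSpace E]
      (T : PhaseSpace S →L[ℂ] E), ∃ y, Tendsto (fun n => T (u n)) atTop (𝓝 y) := fun T =>
    cauchySeq_tendsto_of_complete (hu.map T.uniformContinuous)
  have : CompleteSpace (L2star S.ℓ) := isClosed_L2star.completeSpace_coe
  obtain ⟨s, hs⟩ := lim (shearL S)
  obtain ⟨Φ, hΦ⟩ := lim (PhiL S)
  obtain ⟨p, hp⟩ := lim (psiGradL S)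
  obtain ⟨Ψ, hΨ⟩ := lim (PsiL S)
  obtain ⟨d, hd⟩ := lim (axialL S)
  obtain ⟨W, hW⟩ := lim (WL S)
  obtain ⟨θ, hθ⟩ := lim (thetaL S)
  obtain ⟨η, hη⟩ := lim (etaL S)
  obtain ⟨ξ, hξ⟩ := lim (xiL S)
  obtain ⟨ζ, hζ⟩ := lim (zetaL S)
  have hs0 : s ∈ L2star S.ℓ :=
    isClosed_L2star.mem_of_tendsto hs (Eventually.of_forall fun n => shear_mem_L2star (u n))
  obtain ⟨φ, ψ, w, e₁, e₂, e₃⟩ := exists_strain S hs0 p d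
  let v : PhaseSpace S := ⟨φ, Φ, ψ, Ψ, w, W, θ, η, ξ, ζ⟩
  refine ⟨v, ?_⟩
  rw [← tendsto_sub_nhds_zero_iff]
  have sub : ∀ {E : Type} [NormedAddCommGroup E] [NormedSpace ℂ E] (T : PhaseSpace S →L[ℂ] E)
      {y : E}, T v = y → Tendsto (fun n => T (u n)) atTop (𝓝 y) →
      Tendsto (fun n => T (u n - v)) atTop (𝓝 0) := by
    intro E _ _ T y hy h
    simp only [map_sub, hy]
    exact tendsto_sub_nhds_zero_iff.2 h
  exact PhaseSpace.tendsto_zero (sub (shearL S) e₁ hs) (sub (PhiL S) rfl hΦ)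
    (sub (psiGradL S) e₂ hp) (sub (PsiL S) rfl hΨ) (sub (axialL S) e₃ hd) (sub (WL S) rfl hW)
    (sub (thetaL S) rfl hθ) (sub (etaL S) rfl hη) (sub (xiL S) rfl hξ) (sub (zetaL S) rfl hζ)

lemma H1star.hasWeakDeriv {ℓ : ℝ} (f : H1star ℓ) :
    HasWeakDeriv ℓ (f : L2 ℓ) (gradStar ℓ f) :=
  hasWeakDeriv_weakDeriv f.2.1

/-- The component `ψ` as a continuous operator into `L²`. -/
def psiL (S : BGPData) : PhaseSpace S →L[ℂ] L2 S.ℓ :=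
  LinearMap.mkContinuousOfExistsBound
    ⟨⟨fun u => (u.ψ : L2 S.ℓ), fun _ _ => rfl⟩, fun _ _ => rfl⟩ (by
      obtain ⟨C, hC⟩ := exists_norm_le_weakDeriv S.ℓ_pos
      refine ⟨|C| * ‖psiGradL S‖, fun u => ?_⟩
      refine (hC _ _ u.ψ.2.2 (H1star.hasWeakDeriv u.ψ)).trans ?_
      rw [mul_assoc]
      exact mul_le_mul (le_abs_self C) ((psiGradL S).le_opNorm u) (norm_nonneg _) (abs_nonneg C))

/-- The pair `(φ, w)` as a linear operator. -/
def phiw (S : BGPData) : PhaseSpace S →ₗ[ℂ] H10 S.ℓ × L2 S.ℓ where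
  toFun u := (u.φ, (u.w : L2 S.ℓ))
  map_add' _ _ := rfl
  map_smul' _ _ := rfl

/-- The pair `(φ, w)` as a continuous operator, by the closed graph theorem. -/
def phiwL (S : BGPData) : PhaseSpace S →L[ℂ] H10 S.ℓ × L2 S.ℓ :=
  ContinuousLinearMap.ofSeqClosedGraph (g := phiw S) (by
    intro u x y hu hy
    have hφ : Tendsto (fun n => (u n).φ) atTop (𝓝 y.1) := (continuous_fst.tendsto _).comp hy
    have hw : Tendsto (fun n => ((u n).w : L2 S.ℓ)) atTop (𝓝 y.2) :=
      (continuous_snd.tendsto _).comp hy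
    have hφ₁ := ((H10.gradIso S.ℓ).continuous.tendsto _).comp hφ
    have hφ₀ := ((H10.toL2L S.ℓ).continuous.tendsto _).comp hφ
    have hψ := ((psiL S).continuous.tendsto x).comp hu
    have hs := ((shearL S).continuous.tendsto x).comp hu
    have hd := ((axialL S).continuous.tendsto x).comp hu
    have e₁ : y.1.grad + (x.ψ : L2 S.ℓ) + (S.l : ℂ) • y.2 = shear S x :=
      tendsto_nhds_unique ((hφ₁.add hψ).add (hw.const_smul (S.l : ℂ))) hs
    have hwx : Tendsto (fun n => gradStar S.ℓ (u n).w) atTop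
        (𝓝 (axial S x + (S.l : ℂ) • y.1.toL2)) := by
      refine (hd.add (hφ₀.const_smul (S.l : ℂ))).congr fun n => ?_
      change gradStar S.ℓ (u n).w - (S.l : ℂ) • (u n).φ.toL2 + (S.l : ℂ) • (u n).φ.toL2 = _
      abel
    have hw' := HasWeakDeriv.of_tendsto (fun n => H1star.hasWeakDeriv (u n).w) hw hwx
    have hmem : y.2 ∈ L2star S.ℓ :=
      isClosed_L2star.mem_of_tendsto hw (Eventually.of_forall fun n => (u n).w.2.2)
    let w : H1star S.ℓ := ⟨y.2, hw'.mem_H1, hmem⟩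
    have e₃ : gradStar S.ℓ w = axial S x + (S.l : ℂ) • y.1.toL2 := hw'.weakDeriv_eq
    -- The difference between the displacement of `x` and the limit pair `y`. Its `ψ` entry can be
    -- taken zero because `ψ` already depends continuously on the energy norm. All its strains
    -- vanish, so definiteness of the energy gives `z = 0`.
    let z : PhaseSpace S := ⟨x.φ - y.1, 0, 0, 0, x.w - w, 0, 0, 0, 0, 0⟩
    have e₄ : shear S z = 0 := by
      change H10.grad (x.φ - y.1) + (0 : L2 S.ℓ) + (S.l : ℂ) • ((x.w : L2 S.ℓ) - y.2) = 0
      have e : x.φ.grad + (x.ψ : L2 S.ℓ) + (S.l : ℂ) • (x.w : L2 S.ℓ) = shear S x := rfl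
      rw [map_sub]
      refine Eq.trans ?_ (sub_eq_zero.2 (e.trans e₁.symm))
      module
    have e₅ : axial S z = 0 := by
      change gradStar S.ℓ (x.w - w) - (S.l : ℂ) • H10.toL2 (x.φ - y.1) = 0
      rw [map_sub, map_sub, e₃]
      change _ - (gradStar S.ℓ x.w - (S.l : ℂ) • x.φ.toL2 + _) - _ = _
      module
    have hz : z = 0 := by
      refine eq_zero_of_energy ?_
      simp [energyInner, e₄, e₅, z]
    refine Prod.ext ?_ ?_
    · exact (sub_eq_zero.1 (congrArg PhaseSpace.φ hz)).symm
    · exact (congrArg Subtype.val (sub_eq_zero.1 (congrArg PhaseSpace.w hz))).symm)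

end phaseSpace

/-! ### Surjectivity of the generator -/

section surjectivity

variable {S : BGPData}

/-- Solvability of the stationary heat equation with memory. -/
lemma exists_memory_solution {ℓ : ℝ} (hℓ : 0 < ℓ) {μ : MemoryKernel} (r : L2 ℓ)
    (g : Memory ℓ μ) : ∃ (θ : H10 ℓ) (η : Memory ℓ μ), η ∈ transportDomain ℓ μ ∧
      HasMemDeriv η (Lp.const 2 μ.measure θ - g) ∧ HasWeakDeriv ℓ (memMean μ η).grad r := by
  obtain ⟨q, hq, hq'⟩ := exists_primitive hℓ r
  obtain ⟨y, rfl⟩ := exists_grad_eq hℓ hq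
  have hm : (μ.moment : ℂ) ≠ 0 := by exact_mod_cast μ.moment_pos.ne'
  -- The mean of the primitive of `θ - g` is `moment • θ - memMean (memPrimitive g)`. This choice
  -- makes it equal to `y`, whose gradient is a primitive of `r`.
  let θ : H10 ℓ := (μ.moment : ℂ)⁻¹ • (y + memMean μ (memPrimitive g))
  refine ⟨θ, memPrimitive (Lp.const 2 μ.measure θ - g), Memory.primitive_mem _,
    Memory.hasMemDeriv_primitive _, ?_⟩
  have e : memMean μ (memPrimitive (Lp.const 2 μ.measure θ - g)) = y := by
    have h1 : memPrimitive (Lp.const 2 μ.measure θ - g) =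
        memPrimitive (Lp.const 2 μ.measure θ) - memPrimitive g :=
      map_sub (memPrimitiveL ℓ μ) _ _
    rw [h1, map_sub, memMean_primitive_const, smul_inv_smul₀ hm, add_sub_cancel_right]
  rwa [e]

/-- The generator is onto. -/
lemma exists_bgpAction_eq (f : PhaseSpace S) :
    ∃ (u : PhaseSpace S) (h : InDomain u), bgpAction u h = f := by
  have hρ₁ : (S.ρ₁ : ℂ) ≠ 0 := by exact_mod_cast S.ρ₁_pos.ne'
  have hρ₂ : (S.ρ₂ : ℂ) ≠ 0 := by exact_mod_cast S.ρ₂_pos.ne'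
  have hρ₃ : (S.ρ₃ : ℂ) ≠ 0 := by exact_mod_cast S.ρ₃_pos.ne'
  have hk : (S.k : ℂ) ≠ 0 := by exact_mod_cast S.k_pos.ne'
  have hk₀ : (S.k₀ : ℂ) ≠ 0 := by exact_mod_cast S.k₀_pos.ne'
  have hb : (S.b : ℂ) ≠ 0 := by exact_mod_cast S.b_pos.ne'
  have hϖ : (S.ϖ : ℂ) ≠ 0 := by exact_mod_cast S.ϖ_pos.ne'
  obtain ⟨θ, η, hη, hη', hy⟩ := exists_memory_solution (μ := S.μ) S.ℓ_pos
    ((S.ϖ : ℂ)⁻¹ • ((S.ρ₃ : ℂ) • f.θ + (S.γ : ℂ) • weakDeriv (f.ψ : L2 S.ℓ))) f.η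
  obtain ⟨ξ, ζ, hζ, hζ', hx⟩ := exists_memory_solution (μ := S.ν) S.ℓ_pos
    ((S.ϖ : ℂ)⁻¹ • ((S.ρ₃ : ℂ) • f.ξ + (S.γ : ℂ) •
      (weakDeriv (f.w : L2 S.ℓ) - (S.l : ℂ) • f.φ.toL2))) f.ζ
  have hg₆ : (S.ρ₁ : ℂ) • (f.W : L2 S.ℓ) + (S.γ : ℂ) • ξ.grad ∈ L2star S.ℓ :=
    add_mem (Submodule.smul_mem _ _ f.W.2) (Submodule.smul_mem _ _ (weakDeriv_mem_L2star ξ.toL2_mem))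
  -- With `N = k₀ (w_x - l φ)` and `s = -k (φ_x + ψ + l w)`, the vertical and axial force balances
  -- form the displacement system again, and `N ∈ H¹₀`, `s` of zero mean are the conditions imposed
  -- by the domain. The stresses are thus found before the displacements.
  obtain ⟨N, s, hN, hs, hN', hs'⟩ := exists_displacement S.ℓ_pos S.l_pos S.lℓ_ne hg₆
    (-((S.ρ₁ : ℂ) • f.Φ + (S.l * S.γ : ℂ) • ξ.toL2))
  have hh : (S.b : ℂ)⁻¹ • ((S.ρ₂ : ℂ) • (f.Ψ : L2 S.ℓ) + (S.γ : ℂ) • θ.grad - s) ∈ L2star S.ℓ :=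
    Submodule.smul_mem _ _ (sub_mem (add_mem (Submodule.smul_mem _ _ f.Ψ.2)
      (Submodule.smul_mem _ _ (weakDeriv_mem_L2star θ.toL2_mem))) hs)
  -- Once `s` is known, the rotation equation prescribes `ψ_xx`. It has zero mean, so `ψ_x` can be
  -- taken in `H¹₀`, as the domain requires.
  obtain ⟨h, hh'⟩ := exists_grad_eq S.ℓ_pos hh
  obtain ⟨φ, ψ, w, e₁, e₂, e₃⟩ := exists_strain S
    (Submodule.smul_mem (L2star S.ℓ) (-(S.k : ℂ)⁻¹) hs) h.toL2 ((S.k₀ : ℂ)⁻¹ • N)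
  let u : PhaseSpace S := ⟨φ, f.φ.toL2, ψ, ⟨f.ψ, f.ψ.2.2⟩, w, ⟨f.w, f.w.2.2⟩, θ.toL2, η, ξ.toL2, ζ⟩
  have eS : shear S u = -(S.k : ℂ)⁻¹ • s := e₁
  have eN : axial S u = (S.k₀ : ℂ)⁻¹ • N := e₃
  have hS := hs'.smul (-(S.k : ℂ)⁻¹)
  have hu : InDomain u :=
    { φ := ⟨H10sub_le_H1 φ.toL2_mem, by
        change φ.grad ∈ H1 S.ℓ
        have : φ.grad = -(S.k : ℂ)⁻¹ • s - ψ - (S.l : ℂ) • (w : L2 S.ℓ) := by rw [← e₁]; abel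
        rw [this]
        exact sub_mem (sub_mem hS.mem_H1 ψ.2.1) (Submodule.smul_mem _ _ w.2.1)⟩
      Φ := f.φ.toL2_mem
      ψ_x := by
        change gradStar S.ℓ ψ ∈ _
        rw [e₂]; exact h.toL2_mem
      w_x := by
        change gradStar S.ℓ w ∈ _
        rw [sub_eq_iff_eq_add.1 e₃]
        exact add_mem (Submodule.smul_mem _ _ hN) (Submodule.smul_mem _ _ φ.toL2_mem)
      Ψ := f.ψ.2.1
      W := f.w.2.1
      θ := θ.toL2_mem
      ξ := ξ.toL2_mem
      η_mean := ⟨H10sub_le_H1 (H10.toL2_mem _), hy.mem_H1⟩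
      ζ_mean := ⟨H10sub_le_H1 (H10.toL2_mem _), hx.mem_H1⟩
      η := hη
      ζ := hζ }
  have eψ : weakDeriv (gradStar S.ℓ u.ψ) =
      (S.b : ℂ)⁻¹ • ((S.ρ₂ : ℂ) • (f.Ψ : L2 S.ℓ) + (S.γ : ℂ) • θ.grad - s) := by
    rw [← hh']
    change weakDeriv (gradStar S.ℓ ψ) = _
    rw [e₂]; rfl
  refine ⟨u, hu, ?_⟩
  ext1
  · rfl
  · change (S.k / S.ρ₁ : ℂ) • weakDeriv (shear S u) + (S.l * S.k₀ / S.ρ₁ : ℂ) • axial S u -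
      (S.l * S.γ / S.ρ₁ : ℂ) • ξ.toL2 = f.Φ
    rw [eS, hS.weakDeriv_eq, eN]
    match_scalars <;> field_simp <;> ring
  · rfl
  · refine Subtype.ext ?_
    change (S.b / S.ρ₂ : ℂ) • weakDeriv (gradStar S.ℓ u.ψ) - (S.k / S.ρ₂ : ℂ) • shear S u -
      (S.γ / S.ρ₂ : ℂ) • θ.grad = f.Ψ
    rw [eψ, eS]
    match_scalars <;> field_simp <;> ring
  · rfl
  · refine Subtype.ext ?_
    change (S.k₀ / S.ρ₁ : ℂ) • weakDeriv (axial S u) - (S.l * S.k / S.ρ₁ : ℂ) • shear S u -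
      (S.γ / S.ρ₁ : ℂ) • ξ.grad = f.W
    rw [eS, eN, (hN'.smul _).weakDeriv_eq]
    match_scalars <;> field_simp <;> ring
  · change (S.ϖ / S.ρ₃ : ℂ) • weakDeriv (memMean S.μ η).grad -
      (S.γ / S.ρ₃ : ℂ) • weakDeriv (f.ψ : L2 S.ℓ) = f.θ
    rw [hy.weakDeriv_eq]
    match_scalars <;> field_simp
    ring
  · change transport S.ℓ S.μ ⟨η, hη⟩ + Lp.const 2 S.μ.measure θ = f.η
    rw [transport_eq hη hη']
    abel
  · change (S.ϖ / S.ρ₃ : ℂ) • weakDeriv (memMean S.ν ζ).grad -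
      (S.γ / S.ρ₃ : ℂ) • (weakDeriv (f.w : L2 S.ℓ) - (S.l : ℂ) • f.φ.toL2) = f.ξ
    rw [hx.weakDeriv_eq]
    match_scalars <;> field_simp <;> ring
  · change transport S.ℓ S.ν ⟨ζ, hζ⟩ + Lp.const 2 S.ν.measure ξ = f.ζ
    rw [transport_eq hζ hζ']
    abel

end surjectivity

/-! ### Dissipation -/

section dissipation

variable {S : BGPData}

/-- Writing `η` as the primitive of its derivative `θ`, the pairing is minus `⟨memPrimitive θ, θ⟩`,
to which the dissipation inequality applies. -/
lemma inner_transport_re_le {ℓ : ℝ} {μ : MemoryKernel} {η : Memory ℓ μ}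
    (hη : η ∈ transportDomain ℓ μ) :
    (inner ℂ η (transport ℓ μ ⟨η, hη⟩)).re ≤ -(μ.rate / 2) * ‖η‖ ^ 2 := by
  obtain ⟨θ, hθ⟩ := hη.1
  rw [transport_eq hη hθ, inner_neg_right, Complex.neg_re]
  have := Memory.rate_mul_norm_sq_le θ
  rw [← eq_primitive_of_mem hη hθ] at this
  linarith

/-- After integration by parts, the elastic terms cancel against each other, the `γ` couplings
cancel between the mechanical and heat equations, and the flux term of each heat equation cancels
with the constant source in its memory equation through `inner_memMean`. Only the two transport
terms survive. -/
lemma inner_bgpAction_re_le {u : PhaseSpace S} (h : InDomain u) :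
    (inner ℂ u (bgpAction u h)).re ≤
      -(S.ϖ * S.μ.rate / 2) * ‖u.η‖ ^ 2 - (S.ϖ * S.ν.rate / 2) * ‖u.ζ‖ ^ 2 := by
  have hρ₁ : (S.ρ₁ : ℂ) ≠ 0 := by exact_mod_cast S.ρ₁_pos.ne'
  have hρ₂ : (S.ρ₂ : ℂ) ≠ 0 := by exact_mod_cast S.ρ₂_pos.ne'
  have hρ₃ : (S.ρ₃ : ℂ) ≠ 0 := by exact_mod_cast S.ρ₃_pos.ne'
  have i₁ := inner_weakDeriv_right h.Φ (hasWeakDeriv_weakDeriv h.shear_mem)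
  have i₂ := inner_weakDeriv_right h.ψ_x (hasWeakDeriv_weakDeriv h.Ψ)
  have i₃ := inner_weakDeriv_right h.axial_mem (hasWeakDeriv_weakDeriv h.W)
  have i₄ := inner_weakDeriv_right h.θ (hasWeakDeriv_weakDeriv h.Ψ)
  have i₅ := inner_weakDeriv_right h.ξ (hasWeakDeriv_weakDeriv h.W)
  have i₆ := inner_weakDeriv h.θ (hasWeakDeriv_weakDeriv h.η_mean.2)
  have i₇ := inner_weakDeriv h.ξ (hasWeakDeriv_weakDeriv h.ζ_mean.2)
  have j₆ := inner_memMean u.η (H10.mk u.θ h.θ)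
  have j₇ := inner_memMean u.ζ (H10.mk u.ξ h.ξ)
  change inner ℂ (weakDeriv u.θ) (memMean S.μ u.η).grad = _ at j₆
  change _ = -inner ℂ u.θ (weakDeriv (memMean S.μ u.η).grad) at i₆
  change inner ℂ (weakDeriv u.θ) (memMean S.μ u.η).grad = _ at i₆
  change inner ℂ (weakDeriv u.ξ) (memMean S.ν u.ζ).grad = _ at j₇
  change _ = -inner ℂ u.ξ (weakDeriv (memMean S.ν u.ζ).grad) at i₇
  change inner ℂ (weakDeriv u.ξ) (memMean S.ν u.ζ).grad = _ at i₇
  have hη := mul_le_mul_of_nonneg_left (inner_transport_re_le h.η) S.ϖ_pos.le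
  have hζ := mul_le_mul_of_nonneg_left (inner_transport_re_le h.ζ) S.ϖ_pos.le
  -- The displacement entries of `bgpAction u h` are the velocities, so the energy product involves
  -- the strains of the velocities.
  have expand : inner ℂ u (bgpAction u h) =
      S.k * inner ℂ (shear S u) (weakDeriv u.Φ + (u.Ψ : L2 S.ℓ) + (S.l : ℂ) • (u.W : L2 S.ℓ)) +
      S.ρ₁ * inner ℂ u.Φ ((S.k / S.ρ₁ : ℂ) • weakDeriv (shear S u) +
        (S.l * S.k₀ / S.ρ₁ : ℂ) • axial S u - (S.l * S.γ / S.ρ₁ : ℂ) • u.ξ) +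
      S.b * inner ℂ (gradStar S.ℓ u.ψ) (weakDeriv (u.Ψ : L2 S.ℓ)) +
      S.ρ₂ * inner ℂ (u.Ψ : L2 S.ℓ) ((S.b / S.ρ₂ : ℂ) • weakDeriv (gradStar S.ℓ u.ψ) -
        (S.k / S.ρ₂ : ℂ) • shear S u - (S.γ / S.ρ₂ : ℂ) • weakDeriv u.θ) +
      S.k₀ * inner ℂ (axial S u) (weakDeriv (u.W : L2 S.ℓ) - (S.l : ℂ) • u.Φ) +
      S.ρ₁ * inner ℂ (u.W : L2 S.ℓ) ((S.k₀ / S.ρ₁ : ℂ) • weakDeriv (axial S u) -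
        (S.l * S.k / S.ρ₁ : ℂ) • shear S u - (S.γ / S.ρ₁ : ℂ) • weakDeriv u.ξ) +
      S.ρ₃ * inner ℂ u.θ ((S.ϖ / S.ρ₃ : ℂ) • weakDeriv (memMean S.μ u.η).grad -
        (S.γ / S.ρ₃ : ℂ) • weakDeriv (u.Ψ : L2 S.ℓ)) +
      S.ϖ * inner ℂ u.η (transport S.ℓ S.μ ⟨u.η, h.η⟩ +
        Lp.const 2 S.μ.measure (H10.mk u.θ h.θ)) +
      S.ρ₃ * inner ℂ u.ξ ((S.ϖ / S.ρ₃ : ℂ) • weakDeriv (memMean S.ν u.ζ).grad -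
        (S.γ / S.ρ₃ : ℂ) • (weakDeriv (u.W : L2 S.ℓ) - (S.l : ℂ) • u.Φ)) +
      S.ϖ * inner ℂ u.ζ (transport S.ℓ S.ν ⟨u.ζ, h.ζ⟩ +
        Lp.const 2 S.ν.measure (H10.mk u.ξ h.ξ)) := rfl
  have e := congrArg Complex.re expand
  have cancel : ∀ (ρ c : ℝ) (z : ℂ), (ρ : ℂ) ≠ 0 → (ρ : ℂ) * ((c / ρ : ℂ) * z) = c * z := by
    intro ρ c z hρ
    field_simp
  have cancel' : ∀ (ρ c d : ℝ) (z : ℂ), (ρ : ℂ) ≠ 0 →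
      (ρ : ℂ) * ((c * d / ρ : ℂ) * z) = c * (d * z) := by
    intro ρ c d z hρ
    field_simp
  simp only [inner_add_right, inner_sub_right, inner_smul_right, mul_add, mul_sub,
    cancel _ _ _ hρ₁, cancel _ _ _ hρ₂, cancel _ _ _ hρ₃, cancel' _ _ _ _ hρ₁,
    Complex.add_re, Complex.sub_re, Complex.re_ofReal_mul] at e
  have re : ∀ {E : Type} [NormedAddCommGroup E] [InnerProductSpace ℂ E] (x y : E),
      (inner ℂ x y).re = (inner ℂ y x).re := fun x y => inner_re_symm (𝕜 := ℂ) x y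
  have re' : ∀ {z w : ℂ}, z = -w → z.re = -w.re := fun h => by rw [h, Complex.neg_re]
  have i₁' := re' i₁
  have i₂' := re' i₂
  have i₃' := re' i₃
  have i₄' := re' i₄
  have i₅' := re' i₅
  have i₆' := re' i₆
  have i₇' := re' i₇
  have j₆' := congrArg Complex.re j₆
  have j₇' := congrArg Complex.re j₇
  rw [e]
  rw [re u.Φ (weakDeriv (shear S u)), i₁', re _ (u.Ψ : L2 S.ℓ), re _ (u.W : L2 S.ℓ),
    re u.Φ (axial S u), re u.ξ u.Φ, i₂', re (gradStar S.ℓ u.ψ), i₄', i₃',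
    re (axial S u) (weakDeriv _), i₅', re u.θ (weakDeriv (u.Ψ : L2 S.ℓ)),
    re u.ξ (weakDeriv (u.W : L2 S.ℓ)), re u.η (Lp.const _ _ _), re u.ζ (Lp.const _ _ _),
    ← j₆', ← j₇', i₆', i₇']
  linarith

end dissipation

open Asymptotics

/-! ### Bounded and vanishing sequences -/

section sequences

/-- A sequence tending to zero. -/
abbrev IsNull {E : Type*} [NormedAddCommGroup E] (x : ℕ → E) : Prop :=
  x =o[atTop] (fun _ => (1 : ℝ))

/-- A bounded sequence. -/
abbrev IsBdd {E : Type*} [NormedAddCommGroup E] (x : ℕ → E) : Prop :=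
  x =O[atTop] (fun _ => (1 : ℝ))

variable {E F : Type*} [NormedAddCommGroup E] {x y : ℕ → E}

lemma IsNull.add (hx : IsNull x) (hy : IsNull y) : IsNull (fun n => x n + y n) :=
  IsLittleO.add hx hy

lemma IsNull.sub (hx : IsNull x) (hy : IsNull y) : IsNull (fun n => x n - y n) :=
  IsLittleO.sub hx hy

lemma IsNull.neg (hx : IsNull x) : IsNull (fun n => -x n) := hx.neg_left

lemma IsNull.isBdd (hx : IsNull x) : IsBdd x := hx.isBigO

lemma IsBdd.add (hx : IsBdd x) (hy : IsBdd y) : IsBdd (fun n => x n + y n) :=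
  IsBigO.add hx hy

lemma IsBdd.sub (hx : IsBdd x) (hy : IsBdd y) : IsBdd (fun n => x n - y n) :=
  IsBigO.sub hx hy

lemma IsNull.of_norm_sq (h : IsNull (fun n => ‖x n‖ ^ 2)) : IsNull x := by
  rw [IsNull, isLittleO_one_iff] at *
  rw [tendsto_zero_iff_norm_tendsto_zero]
  simpa using h.sqrt

variable [InnerProductSpace ℂ E] [NormedAddCommGroup F] [InnerProductSpace ℂ F]

lemma IsNull.smul (c : ℂ) (h : IsNull x) : IsNull (fun n => c • x n) := h.const_smul_left c

lemma IsBdd.smul (c : ℂ) (h : IsBdd x) : IsBdd (fun n => c • x n) := h.const_smul_left c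

lemma IsNull.of_smul {c : ℂ} (hc : c ≠ 0) (h : IsNull (fun n => c • x n)) : IsNull x :=
  (isLittleO_const_smul_left hc).1 h

lemma IsBdd.of_smul {c : ℂ} (hc : c ≠ 0) (h : IsBdd (fun n => c • x n)) : IsBdd x :=
  (isBigO_const_smul_left hc).1 h

lemma IsNull.map (T : E →L[ℂ] F) (h : IsNull x) : IsNull (fun n => T (x n)) :=
  (T.isBigO_comp x atTop).trans_isLittleO h

lemma IsBdd.map (T : E →L[ℂ] F) (h : IsBdd x) : IsBdd (fun n => T (x n)) :=
  (T.isBigO_comp x atTop).trans h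

lemma IsNull.inner_left (hx : IsNull x) (hy : IsBdd y) :
    IsNull (fun n => inner ℂ (x n) (y n)) := by
  have h := hx.norm_left.mul_isBigO hy.norm_left
  simp only [mul_one] at h
  exact (IsBigO.of_norm_le fun n => norm_inner_le_norm _ _).trans_isLittleO h

lemma IsNull.inner_right (hx : IsBdd x) (hy : IsNull y) :
    IsNull (fun n => inner ℂ (x n) (y n)) := by
  have h := hx.norm_left.mul_isLittleO hy.norm_left
  simp only [mul_one] at h
  exact (IsBigO.of_norm_le fun n => norm_inner_le_norm _ _).trans_isLittleO h

lemma IsNull.of_inner_self (h : IsNull (fun n => inner ℂ (x n) (x n))) : IsNull x := by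
  refine IsNull.of_norm_sq (h.norm_left.congr_left fun n => ?_)
  rw [inner_self_eq_norm_sq_to_K]
  simp

end sequences

/-! ### The resolvent equation, component by component -/

section residual

variable {S : BGPData}

/-- The vector `z u - A u`. -/
def residual (z : ℂ) (u : PhaseSpace S) (h : InDomain u) : PhaseSpace S := z • u - bgpAction u h

variable {z : ℂ} {u : PhaseSpace S} (h : InDomain u)

lemma residual_φ : u.Φ = z • u.φ.toL2 - (residual z u h).φ.toL2 := by
  change u.Φ = z • u.φ.toL2 - (z • u.φ.toL2 - u.Φ)
  abel

lemma residual_ψ : (u.Ψ : L2 S.ℓ) = z • (u.ψ : L2 S.ℓ) - (residual z u h).ψ := by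
  change (u.Ψ : L2 S.ℓ) = z • (u.ψ : L2 S.ℓ) - (z • (u.ψ : L2 S.ℓ) - u.Ψ)
  abel

lemma residual_w : (u.W : L2 S.ℓ) = z • (u.w : L2 S.ℓ) - (residual z u h).w := by
  change (u.W : L2 S.ℓ) = z • (u.w : L2 S.ℓ) - (z • (u.w : L2 S.ℓ) - u.W)
  abel

/-- The displacement entries of the action are velocities and `axial` is linear. This turns the
source term of the second heat equation into `z • axial` up to a residual. -/
lemma residual_axial : weakDeriv (u.W : L2 S.ℓ) - (S.l : ℂ) • u.Φ =
    z • axial S u - axial S (residual z u h) := by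
  rw [residual, map_sub, map_smul, sub_sub_cancel]
  rfl

lemma residual_Φ : (S.k : ℂ) • weakDeriv (shear S u) + (S.l * S.k₀ : ℂ) • axial S u =
    (S.ρ₁ : ℂ) • (z • u.Φ - (residual z u h).Φ) + (S.l * S.γ : ℂ) • u.ξ := by
  have hρ₁ : (S.ρ₁ : ℂ) ≠ 0 := by exact_mod_cast S.ρ₁_pos.ne'
  change _ = (S.ρ₁ : ℂ) • (z • u.Φ - (z • u.Φ - ((S.k / S.ρ₁ : ℂ) • weakDeriv (shear S u) +
    (S.l * S.k₀ / S.ρ₁ : ℂ) • axial S u - (S.l * S.γ / S.ρ₁ : ℂ) • u.ξ))) + _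
  match_scalars <;> field_simp <;> ring

lemma residual_Ψ : (S.b : ℂ) • weakDeriv (gradStar S.ℓ u.ψ) - (S.k : ℂ) • shear S u =
    (S.ρ₂ : ℂ) • (z • (u.Ψ : L2 S.ℓ) - (residual z u h).Ψ) + (S.γ : ℂ) • weakDeriv u.θ := by
  have hρ₂ : (S.ρ₂ : ℂ) ≠ 0 := by exact_mod_cast S.ρ₂_pos.ne'
  change _ = (S.ρ₂ : ℂ) • (z • (u.Ψ : L2 S.ℓ) - (z • (u.Ψ : L2 S.ℓ) -
    ((S.b / S.ρ₂ : ℂ) • weakDeriv (gradStar S.ℓ u.ψ) - (S.k / S.ρ₂ : ℂ) • shear S u -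
      (S.γ / S.ρ₂ : ℂ) • weakDeriv u.θ))) + _
  match_scalars <;> field_simp <;> ring

lemma residual_W : (S.k₀ : ℂ) • weakDeriv (axial S u) - (S.l * S.k : ℂ) • shear S u =
    (S.ρ₁ : ℂ) • (z • (u.W : L2 S.ℓ) - (residual z u h).W) + (S.γ : ℂ) • weakDeriv u.ξ := by
  have hρ₁ : (S.ρ₁ : ℂ) ≠ 0 := by exact_mod_cast S.ρ₁_pos.ne'
  change _ = (S.ρ₁ : ℂ) • (z • (u.W : L2 S.ℓ) - (z • (u.W : L2 S.ℓ) -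
    ((S.k₀ / S.ρ₁ : ℂ) • weakDeriv (axial S u) - (S.l * S.k / S.ρ₁ : ℂ) • shear S u -
      (S.γ / S.ρ₁ : ℂ) • weakDeriv u.ξ))) + _
  match_scalars <;> field_simp <;> ring

lemma residual_θ : (S.ϖ : ℂ) • weakDeriv (memMean S.μ u.η).grad -
    (S.γ : ℂ) • weakDeriv (u.Ψ : L2 S.ℓ) = (S.ρ₃ : ℂ) • (z • u.θ - (residual z u h).θ) := by
  have hρ₃ : (S.ρ₃ : ℂ) ≠ 0 := by exact_mod_cast S.ρ₃_pos.ne'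
  change _ = (S.ρ₃ : ℂ) • (z • u.θ - (z • u.θ - ((S.ϖ / S.ρ₃ : ℂ) •
    weakDeriv (memMean S.μ u.η).grad - (S.γ / S.ρ₃ : ℂ) • weakDeriv (u.Ψ : L2 S.ℓ))))
  match_scalars <;> field_simp
  ring

lemma residual_ξ : (S.ϖ : ℂ) • weakDeriv (memMean S.ν u.ζ).grad -
    (S.γ : ℂ) • (weakDeriv (u.W : L2 S.ℓ) - (S.l : ℂ) • u.Φ) =
    (S.ρ₃ : ℂ) • (z • u.ξ - (residual z u h).ξ) := by
  have hρ₃ : (S.ρ₃ : ℂ) ≠ 0 := by exact_mod_cast S.ρ₃_pos.ne'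
  change _ = (S.ρ₃ : ℂ) • (z • u.ξ - (z • u.ξ - ((S.ϖ / S.ρ₃ : ℂ) •
    weakDeriv (memMean S.ν u.ζ).grad - (S.γ / S.ρ₃ : ℂ) •
      (weakDeriv (u.W : L2 S.ℓ) - (S.l : ℂ) • u.Φ))))
  match_scalars <;> field_simp
  ring

/-- For `z` imaginary, `z ⟨u, u⟩` has no real part, so the real part of the pairing is exactly the
dissipation. -/
lemma memory_norm_sq_le (hz : z.re = 0) : S.ϖ * S.μ.rate / 2 * ‖u.η‖ ^ 2 +
    S.ϖ * S.ν.rate / 2 * ‖u.ζ‖ ^ 2 ≤ ‖inner ℂ u (residual z u h)‖ := by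
  have h1 := inner_bgpAction_re_le h
  have h2 := Complex.re_le_norm (inner ℂ u (residual z u h))
  have h3 : (inner ℂ u (residual z u h)).re = -(inner ℂ u (bgpAction u h)).re := by
    have h4 : (inner ℂ u u).im = 0 := inner_self_im (𝕜 := ℂ) u
    rw [residual, inner_sub_right, inner_smul_right, Complex.sub_re, Complex.mul_re, hz, h4]
    ring
  linarith

end residual

/-! ### The a priori estimate -/

section estimate

lemma IsNull.of_weakDeriv {ℓ : ℝ} (hℓ : 0 < ℓ) {x y : ℕ → L2 ℓ} (hx : ∀ n, x n ∈ L2star ℓ)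
    (hxy : ∀ n, HasWeakDeriv ℓ (x n) (y n)) (hy : IsNull y) : IsNull x := by
  obtain ⟨C, hC⟩ := exists_norm_le_weakDeriv hℓ
  exact (IsBigO.of_bound C (Eventually.of_forall fun n => hC _ _ (hx n) (hxy n))).trans_isLittleO hy

/-- The memory equation inverts to `η = memPrimitive (Θ + g - z η)`. Averaging isolates `moment •
Θ`, every other term being a bounded operator applied to a null sequence. The convergence is in
`H¹₀`, so gradients vanish too. -/
lemma IsNull.of_memory {ℓ : ℝ} {μ : MemoryKernel} {z : ℂ} {η g : ℕ → Memory ℓ μ} {Θ : ℕ → H10 ℓ}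
    (hη : ∀ n, η n ∈ transportDomain ℓ μ)
    (e : ∀ n, g n = z • η n - (transport ℓ μ ⟨η n, hη n⟩ + Lp.const 2 μ.measure (Θ n)))
    (h₁ : IsNull η) (h₂ : IsNull g) : IsNull Θ := by
  have hm : (μ.moment : ℂ) ≠ 0 := by exact_mod_cast μ.moment_pos.ne'
  have key : ∀ n, (μ.moment : ℂ) • Θ n =
      memMeanL ℓ μ (η n) - memMeanL ℓ μ (memPrimitiveL ℓ μ (g n - z • η n)) := by
    intro n
    obtain ⟨θ, hθ⟩ := (hη n).1
    have h := e n
    rw [transport_eq (hη n) hθ] at h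
    have h3 : θ = Lp.const 2 μ.measure (Θ n) + (g n - z • η n) := by
      rw [h]; abel
    have h4 := eq_primitive_of_mem (hη n) hθ
    have h5 : η n = memPrimitive (Lp.const 2 μ.measure (Θ n)) +
        memPrimitive (g n - z • η n) := by
      rw [h3] at h4
      exact h4.trans (map_add (memPrimitiveL ℓ μ) _ _)
    rw [eq_sub_iff_add_eq]
    conv_rhs => rw [h5]
    rw [map_add, ← memMean_primitive_const]
    rfl
  refine IsNull.of_smul hm (IsLittleO.congr_left ?_ fun n => (key n).symm)
  have h₃ : IsNull (fun n => g n - z • η n) := h₂.sub (h₁.smul z)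
  exact (h₁.map _).sub ((h₃.map (memPrimitiveL ℓ μ)).map _)

variable {S : BGPData} {z : ℂ} {u : ℕ → PhaseSpace S} (h : ∀ n, InDomain (u n))

lemma memory_null (hz : z.re = 0) (hu : IsBdd u)
    (hf : IsNull (fun n => residual z (u n) (h n))) :
    IsNull (fun n => (u n).η) ∧ IsNull (fun n => (u n).ζ) := by
  have hi := IsNull.inner_right hu hf
  have p : 0 < S.ϖ * S.μ.rate / 2 := by have := S.ϖ_pos; have := S.μ.rate_pos; positivity
  have q : 0 < S.ϖ * S.ν.rate / 2 := by have := S.ϖ_pos; have := S.ν.rate_pos; positivity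
  have aux : ∀ (c : ℝ) (a : ℕ → ℝ), 0 < c →
      (∀ n, c * a n ^ 2 ≤ ‖inner ℂ (u n) (residual z (u n) (h n))‖) → IsNull (fun n => a n ^ 2) := by
    intro c a hc ha
    refine (IsBigO.of_bound c⁻¹ (Eventually.of_forall fun n => ?_)).trans_isLittleO hi
    rw [Real.norm_of_nonneg (sq_nonneg _), inv_mul_eq_div, le_div_iff₀ hc, mul_comm]
    exact ha n
  refine ⟨IsNull.of_norm_sq (aux _ _ p fun n => ?_), IsNull.of_norm_sq (aux _ _ q fun n => ?_)⟩
  · have := memory_norm_sq_le (h n) hz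
    have : 0 ≤ S.ϖ * S.ν.rate / 2 * ‖(u n).ζ‖ ^ 2 := by positivity
    linarith
  · have := memory_norm_sq_le (h n) hz
    have : 0 ≤ S.ϖ * S.μ.rate / 2 * ‖(u n).η‖ ^ 2 := by positivity
    linarith

lemma theta_null (hf : IsNull (fun n => residual z (u n) (h n)))
    (hη : IsNull (fun n => (u n).η)) :
    IsNull (fun n => (u n).θ) ∧ IsNull (fun n => weakDeriv (u n).θ) := by
  have hΘ : IsNull (fun n => H10.mk (u n).θ (h n).θ) :=
    IsNull.of_memory (fun n => (h n).η) (fun n => rfl) hη (hf.map (etaL S))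
  exact ⟨hΘ.map (H10.toL2L S.ℓ), hΘ.map (H10.gradIso S.ℓ).toContinuousLinearMap⟩

lemma xi_null (hf : IsNull (fun n => residual z (u n) (h n)))
    (hζ : IsNull (fun n => (u n).ζ)) :
    IsNull (fun n => (u n).ξ) ∧ IsNull (fun n => weakDeriv (u n).ξ) := by
  have hΘ : IsNull (fun n => H10.mk (u n).ξ (h n).ξ) :=
    IsNull.of_memory (fun n => (h n).ζ) (fun n => rfl) hζ (hf.map (zetaL S))
  exact ⟨hΘ.map (H10.toL2L S.ℓ), hΘ.map (H10.gradIso S.ℓ).toContinuousLinearMap⟩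

lemma mean_grad_null {ℓ : ℝ} {μ : MemoryKernel} {η : ℕ → Memory ℓ μ} (hη : IsNull η) :
    IsNull (fun n => (memMean μ (η n)).grad) :=
  (hη.map (memMeanL ℓ μ)).map (H10.gradIso ℓ).toContinuousLinearMap

/-- By the first heat equation, the derivative of `ϖ p_x - γ Ψ`, with `p` the memory mean, is a null
sequence. This function has zero mean, so Poincaré–Wirtinger makes it null. Since `p_x` is null, so
is `Ψ`. -/
lemma Psi_null (hf : IsNull (fun n => residual z (u n) (h n)))
    (hη : IsNull (fun n => (u n).η)) (hθ : IsNull (fun n => (u n).θ)) :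
    IsNull (fun n => ((u n).Ψ : L2 S.ℓ)) := by
  have hγ : (S.γ : ℂ) ≠ 0 := by exact_mod_cast S.γ_pos.ne'
  have hP : IsNull (fun n => (S.ϖ : ℂ) • (memMean S.μ (u n).η).grad +
      -(S.γ : ℂ) • ((u n).Ψ : L2 S.ℓ)) := by
    refine IsNull.of_weakDeriv (y := fun n => (S.ϖ : ℂ) • weakDeriv (memMean S.μ (u n).η).grad +
      -(S.γ : ℂ) • weakDeriv ((u n).Ψ : L2 S.ℓ)) S.ℓ_pos (fun n => ?_) (fun n => ?_) ?_
    · exact add_mem (Submodule.smul_mem _ _ (weakDeriv_mem_L2star (H10.toL2_mem _)))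
        (Submodule.smul_mem _ _ (u n).Ψ.2)
    · exact ((hasWeakDeriv_weakDeriv (h n).η_mean.2).smul _).add
        ((hasWeakDeriv_weakDeriv (h n).Ψ).smul _)
    · refine IsLittleO.congr_left (f₁ := fun n => (S.ρ₃ : ℂ) • (z • (u n).θ -
        (residual z (u n) (h n)).θ)) ?_ fun n => ?_
      · exact IsNull.smul _ ((hθ.smul z).sub (hf.map (thetaL S)))
      · rw [← residual_θ, neg_smul, sub_eq_add_neg]
  refine IsNull.of_smul hγ ?_
  refine (((mean_grad_null hη).smul (S.ϖ : ℂ)).sub hP).congr_left fun n => ?_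
  module

/-- The vector keeping only the displacement entries has energy given by the strains; `phiwL`
transfers its convergence to `φ` and `w`. -/
lemma displacement_null (hS : IsNull (fun n => shear S (u n)))
    (hψ : IsNull (fun n => gradStar S.ℓ (u n).ψ)) (hN : IsNull (fun n => axial S (u n))) :
    IsNull (fun n => (u n).φ.toL2) ∧ IsNull (fun n => ((u n).w : L2 S.ℓ)) := by
  let v : ℕ → PhaseSpace S := fun n => ⟨(u n).φ, 0, (u n).ψ, 0, (u n).w, 0, 0, 0, 0, 0⟩
  have hv : IsNull v := by
    rw [IsNull, isLittleO_one_iff] at *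
    exact PhaseSpace.tendsto_zero hS tendsto_const_nhds hψ tendsto_const_nhds hN
      tendsto_const_nhds tendsto_const_nhds tendsto_const_nhds tendsto_const_nhds
      tendsto_const_nhds
  have h1 : IsNull (fun n => (u n).φ) :=
    hv.map ((ContinuousLinearMap.fst ℂ (H10 S.ℓ) (L2 S.ℓ)).comp (phiwL S))
  exact ⟨h1.map (H10.toL2L S.ℓ),
    hv.map ((ContinuousLinearMap.snd ℂ (H10 S.ℓ) (L2 S.ℓ)).comp (phiwL S))⟩

/-- Away from `z = 0`, the strains vanish along with the thermal components. -/
lemma strain_null (hz : z ≠ 0) (hu : IsBdd u) (hf : IsNull (fun n => residual z (u n) (h n)))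
    (hζ : IsNull (fun n => (u n).ζ)) (hθ : IsNull (fun n => weakDeriv (u n).θ))
    (hξ : IsNull (fun n => (u n).ξ)) (hξ' : IsNull (fun n => weakDeriv (u n).ξ))
    (hΨ : IsNull (fun n => ((u n).Ψ : L2 S.ℓ))) :
    IsNull (fun n => shear S (u n)) ∧ IsNull (fun n => gradStar S.ℓ (u n).ψ) ∧
      IsNull (fun n => axial S (u n)) := by
  have hk : (S.k : ℂ) ≠ 0 := by exact_mod_cast S.k_pos.ne'
  have hk₀ : (S.k₀ : ℂ) ≠ 0 := by exact_mod_cast S.k₀_pos.ne'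
  have hb : (S.b : ℂ) ≠ 0 := by exact_mod_cast S.b_pos.ne'
  have hγ : (S.γ : ℂ) ≠ 0 := by exact_mod_cast S.γ_pos.ne'
  have bS : IsBdd (fun n => shear S (u n)) := hu.map (shearL S)
  have bN : IsBdd (fun n => axial S (u n)) := hu.map (axialL S)
  have fΨ : IsNull (fun n => ((residual z (u n) (h n)).Ψ : L2 S.ℓ)) :=
    (hf.map (PsiL S)).map (L2star S.ℓ).subtypeL
  have fW : IsNull (fun n => ((residual z (u n) (h n)).W : L2 S.ℓ)) :=
    (hf.map (WL S)).map (L2star S.ℓ).subtypeL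
  have bW : IsBdd (fun n => ((u n).W : L2 S.ℓ)) := (hu.map (WL S)).map (L2star S.ℓ).subtypeL
  have hψ : IsNull (fun n => ((u n).ψ : L2 S.ℓ)) := by
    refine IsNull.of_smul hz ((hΨ.add (hf.map (psiL S))).congr_left fun n => ?_)
    rw [residual_ψ (h n)]
    exact sub_add_cancel _ _
  have e₁ : IsNull (fun n => (S.b : ℂ) • weakDeriv (gradStar S.ℓ (u n).ψ) -
      (S.k : ℂ) • shear S (u n)) := by
    simp only [residual_Ψ (h _) (z := z)]
    exact (((hΨ.smul z).sub fΨ).smul _).add (hθ.smul _)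
  have bψxx : IsBdd (fun n => weakDeriv (gradStar S.ℓ (u n).ψ)) := by
    refine IsBdd.of_smul hb ((e₁.isBdd.add (bS.smul (S.k : ℂ))).congr_left fun n => ?_)
    exact sub_add_cancel _ _
  -- Interpolation: `‖ψ_x‖² = -⟨ψ_xx, ψ⟩`, with `ψ_xx` bounded and `ψ` null.
  have hψx : IsNull (fun n => gradStar S.ℓ (u n).ψ) := by
    refine IsNull.of_inner_self ((IsNull.inner_right bψxx hψ).neg.congr_left fun n => ?_)
    rw [inner_weakDeriv (h n).ψ_x (H1star.hasWeakDeriv (u n).ψ), neg_neg]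
  have bSx : IsBdd (fun n => weakDeriv (shear S (u n))) := by
    refine IsBdd.of_smul hk (IsBigO.congr_left (f₁ := fun n => (S.ρ₁ : ℂ) • (z • (u n).Φ -
      (residual z (u n) (h n)).Φ) + (S.l * S.γ : ℂ) • (u n).ξ -
      (S.l * S.k₀ : ℂ) • axial S (u n)) ?_ fun n => ?_)
    · exact (((((hu.map (PhiL S)).smul z).sub (hf.map (PhiL S)).isBdd).smul _).add
        (hξ.smul _).isBdd).sub (bN.smul _)
    · rw [← residual_Φ, add_sub_cancel_right]
  have bNx : IsBdd (fun n => weakDeriv (axial S (u n))) := by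
    refine IsBdd.of_smul hk₀ (IsBigO.congr_left (f₁ := fun n => (S.ρ₁ : ℂ) • (z • ((u n).W : L2 S.ℓ)
      - (residual z (u n) (h n)).W) + (S.γ : ℂ) • weakDeriv (u n).ξ +
      (S.l * S.k : ℂ) • shear S (u n)) ?_ fun n => ?_)
    · exact ((((bW.smul z).sub fW.isBdd).smul _).add (hξ'.smul _).isBdd).add (bS.smul _)
    · rw [← residual_W, sub_add_cancel]
  -- Pairing the rotation equation with the shear leaves `k ‖shear‖²` and `b ⟨shear, ψ_xx⟩ = -b
  -- ⟨shear_x, ψ_x⟩`. The latter is null since `shear_x` is bounded.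
  have hS : IsNull (fun n => shear S (u n)) := by
    have h₁ := IsNull.inner_right bSx hψx
    have h₂ := IsNull.inner_right bS e₁
    refine IsNull.of_inner_self (IsNull.of_smul hk
      (((h₁.smul (S.b : ℂ)).add h₂).neg.congr_left fun n => ?_))
    rw [inner_sub_right, inner_smul_right, inner_smul_right,
      inner_weakDeriv_right (h n).ψ_x (hasWeakDeriv_weakDeriv (h n).shear_mem), smul_eq_mul,
      smul_eq_mul]
    ring
  -- The second heat equation reads `γ z axial = ϖ p_xx` plus a null term, with `p` the memory mean
  -- of `ζ`. Pairing with `axial ∈ H¹₀` moves one derivative from `p_xx` onto `axial`, where it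
  -- stays bounded, while `p_x` is null.
  have hN : IsNull (fun n => axial S (u n)) := by
    have h₂ : IsNull (fun n => (S.γ : ℂ) • axial S (residual z (u n) (h n)) -
        (S.ρ₃ : ℂ) • (z • (u n).ξ - (residual z (u n) (h n)).ξ)) :=
      ((hf.map (axialL S)).smul _).sub (((hξ.smul z).sub (hf.map (xiL S))).smul _)
    have key : ∀ n, (S.γ * z : ℂ) • axial S (u n) = (S.ϖ : ℂ) • weakDeriv (memMean S.ν (u n).ζ).grad
        + ((S.γ : ℂ) • axial S (residual z (u n) (h n)) -
          (S.ρ₃ : ℂ) • (z • (u n).ξ - (residual z (u n) (h n)).ξ)) := by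
      intro n
      rw [← residual_ξ, residual_axial (h n) (z := z)]
      module
    have h₃ := IsNull.inner_right bN h₂
    have h₁' := IsNull.inner_right bNx (mean_grad_null hζ)
    refine IsNull.of_inner_self (IsNull.of_smul (mul_ne_zero hγ hz)
      ((h₃.sub (h₁'.smul (S.ϖ : ℂ))).congr_left fun n => ?_))
    have i : inner ℂ (weakDeriv (axial S (u n))) (memMean S.ν (u n).ζ).grad =
        -inner ℂ (axial S (u n)) (weakDeriv (memMean S.ν (u n).ζ).grad) :=
      inner_weakDeriv (h n).axial_mem (hasWeakDeriv_weakDeriv (h n).ζ_mean.2)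
    rw [smul_eq_mul, smul_eq_mul, ← inner_smul_right _ _ (S.γ * z : ℂ), key n, inner_add_right,
      inner_smul_right, i]
    ring
  exact ⟨hS, hψx, hN⟩

/-- The strains vanish along with the velocities and the thermal components. -/
lemma strain_null_of_velocity (hu : IsBdd u) (hf : IsNull (fun n => residual z (u n) (h n)))
    (hθ : IsNull (fun n => weakDeriv (u n).θ))
    (hξ : IsNull (fun n => (u n).ξ)) (hξ' : IsNull (fun n => weakDeriv (u n).ξ))
    (hΦ : IsNull (fun n => (u n).Φ))
    (hΨ : IsNull (fun n => ((u n).Ψ : L2 S.ℓ))) (hW : IsNull (fun n => ((u n).W : L2 S.ℓ))) :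
    IsNull (fun n => shear S (u n)) ∧ IsNull (fun n => gradStar S.ℓ (u n).ψ) ∧
      IsNull (fun n => axial S (u n)) := by
  have fΨ : IsNull (fun n => ((residual z (u n) (h n)).Ψ : L2 S.ℓ)) :=
    (hf.map (PsiL S)).map (L2star S.ℓ).subtypeL
  have fW : IsNull (fun n => ((residual z (u n) (h n)).W : L2 S.ℓ)) :=
    (hf.map (WL S)).map (L2star S.ℓ).subtypeL
  have e₁ : IsNull (fun n => (S.k : ℂ) • weakDeriv (shear S (u n)) +
      (S.l * S.k₀ : ℂ) • axial S (u n)) := by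
    simp only [residual_Φ (h _) (z := z)]
    exact (((hΦ.smul z).sub (hf.map (PhiL S))).smul _).add (hξ.smul _)
  have e₂ : IsNull (fun n => (S.b : ℂ) • weakDeriv (gradStar S.ℓ (u n).ψ) -
      (S.k : ℂ) • shear S (u n)) := by
    simp only [residual_Ψ (h _) (z := z)]
    exact (((hΨ.smul z).sub fΨ).smul _).add (hθ.smul _)
  have e₃ : IsNull (fun n => (S.k₀ : ℂ) • weakDeriv (axial S (u n)) -
      (S.l * S.k : ℂ) • shear S (u n)) := by
    simp only [residual_W (h _) (z := z)]
    exact (((hW.smul z).sub fW).smul _).add (hξ'.smul _)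
  have bφ : IsBdd (fun n => (u n).φ.toL2) := (hu.map
    ((ContinuousLinearMap.fst ℂ (H10 S.ℓ) (L2 S.ℓ)).comp (phiwL S))).map (H10.toL2L S.ℓ)
  have bw : IsBdd (fun n => ((u n).w : L2 S.ℓ)) :=
    hu.map ((ContinuousLinearMap.snd ℂ (H10 S.ℓ) (L2 S.ℓ)).comp (phiwL S))
  have bψ : IsBdd (fun n => ((u n).ψ : L2 S.ℓ)) := hu.map (psiL S)
  -- Virtual work: testing the three elastic operators with `φ, ψ, w` returns minus the elastic
  -- energy. The operators are null and the displacements bounded, so the energy vanishes.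
  have energy : ∀ n, (S.k * inner ℂ (shear S (u n)) (shear S (u n)) +
      S.b * inner ℂ (gradStar S.ℓ (u n).ψ) (gradStar S.ℓ (u n).ψ) +
      S.k₀ * inner ℂ (axial S (u n)) (axial S (u n)) : ℂ) =
      -(inner ℂ ((S.k : ℂ) • weakDeriv (shear S (u n)) + (S.l * S.k₀ : ℂ) • axial S (u n))
        (u n).φ.toL2 +
      inner ℂ ((S.b : ℂ) • weakDeriv (gradStar S.ℓ (u n).ψ) - (S.k : ℂ) • shear S (u n))
        ((u n).ψ : L2 S.ℓ) +
      inner ℂ ((S.k₀ : ℂ) • weakDeriv (axial S (u n)) - (S.l * S.k : ℂ) • shear S (u n))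
        ((u n).w : L2 S.ℓ)) := by
    intro n
    have i₁ := inner_weakDeriv_right (u n).φ.toL2_mem (hasWeakDeriv_weakDeriv (h n).shear_mem)
    have i₂ := inner_weakDeriv (h n).ψ_x (H1star.hasWeakDeriv (u n).ψ)
    have i₃ := inner_weakDeriv (h n).axial_mem (H1star.hasWeakDeriv (u n).w)
    have d₁ : inner ℂ (shear S (u n)) (shear S (u n)) = inner ℂ (shear S (u n))
      (weakDeriv (u n).φ.toL2 + ((u n).ψ : L2 S.ℓ) + (S.l : ℂ) • ((u n).w : L2 S.ℓ)) := rfl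
    have d₂ : inner ℂ (axial S (u n)) (axial S (u n)) = inner ℂ (axial S (u n))
      (gradStar S.ℓ (u n).w - (S.l : ℂ) • (u n).φ.toL2) := rfl
    rw [inner_add_right, inner_add_right, inner_smul_right, i₁] at d₁
    rw [inner_sub_right, inner_smul_right] at d₂
    simp only [inner_add_left, inner_sub_left, inner_smul_left, map_mul, Complex.conj_ofReal, d₁,
      d₂, i₂, i₃]
    ring
  have hE := (((IsNull.inner_left e₁ bφ).add (IsNull.inner_left e₂ bψ)).add
    (IsNull.inner_left e₃ bw)).neg
  have bound : ∀ n, S.k * ‖shear S (u n)‖ ^ 2 + S.b * ‖gradStar S.ℓ (u n).ψ‖ ^ 2 +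
      S.k₀ * ‖axial S (u n)‖ ^ 2 ≤
      ‖(S.k * inner ℂ (shear S (u n)) (shear S (u n)) +
      S.b * inner ℂ (gradStar S.ℓ (u n).ψ) (gradStar S.ℓ (u n).ψ) +
      S.k₀ * inner ℂ (axial S (u n)) (axial S (u n)) : ℂ)‖ := by
    intro n
    refine le_of_eq_of_le ?_ (Complex.re_le_norm _)
    simp only [Complex.add_re, Complex.re_ofReal_mul, norm_sq_eq_re_inner (𝕜 := ℂ)]
    rfl
  have aux : ∀ (c : ℝ) (a : ℕ → ℝ), 0 < c →
      (∀ n, c * a n ^ 2 ≤ S.k * ‖shear S (u n)‖ ^ 2 + S.b * ‖gradStar S.ℓ (u n).ψ‖ ^ 2 +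
      S.k₀ * ‖axial S (u n)‖ ^ 2) → IsNull (fun n => a n ^ 2) := by
    intro c a hc ha
    refine (IsBigO.of_bound c⁻¹ (Eventually.of_forall fun n => ?_)).trans_isLittleO
      (hE.congr_left fun n => (energy n).symm)
    rw [Real.norm_of_nonneg (sq_nonneg _), inv_mul_eq_div, le_div_iff₀ hc, mul_comm]
    exact (ha n).trans (bound n)
  have h1 := S.k_pos
  have h2 := S.b_pos
  have h3 := S.k₀_pos
  have p₁ : ∀ n, 0 ≤ S.k * ‖shear S (u n)‖ ^ 2 := fun n => by positivity
  have p₂ : ∀ n, 0 ≤ S.b * ‖gradStar S.ℓ (u n).ψ‖ ^ 2 := fun n => by positivity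
  have p₃ : ∀ n, 0 ≤ S.k₀ * ‖axial S (u n)‖ ^ 2 := fun n => by positivity
  exact ⟨IsNull.of_norm_sq (aux _ _ h1 fun n => by linarith [p₂ n, p₃ n]),
    IsNull.of_norm_sq (aux _ _ h2 fun n => by linarith [p₁ n, p₃ n]),
    IsNull.of_norm_sq (aux _ _ h3 fun n => by linarith [p₂ n, p₁ n])⟩

/-- The order is memory, temperatures, `Ψ`, then a split on `z`. For `z = 0` the velocities are
minus residual components and give the strains; otherwise the strains come first and give the
velocities through `z`. -/
lemma null_of_residual (hz : z.re = 0) (hu : IsBdd u)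
    (hf : IsNull (fun n => residual z (u n) (h n))) : IsNull u := by
  obtain ⟨hη, hζ⟩ := memory_null h hz hu hf
  obtain ⟨hθ, hθ'⟩ := theta_null h hf hη
  obtain ⟨hξ, hξ'⟩ := xi_null h hf hζ
  have hΨ := Psi_null h hf hη hθ
  have fφ : IsNull (fun n => (residual z (u n) (h n)).φ.toL2) := (hf.map
    ((ContinuousLinearMap.fst ℂ (H10 S.ℓ) (L2 S.ℓ)).comp (phiwL S))).map (H10.toL2L S.ℓ)
  have fw : IsNull (fun n => ((residual z (u n) (h n)).w : L2 S.ℓ)) :=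
    hf.map ((ContinuousLinearMap.snd ℂ (H10 S.ℓ) (L2 S.ℓ)).comp (phiwL S))
  have zero : IsNull (fun _ : ℕ => (0 : L2 S.ℓ)) := isLittleO_zero _ _
  obtain ⟨hS, hψx, hN, hΦ, hW⟩ : IsNull (fun n => shear S (u n)) ∧
      IsNull (fun n => gradStar S.ℓ (u n).ψ) ∧ IsNull (fun n => axial S (u n)) ∧
      IsNull (fun n => (u n).Φ) ∧ IsNull (fun n => ((u n).W : L2 S.ℓ)) := by
    by_cases h0 : z = 0
    · subst h0
      have hΦ : IsNull (fun n => (u n).Φ) := (zero.sub fφ).congr_left fun n => by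
        rw [residual_φ (h n) (z := 0), zero_smul]
      have hW : IsNull (fun n => ((u n).W : L2 S.ℓ)) := (zero.sub fw).congr_left fun n => by
        rw [residual_w (h n) (z := 0), zero_smul]
      obtain ⟨hS, hψx, hN⟩ := strain_null_of_velocity h hu hf hθ' hξ hξ' hΦ hΨ hW
      exact ⟨hS, hψx, hN, hΦ, hW⟩
    · obtain ⟨hS, hψx, hN⟩ := strain_null h h0 hu hf hζ hθ' hξ hξ' hΨ
      obtain ⟨hφ, hw⟩ := displacement_null hS hψx hN
      exact ⟨hS, hψx, hN, ((hφ.smul z).sub fφ).congr_left fun n => (residual_φ (h n)).symm,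
        ((hw.smul z).sub fw).congr_left fun n => (residual_w (h n)).symm⟩
  rw [IsNull, isLittleO_one_iff] at *
  exact PhaseSpace.tendsto_zero hS hΦ hψx (tendsto_subtype_rng.2 hΨ) hN (tendsto_subtype_rng.2 hW)
    hθ hη hξ hζ

/-- `z - A` is bounded below for `z` on the imaginary axis. -/
lemma exists_norm_le_residual (S : BGPData) {z : ℂ} (hz : z.re = 0) :
    ∃ c > 0, ∀ (u : PhaseSpace S) (h : InDomain u), c * ‖u‖ ≤ ‖residual z u h‖ := by
  by_contra! H
  -- The lower bound fails for each constant `1 / (n + 1)`. The strict inequality excludes `u = 0`,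
  -- so the offending vector can be normalised by homogeneity of the residual.
  have : ∀ n : ℕ, ∃ (u : PhaseSpace S) (h : InDomain u), ‖u‖ = 1 ∧
      ‖residual z u h‖ ≤ ((n : ℝ) + 1)⁻¹ := by
    intro n
    obtain ⟨u, h, hu⟩ := H ((n : ℝ) + 1)⁻¹ (by positivity)
    have hu0 : 0 < ‖u‖ := by
      rw [norm_pos_iff]
      rintro rfl
      simp at hu
      exact absurd hu (norm_nonneg _).not_gt
    let a : ℂ := ((‖u‖⁻¹ : ℝ) : ℂ)
    have ha : ‖a‖ = ‖u‖⁻¹ := by simp [a]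
    have h' : InDomain (a • u) := (bgpDomain S).smul_mem a h
    have e : residual z (a • u) h' = a • residual z u h := by
      rw [residual, residual, bgpAction_smul a h, smul_sub, smul_comm]
    refine ⟨a • u, h', ?_, ?_⟩
    · rw [norm_smul, ha, inv_mul_cancel₀ hu0.ne']
    · rw [e, norm_smul, ha, inv_mul_eq_div, div_le_iff₀ hu0]
      exact hu.le
  choose u h hu hf using this
  have hn : IsNull u := by
    refine null_of_residual h hz (IsBigO.of_bound 1 (Eventually.of_forall fun n => ?_)) ?_
    · simp [hu n]
    · rw [IsNull, isLittleO_one_iff]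
      refine squeeze_zero_norm hf ?_
      simpa only [one_div] using tendsto_one_div_add_atTop_nhds_zero_nat (𝕜 := ℝ)
  rw [IsNull, isLittleO_one_iff] at hn
  have := hn.norm
  simp [hu] at this

end estimate

/-! ### Continuation of the resolvent -/

section continuation

variable {X : Type*} [NormedAddCommGroup X] [NormedSpace ℂ X] {A : X →ₗ.[ℂ] X}

/-- The lower bound at `z` gives `‖R‖ ≤ c⁻¹`, and `z' - A = (1 + (z' - z) R) (z - A)` with an
invertible first factor. The radius depends on the lower bound alone, which is what the closedness
argument in `I_mul_mem_unboundedResolventSet` needs. -/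
lemma mem_unboundedResolventSet_of_norm_sub_lt [CompleteSpace X] {z z' : ℂ} {c : ℝ}
    (hb : ∀ u : A.domain, c * ‖(u : X)‖ ≤ ‖z • (u : X) - A u‖)
    (hz : z ∈ unboundedResolventSet A) (hzz : ‖z' - z‖ < c) : z' ∈ unboundedResolventSet A := by
  obtain ⟨R, h₁, h₂⟩ := hz
  have hc : 0 < c := (norm_nonneg _).trans_lt hzz
  have hR : ‖R‖ ≤ c⁻¹ := by
    refine R.opNorm_le_bound (inv_nonneg.2 hc.le) fun x => ?_
    obtain ⟨h, e⟩ := h₁ x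
    have := hb ⟨R x, h⟩
    rw [e] at this
    rwa [inv_mul_eq_div, le_div_iff₀ hc, mul_comm]
  have hB : ‖-((z' - z) • R)‖ < 1 := by
    rw [norm_neg, norm_smul]
    refine (mul_le_mul_of_nonneg_left hR (norm_nonneg _)).trans_lt ?_
    rwa [← div_eq_mul_inv, div_lt_one hc]
  let V := Units.oneSub _ hB
  have v₁ : ∀ x, (V⁻¹.1 : X →L[ℂ] X) x + (z' - z) • R ((V⁻¹.1 : X →L[ℂ] X) x) = x := by
    intro x
    have h : (V.1 * V⁻¹.1 : X →L[ℂ] X) x = x := by rw [V.mul_inv]; rfl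
    simpa [V] using h
  have v₂ : ∀ y, (V⁻¹.1 : X →L[ℂ] X) (y + (z' - z) • R y) = y := by
    intro y
    have h : (V⁻¹.1 * V.1 : X →L[ℂ] X) y = y := by rw [V.inv_mul]; rfl
    simpa [V] using h
  refine ⟨R.comp V⁻¹.1, fun x => ?_, fun u => ?_⟩
  · obtain ⟨h, e⟩ := h₁ ((V⁻¹.1 : X →L[ℂ] X) x)
    refine ⟨h, ?_⟩
    refine Eq.trans ?_ (v₁ x)
    rw [← sub_add_cancel z' z, add_smul, add_comm (_ • _), add_sub_right_comm]
    simp only [add_sub_cancel_right]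
    exact congrArg (· + _) e
  · have e : z' • (u : X) - A u =
        (z • (u : X) - A u) + (z' - z) • R (z • (u : X) - A u) := by
      rw [h₂]; module
    rw [ContinuousLinearMap.comp_apply, e, v₂, h₂]

/-- The lower bound gives injectivity and the norm bound `c⁻¹`; the resolvent at zero is minus the
inverse of `A`. -/
lemma zero_mem_unboundedResolventSet {c : ℝ} (hc : 0 < c)
    (hb : ∀ u : A.domain, c * ‖(u : X)‖ ≤ ‖A u‖) (hs : Function.Surjective A) :
    0 ∈ unboundedResolventSet A := by
  have hi : Function.Injective A.toFun := by
    rw [injective_iff_map_eq_zero]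
    intro u hu
    have := hb u
    rw [show A u = 0 from hu, norm_zero] at this
    exact Subtype.ext (norm_le_zero_iff.1 (nonpos_of_mul_nonpos_right this hc))
  let e := LinearEquiv.ofBijective A.toFun ⟨hi, hs⟩
  have he : ∀ x, A (e.symm x) = x := fun x => e.apply_symm_apply x
  let R : X →L[ℂ] X := (-(A.domain.subtype ∘ₗ e.symm.toLinearMap)).mkContinuous c⁻¹ fun x => by
    rw [inv_mul_eq_div, le_div_iff₀ hc, mul_comm]
    have := hb (e.symm x)
    rw [he] at this
    simpa using this
  have hR : ∀ x, R x = ((-e.symm x : A.domain) : X) := fun x => rfl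
  refine ⟨R, fun x => ⟨(-e.symm x).2, ?_⟩, fun u => ?_⟩
  · change (0 : ℂ) • _ - A (-e.symm x) = x
    rw [LinearPMap.map_neg, he, zero_smul, zero_sub, neg_neg]
  · rw [hR, zero_smul, zero_sub, map_neg, neg_neg]
    exact congrArg Subtype.val (e.symm_apply_apply u)

/-- If `i r - A` is bounded below for all real `r` and `A` is boundedly invertible, the imaginary
axis lies in the resolvent set. -/
lemma I_mul_mem_unboundedResolventSet [CompleteSpace X]
    (hb : ∀ r : ℝ, ∃ c > 0, ∀ u : A.domain,
      c * ‖(u : X)‖ ≤ ‖(Complex.I * (r : ℂ)) • (u : X) - A u‖)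
    (h0 : 0 ∈ unboundedResolventSet A) (r : ℝ) : Complex.I * (r : ℂ) ∈ unboundedResolventSet A := by
  have dist_eq : ∀ r s : ℝ, ‖Complex.I * (s : ℂ) - Complex.I * (r : ℂ)‖ = dist s r := by
    intro r s
    rw [← mul_sub, norm_mul, Complex.norm_I, one_mul, ← Complex.ofReal_sub, Complex.norm_real,
      Real.dist_eq, Real.norm_eq_abs]
  let s : Set ℝ := {r | Complex.I * (r : ℂ) ∈ unboundedResolventSet A}
  have ho : IsOpen s := by
    rw [Metric.isOpen_iff]
    intro r hr
    obtain ⟨c, hc, h⟩ := hb r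
    refine ⟨c, hc, fun t ht => mem_unboundedResolventSet_of_norm_sub_lt h hr ?_⟩
    rwa [dist_eq]
  have hcl : IsClosed s := by
    refine isClosed_of_closure_subset fun r hr => ?_
    obtain ⟨c, hc, h⟩ := hb r
    -- A point `t` of the set closer than `c / 2` to `r` inherits the lower bound `c / 2` from that
    -- at `r`, and this radius reaches back to `r`.
    obtain ⟨t, ht, htr⟩ := Metric.mem_closure_iff.1 hr (c / 2) (half_pos hc)
    rw [← dist_eq] at htr
    refine mem_unboundedResolventSet_of_norm_sub_lt (c := c / 2) (fun u => ?_) ht htr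
    have h1 := h u
    have h2 : (Complex.I * (r : ℂ)) • (u : X) - A u = ((Complex.I * (t : ℂ)) • (u : X) - A u) +
        (Complex.I * (r : ℂ) - Complex.I * (t : ℂ)) • (u : X) := by module
    rw [h2] at h1
    have h3 := norm_add_le ((Complex.I * (t : ℂ)) • (u : X) - A u)
      ((Complex.I * (r : ℂ) - Complex.I * (t : ℂ)) • (u : X))
    rw [norm_smul] at h3
    have h4 := mul_le_mul_of_nonneg_right htr.le (norm_nonneg (u : X))
    linarith
  have hne : s.Nonempty := ⟨0, by simpa [s] using h0⟩
  have h := IsClopen.eq_univ ⟨hcl, ho⟩ hne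
  exact eq_univ_iff_forall.1 h r

end continuation

end Bresse

end

theorem theorem7p7 (S : Bresse.BGPData) :
    ∀ r : ℝ, Complex.I * (r : ℂ) ∈ Bresse.unboundedResolventSet (Bresse.bgpGenerator S) := by
  have hb : ∀ r : ℝ, ∃ c > 0, ∀ u : (Bresse.bgpGenerator S).domain, c * ‖(u : Bresse.PhaseSpace S)‖
      ≤ ‖(Complex.I * (r : ℂ)) • (u : Bresse.PhaseSpace S) - Bresse.bgpGenerator S u‖ := by
    intro r
    obtain ⟨c, hc, h⟩ := Bresse.exists_norm_le_residual S (z := Complex.I * (r : ℂ)) (by simp)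
    exact ⟨c, hc, fun u => h u.1 u.2⟩
  obtain ⟨c, hc, h⟩ := hb 0
  refine Bresse.I_mul_mem_unboundedResolventSet hb
    (Bresse.zero_mem_unboundedResolventSet hc (fun u => ?_) fun f => ?_)
  · simpa using h u
  · obtain ⟨u, hu, e⟩ := Bresse.exists_bgpAction_eq f
    exact ⟨⟨u, hu⟩, e⟩
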